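/- Let $Z$ be a real Hilbert space, and let $A$ be a sectorial operator in $Z$ generating an exponentially stable (analytic) semigroup $e^{At}$. For $s\ge 0$ let $Z^s=\operatorname{ran}(-A)^{-s}$ with norm $\|x\|_s=\|(-A)^s x\|$, and let $Z^{-s}$ be the completion of $Z$ in the norm $\|(-A)^{-s}x\|$. Let $s_b,s_d,s_c\in[0,1)$ with $s_c+s_b<1$ and $s_c+s_d<1$, let $B_{\rm in}\in Z^{-s_b}$, $B_{\rm d}\in Z^{-s_d}$ (operators $\mathbb R\to Z^{-s_b}$, $\mathbb R\to Z^{-s_d}$) and $C\in\mathcal L(Z^{s_c},\mathbb R)$, and assume $G=C(-A)^{-1}B_{\rm in}\neq 0$. Put $B=B_{\rm in}G^{-1}$, $I_0=I+BCA^{-1}$ and, for $0<\beta<1$, $A_\beta=A-\frac{1-\beta}{\beta}BC$. Let $\beta$ be such that (the part in $Z$ of) $A_\beta$ generates an exponentially stable semigroup $e^{A_\beta t}$ on $Z$; the same symbol denotes its extension by continuity to $Z^{-s_b}$ and $Z^{-s_d}$. Let $0<s_1<1$, $\epsilon>0$, and let $f:Z\to Z$ satisfy $f(0)=0$ and $\|f(\varphi_1)-f(\varphi_2)\|\le\epsilon\|\varphi_1-\varphi_2\|_{s_1}$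 for $\varphi_1,\varphi_2\in Z^{s_1}$. Let $r,d\in C_b^1([0,\infty))$ be real-valued, $\bar z_0\in Z$, and let $\bar z^0$ be a mild solution on $[0,\infty)$, continuous in $Z^{s_1}$ for $t>0$ and with $\|\bar z^0\|_{s_1}$ locally integrable on $[0,\infty)$, of $$\bar z^0_t=A_\beta \bar z^0+I_0\big(f(\bar z^0)+B_{\rm d}d\big)+\tfrac1\beta Br,\qquad \bar z^0(0)=\bar z_0 ,$$ and let $e_0=r-C\bar z^0$. Put $K(t)=-\frac1\beta CA_\beta^{-1}e^{A_\beta t}B$, $K_d(t)=-CA_\beta^{-1}e^{A_\beta t}I_0B_{\rm d}$, $$D=\int_0^\infty|K(t)|\,dt,\quad D_d=\int_0^\infty|K_d(t)|\,dt,\quad D_H=\int_0^\infty\|Ce^{A_\beta t}I_0\|_{\mathcal L(Z,\mathbb R)}\,dt,$$ and, for $0<T\le\infty$, $$D_B(T)=\int_0^T\tfrac1\beta\|e^{A_\beta t}B\|_{s_1}dt,\quad D_{A_\beta}(T)=\int_0^T\|e^{A_\beta t}I_0\|_{\mathcal L(Z,Z^{s_1})}dt,\quad D_{B_{\rm d}}(T)=\int_0^T\|e^{A_\beta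 t}I_0B_{\rm d}\|_{s_1}dt,$$ $$\mathcal D(T)=D_H\,\frac{D_B(T)\,\epsilon}{1-\epsilon D_{A_\beta}(T)},\qquad \mathcal D_d(T)=D_H\,\frac{D_{B_{\rm d}}(T)\,\epsilon}{1-\epsilon D_{A_\beta}(T)} .$$ Assume $D_B(\infty)<\infty$, $D_{B_{\rm d}}(\infty)<\infty$ and $\epsilon D_{A_\beta}(\infty)<1$. Then $D$, $D_d$, $D_H$ are finite, and the following hold. (i) If the initial transients vanish, that is, $\bar z_0=0$ and $K(t)r(0)+K_d(t)d(0)=0$ for all $t>0$ (for instance if $\bar z_0=0$ and $r(0)=d(0)=0$), then for every $t>0$ $$\|e_0\|_{(0,t)}\le (D+\mathcal D(t))\,\|r\|_{1,(0,t)}+(D_d+\mathcal D_d(t))\,\|d\|_{1,(0,t)},$$ and hence also with $\mathcal D(\infty)$, $\mathcal D_d(\infty)$ in place of $\mathcal D(t)$, $\mathcal D_d(t)$. Here $\|\varphi\|_{(0,t)}=\sup_{(0,t)}|\varphi|$ and $\|\varphi\|_{1,(0,t)}=\max\{\|\varphi\|_{(0,t)},\|\varphi'\|_{(0,t)}\}$.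 (ii) For every $\bar z_0\in Z$, $$\limsup_{t\to\infty}|e_0(t)|\le (D+\mathcal D(\infty))\limsup\|r\|_1+(D_d+\mathcal D_d(\infty))\limsup\|d\|_1,$$ where $\limsup\|\varphi\|_1=\max\{\limsup_{t\to\infty}|\varphi(t)|,\limsup_{t\to\infty}|\varphi'(t)|\}$. -/

import Mathlib

open Set Filter Topology MeasureTheory
open scoped ENNReal

noncomputable section

namespace Regulation

variable {Z : Type*} [NormedAddCommGroup Z] [InnerProductSpace ℝ Z] [CompleteSpace Z]

/-- A strongly continuous semigroup of bounded operators on `Z`; only times `t ≥ 0` matter. -/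
structure C0Semigroup (Z : Type*) [NormedAddCommGroup Z] [InnerProductSpace ℝ Z]
    [CompleteSpace Z] where
  op : ℝ → Z →L[ℝ] Z
  op_zero : op 0 = ContinuousLinearMap.id ℝ Z
  op_add : ∀ s t : ℝ, 0 ≤ s → 0 ≤ t → op (s + t) = (op s).comp (op t)
  strong_cont : ∀ x : Z, ContinuousOn (fun t => op t x) (Ici 0)

/-- The infinitesimal generator of `T` is the operator with graph `Γ`. -/
def C0Semigroup.GeneratedBy (T : C0Semigroup Z) (Γ : Set (Z × Z)) : Prop :=
  ∀ x y : Z, (x, y) ∈ Γ ↔ Tendsto (fun t : ℝ => t⁻¹ • (T.op t x - x)) (𝓝[>] 0) (𝓝 y)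

/-- `‖T(t)‖ ≤ M e^{-ω t}` for some `M ≥ 1`, `ω > 0`. -/
def C0Semigroup.ExpStable (T : C0Semigroup Z) : Prop :=
  ∃ M ω : ℝ, 1 ≤ M ∧ 0 < ω ∧ ∀ t : ℝ, 0 ≤ t → ‖T.op t‖ ≤ M * Real.exp (-ω * t)

/-- For an exponentially stable semigroup `T = e^{At}` and `s ≥ 0`, the negative fractional power
`(-A)^{-s} x = Γ(s)⁻¹ ∫₀^∞ τ^{s-1} e^{Aτ} x dτ`, with `(-A)^0 = I`. In particular
`(-A)^{-1} x = ∫₀^∞ e^{Aτ} x dτ`. -/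
def C0Semigroup.negPow (T : C0Semigroup Z) (s : ℝ) (x : Z) : Z :=
  if s = 0 then x else (Real.Gamma s)⁻¹ • ∫ τ in Ioi (0 : ℝ), τ ^ (s - 1) • T.op τ x

/-- The norm `‖x‖_s = ‖(-A)^s x‖` of `Z^s = ran (-A)^{-s}`; it is `∞` if `x ∉ Z^s`. -/
def C0Semigroup.fracNorm (T : C0Semigroup Z) (s : ℝ) (x : Z) : ℝ≥0∞ :=
  ⨅ (y : Z) (_ : T.negPow s y = x), ‖y‖ₑ

/-- `lam` lies in the resolvent set of (the complexification of) `A` and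
`‖R(lam, A)‖ ≤ M / |lam|`. Vectors `x + i y` of the complexification are written as pairs, with
`‖x + i y‖² = ‖x‖² + ‖y‖²`, and `(lam - A)(x + i y) = u + i v` is split into its real and
imaginary parts. -/
def ResolventBound (A : Z →ₗ.[ℝ] Z) (lam : ℂ) (M : ℝ) : Prop :=
  (∀ u v : Z, ∃! p : A.domain × A.domain,
    lam.re • (p.1 : Z) - lam.im • (p.2 : Z) - A p.1 = u ∧
    lam.re • (p.2 : Z) + lam.im • (p.1 : Z) - A p.2 = v) ∧
  ∀ x y : A.domain,
    ‖lam‖ ^ 2 * (‖(x : Z)‖ ^ 2 + ‖(y : Z)‖ ^ 2) ≤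
      M ^ 2 * (‖lam.re • (x : Z) - lam.im • (y : Z) - A x‖ ^ 2 +
        ‖lam.re • (y : Z) + lam.im • (x : Z) - A y‖ ^ 2)

/-- `A` is sectorial of some angle `δ ∈ (0, π/2]`: for each `η ∈ (0, δ)` the resolvent is bounded
by `M_η / |lam|` on the closed sector `|arg lam| ≤ π/2 + δ - η`, `lam ≠ 0`. -/
def IsSectorial (A : Z →ₗ.[ℝ] Z) : Prop :=
  ∃ δ : ℝ, 0 < δ ∧ δ ≤ Real.pi / 2 ∧ ∀ η : ℝ, 0 < η → η < δ →
    ∃ M : ℝ, 1 ≤ M ∧ ∀ lam : ℂ, lam ≠ 0 → |lam.arg| ≤ Real.pi / 2 + δ - η →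
      ResolventBound A lam M

/-- The linear part of the single-input single-output plant
`z' = A z + f(z) + B_in u + B_d d`, `y = C z`.

For `0 ≤ s`, the completion `Z^{-s}` of `Z` in the norm `‖(-A)^{-s} x‖` is realized through the
isometry `(-A)^{-s} : Z^{-s} → Z`: an element of `Z^{-s}` is given by its image in `Z`, and `Z` is
embedded in `Z^{-s}` by `x ↦ (-A)^{-s} x`. Thus `B_in u = u • (-A)^{s_b} b` and
`B_d d = d • (-A)^{s_d} bd` with `b`, `bd` in `Z`.

`C` is a bounded functional on `Z^{s_c}`; its values off `Z^{s_c}` play no role. -/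
structure Plant (Z : Type*) [NormedAddCommGroup Z] [InnerProductSpace ℝ Z]
    [CompleteSpace Z] where
  A : Z →ₗ.[ℝ] Z
  T : C0Semigroup Z
  generates : T.GeneratedBy (A.graph : Set (Z × Z))
  sectorial : IsSectorial A
  stable : T.ExpStable
  sb : ℝ
  sd : ℝ
  sc : ℝ
  sb_mem : sb ∈ Ico (0 : ℝ) 1
  sd_mem : sd ∈ Ico (0 : ℝ) 1
  sc_mem : sc ∈ Ico (0 : ℝ) 1
  sc_add_sb : sc + sb < 1
  sc_add_sd : sc + sd < 1
  b : Z
  bd : Z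
  C : Z →ₗ[ℝ] ℝ
  C_bdd : ∃ c : ℝ, ∀ y : Z, |C (T.negPow sc y)| ≤ c * ‖y‖

namespace Plant

variable (P : Plant Z)

/-- `G = C (-A)^{-1} B_in`, where `(-A)^{-1} (-A)^{s_b} b = (-A)^{-(1 - s_b)} b`. -/
def G : ℝ := P.C (P.T.negPow (1 - P.sb) P.b)

/-- `B = B_in G⁻¹ ∈ Z^{-s_b}`, given by its image `(-A)^{-s_b} B` in `Z`. -/
def B : Z := P.G⁻¹ • P.b

/-- The graph of `A_β = A - ζ B C`, `ζ = (1 - β)/β`, as an operator in `Z`: the domain is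
`{w ∈ Z^{s_c} : A w - ζ (C w) B ∈ Z}`, where `A w` and `B` are taken in the extrapolation space
`Z^{-1}`. The identity `A w - ζ (C w) B = y` is written after applying the injective map `(-A)^{-1}`
to both sides, that is, as `- w - ζ (C w) (-A)^{-1} B = (-A)^{-1} y`. -/
def regGraph (β : ℝ) : Set (Z × Z) :=
  {p | p.1 ∈ range (P.T.negPow P.sc) ∧
    -p.1 - ((1 - β) / β * P.C p.1) • P.T.negPow (1 - P.sb) P.B = P.T.negPow 1 p.2}

/-- `S(t)` extended by continuity to the element of `Z^{-s}` whose image under `(-A)^{-s}` is `v`: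
the limit of `S(t) x` in `Z` as `x ∈ Z` tends to that element in the norm of `Z^{-s}`
(used for `t > 0`). -/
def extOp (S : C0Semigroup Z) (s t : ℝ) (v : Z) : Z :=
  limUnder (comap (P.T.negPow s) (𝓝 v)) (fun x => S.op t x)

/-! In the following `S` stands for the semigroup `e^{A_β t}`. -/

/-- `e^{A_β t} B`. -/
def SB (S : C0Semigroup Z) (t : ℝ) : Z := P.extOp S P.sb t P.B

/-- `e^{A_β t} I_0 x` for `x ∈ Z`, with `I_0 = I + B C A⁻¹`. -/
def SI0 (S : C0Semigroup Z) (t : ℝ) (x : Z) : Z :=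
  S.op t x + (-P.C (P.T.negPow 1 x)) • P.SB S t

/-- `e^{A_β t} I_0 B_d`, with `C A⁻¹ B_d = -C (-A)^{-(1 - s_d)} bd`. -/
def SI0Bd (S : C0Semigroup Z) (t : ℝ) : Z :=
  P.extOp S P.sd t P.bd + (-P.C (P.T.negPow (1 - P.sd) P.bd)) • P.SB S t

/-- `K(t) = -(1/β) C A_β⁻¹ e^{A_β t} B`. -/
def K (β : ℝ) (S : C0Semigroup Z) (t : ℝ) : ℝ := β⁻¹ * P.C (S.negPow 1 (P.SB S t))

/-- `K_d(t) = -C A_β⁻¹ e^{A_β t} I_0 B_d`. -/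
def Kd (S : C0Semigroup Z) (t : ℝ) : ℝ := P.C (S.negPow 1 (P.SI0Bd S t))

/-- `D = ∫₀^∞ |K(t)| dt`. -/
def D (β : ℝ) (S : C0Semigroup Z) : ℝ≥0∞ := ∫⁻ t in Ioi (0 : ℝ), ‖P.K β S t‖ₑ

/-- `D_d = ∫₀^∞ |K_d(t)| dt`. -/
def Dd (S : C0Semigroup Z) : ℝ≥0∞ := ∫⁻ t in Ioi (0 : ℝ), ‖P.Kd S t‖ₑ

/-- `D_H = ∫₀^∞ ‖C e^{A_β t} I_0‖ dt`, with the norm of `L(Z, ℝ)`. -/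
def DH (S : C0Semigroup Z) : ℝ≥0∞ :=
  ∫⁻ t in Ioi (0 : ℝ), ⨆ (x : Z) (_ : ‖x‖ ≤ 1), ‖P.C (P.SI0 S t x)‖ₑ

/-- `D_B = ∫_J ‖(1/β) e^{A_β t} B‖ dt`, with the norm of `L(ℝ, Z^{s₁})`. -/
def DB (β : ℝ) (S : C0Semigroup Z) (s₁ : ℝ) (J : Set ℝ) : ℝ≥0∞ :=
  ∫⁻ t in J, P.T.fracNorm s₁ (β⁻¹ • P.SB S t)

/-- `D_{A_β} = ∫_J ‖e^{A_β t} I_0‖ dt`, with the norm of `L(Z, Z^{s₁})`. -/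
def DA (S : C0Semigroup Z) (s₁ : ℝ) (J : Set ℝ) : ℝ≥0∞ :=
  ∫⁻ t in J, ⨆ (x : Z) (_ : ‖x‖ ≤ 1), P.T.fracNorm s₁ (P.SI0 S t x)

/-- `D_{B_d} = ∫_J ‖e^{A_β t} I_0 B_d‖ dt`, with the norm of `L(ℝ, Z^{s₁})`. -/
def DBd (S : C0Semigroup Z) (s₁ : ℝ) (J : Set ℝ) : ℝ≥0∞ :=
  ∫⁻ t in J, P.T.fracNorm s₁ (P.SI0Bd S t)

/-- `𝒟 = D_H · D_B ε / (1 - ε D_{A_β})`. -/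
def calD (β : ℝ) (S : C0Semigroup Z) (s₁ ε : ℝ) (J : Set ℝ) : ℝ≥0∞ :=
  P.DH S * (P.DB β S s₁ J * ENNReal.ofReal ε / (1 - ENNReal.ofReal ε * P.DA S s₁ J))

/-- `𝒟_d = D_H · D_{B_d} ε / (1 - ε D_{A_β})`. -/
def calDd (S : C0Semigroup Z) (s₁ ε : ℝ) (J : Set ℝ) : ℝ≥0∞ :=
  P.DH S * (P.DBd S s₁ J * ENNReal.ofReal ε / (1 - ENNReal.ofReal ε * P.DA S s₁ J))

/-- `z` is a mild solution on `[0, ∞)`, continuous in `Z^{s₁}` for `t > 0` and with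
`∫₀^t ‖z‖_{s₁} < ∞`, of
`z' = A_β z + I_0 (f(z) + B_d d) + (1/β) B r`, `z(0) = z₀`. Here `y` is `(-A)^{s₁} z`. -/
def IsMildSolution (β : ℝ) (S : C0Semigroup Z) (s₁ : ℝ) (f : Z → Z) (r d : ℝ → ℝ) (z₀ : Z)
    (z : ℝ → Z) : Prop :=
  (∃ y : ℝ → Z, (∀ t, 0 < t → z t = P.T.negPow s₁ (y t)) ∧ ContinuousOn y (Ioi 0) ∧
    ∀ t, 0 < t → IntegrableOn y (Ioc 0 t)) ∧
  ∀ t, 0 ≤ t →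
    IntervalIntegrable (fun τ => (β⁻¹ * r τ) • P.SB S (t - τ) + d τ • P.SI0Bd S (t - τ))
      volume 0 t ∧
    IntervalIntegrable (fun τ => P.SI0 S (t - τ) (f (z τ))) volume 0 t ∧
    z t = S.op t z₀ +
      (∫ τ in (0 : ℝ)..t, ((β⁻¹ * r τ) • P.SB S (t - τ) + d τ • P.SI0Bd S (t - τ))) +
      ∫ τ in (0 : ℝ)..t, P.SI0 S (t - τ) (f (z τ))

end Plant

/-- `φ ∈ C_b^1([0, ∞))`. -/
def IsCb1 (φ : ℝ → ℝ) : Prop :=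
  ContDiffOn ℝ 1 φ (Ici 0) ∧
    ∃ M : ℝ, ∀ t, 0 ≤ t → |φ t| ≤ M ∧ |derivWithin φ (Ici 0) t| ≤ M

/-- `‖φ‖_I = sup_I |φ|`. -/
def supNorm (φ : ℝ → ℝ) (I : Set ℝ) : ℝ≥0∞ := ⨆ t ∈ I, ‖φ t‖ₑ

/-- `‖φ‖_{1, I} = max (sup_I |φ|) (sup_I |φ'|)`. -/
def supNorm1 (φ : ℝ → ℝ) (I : Set ℝ) : ℝ≥0∞ :=
  max (supNorm φ I) (supNorm (derivWithin φ (Ici 0)) I)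

/-- `limsup_{t → ∞} |φ(t)|`. -/
def limsupNorm (φ : ℝ → ℝ) : ℝ≥0∞ := limsup (fun t => ‖φ t‖ₑ) atTop

/-- `limsup ‖φ‖_1 = max (limsup |φ|) (limsup |φ'|)`. -/
def limsupNorm1 (φ : ℝ → ℝ) : ℝ≥0∞ :=
  max (limsupNorm φ) (limsupNorm (derivWithin φ (Ici 0)))

end Regulation

end

noncomputable section

namespace Regulation

set_option linter.unusedSectionVars false

variable {Z : Type*} [NormedAddCommGroup Z] [InnerProductSpace ℝ Z] [CompleteSpace Z]

/-! Since `B` is normalised so that C(-A)⁻¹B = 1, applying C to the generator relation of A_β gives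
C(-A_β)⁻¹ = β C(-A)⁻¹ (`C_negPowL_one`). In equilibrium the input (1/β)Br therefore produces the
output r, and the factor I₀ makes the disturbance B_d d invisible to C. In the time-dependent
problem the variation of constants integral is integrated by parts (`linear_response`,
`C_linear_part`). The boundary terms at time t are exactly r(t) for the reference and 0 for the
disturbance, so e₀ consists of initial transients, the convolutions of K with r' and of K_d with d',
and the output of the nonlinear term. The convolutions account for D and D_d. The nonlinear output
is at most ε times the convolution of ‖C e^{A_β t} I₀‖ with ‖z‖_{s₁}.

For ‖z‖_{s₁} the same formula gives a convolution inequality whose kernel has mass ε D_{A_β} < 1. A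
Gronwall argument for such kernels (`le_of_le_add_conv`, and `limsup_le_of_le_add_conv` at infinity)
divides by 1 - ε D_{A_β}, which produces 𝒟 and 𝒟_d.

The analytic work is to bound these kernels. Sectoriality gives ‖e^{At}y‖ ≤ (c/t)‖A⁻¹y‖ by Fourier
inversion of a Laplace transform (`norm_op_le_div`), and then fractional smoothing of every order s
< 1 (`norm_op_le_rpow`). The semigroup e^{A_β t} satisfies a Volterra equation over e^{At}
(`volterra`) whose feedback singularity t^{-(s_c+s_b)} is integrable, so the smoothing estimates
carry over for short times (`short_time`) and, by exponential stability, for all times with weights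
c(1 + t^{-p})e^{-ωt}.

The scale of spaces is handled through the injective operators L = (-A)^{-s} with dense range. The
norm of Z^s is the range norm `imgNorm L`, which has a dual description (`imgNorm_le_iff`) yielding
measurability, Minkowski's inequality and the passage of C under integrals. Operators on Z^{-s} are
continuous extensions along L (`extL`). -/

theorem exists_clm_integral {E : ℝ → Z →L[ℝ] Z} {ψ : ℝ → ℝ}
    (hE : ∀ x, AEStronglyMeasurable (fun τ => E τ x) (volume.restrict (Ioi 0)))
    (hψ : IntegrableOn ψ (Ioi 0)) (hb : ∀ τ, 0 < τ → ∀ x, ‖E τ x‖ ≤ ψ τ * ‖x‖) :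
    (∀ x, IntegrableOn (fun τ => E τ x) (Ioi 0)) ∧
      ∃ L : Z →L[ℝ] Z, ∀ x, L x = ∫ τ in Ioi (0 : ℝ), E τ x := by
  have hintg : ∀ x, IntegrableOn (fun τ => E τ x) (Ioi 0) := fun x =>
    (hψ.mul_const ‖x‖).mono' (hE x)
      ((ae_restrict_iff' measurableSet_Ioi).2 (Eventually.of_forall fun τ hτ => hb τ hτ x))
  refine ⟨hintg, LinearMap.mkContinuous
    { toFun := fun x => ∫ τ in Ioi (0 : ℝ), E τ x
      map_add' := fun x y => by
        simp only [map_add]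
        exact integral_add (hintg x) (hintg y)
      map_smul' := fun c x => by
        simp only [map_smul, RingHom.id_apply]
        exact integral_smul c _ } (∫ τ in Ioi (0 : ℝ), ψ τ) ?_, fun x => rfl⟩
  intro x
  simp only [LinearMap.coe_mk, AddHom.coe_mk]
  rw [← integral_mul_const]
  refine norm_integral_le_of_norm_le (hψ.mul_const ‖x‖) ?_
  exact (ae_restrict_iff' measurableSet_Ioi).2 (Eventually.of_forall fun τ hτ => hb τ hτ x)

theorem integrableOn_rpow_mul_exp {p ω : ℝ} (hp : -1 < p) (hω : 0 < ω) (M : ℝ) :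
    IntegrableOn (fun τ : ℝ => τ ^ p * (M * Real.exp (-ω * τ))) (Ioi 0) := by
  have h := (integrableOn_rpow_mul_exp_neg_mul_rpow hp one_pos hω).const_mul M
  simp only [Real.rpow_one] at h
  refine h.congr (Eventually.of_forall fun τ => ?_)
  simp only; ring

/-! ### Elementary theory of exponentially stable semigroups and their negative powers. -/

namespace C0Semigroup

variable {T : C0Semigroup Z}

theorem op_add_apply (T : C0Semigroup Z) {s t : ℝ} (hs : 0 ≤ s) (ht : 0 ≤ t) (x : Z) :
    T.op (s + t) x = T.op s (T.op t x) := by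
  rw [T.op_add s t hs ht]; rfl

theorem op_comm (T : C0Semigroup Z) {s t : ℝ} (hs : 0 ≤ s) (ht : 0 ≤ t) (x : Z) :
    T.op s (T.op t x) = T.op t (T.op s x) := by
  rw [← T.op_add_apply hs ht, ← T.op_add_apply ht hs, add_comm]

@[simp] theorem op_zero_apply (T : C0Semigroup Z) (x : Z) : T.op 0 x = x := by
  rw [T.op_zero]; rfl

theorem aestronglyMeasurable_op (T : C0Semigroup Z) (x : Z) :
    AEStronglyMeasurable (fun τ => T.op τ x) (volume.restrict (Ioi 0)) :=
  ((T.strong_cont x).mono Ioi_subset_Ici_self).aestronglyMeasurable measurableSet_Ioi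

theorem aestronglyMeasurable_smul_op (T : C0Semigroup Z) {φ : ℝ → ℝ} (hφ : ContinuousOn φ (Ioi 0))
    (x : Z) : AEStronglyMeasurable (fun τ => φ τ • T.op τ x) (volume.restrict (Ioi 0)) :=
  (hφ.smul ((T.strong_cont x).mono Ioi_subset_Ici_self)).aestronglyMeasurable measurableSet_Ioi

/-- The generator relation `A x = y`. -/
def Gen (T : C0Semigroup Z) (x y : Z) : Prop :=
  Tendsto (fun t : ℝ => t⁻¹ • (T.op t x - x)) (𝓝[>] 0) (𝓝 y)

theorem ExpStable.norm_le (hT : T.ExpStable) :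
    ∃ M ω : ℝ, 1 ≤ M ∧ 0 < ω ∧ ∀ t : ℝ, 0 ≤ t → ∀ x, ‖T.op t x‖ ≤ M * Real.exp (-ω * t) * ‖x‖ := by
  obtain ⟨M, ω, hM, hω, h⟩ := hT
  exact ⟨M, ω, hM, hω, fun t ht x => (T.op t).le_of_opNorm_le (h t ht) x⟩

theorem ExpStable.bounded (hT : T.ExpStable) :
    ∃ M : ℝ, 1 ≤ M ∧ ∀ t : ℝ, 0 ≤ t → ∀ x, ‖T.op t x‖ ≤ M * ‖x‖ := by
  obtain ⟨M, ω, hM, hω, h⟩ := hT.norm_le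
  refine ⟨M, hM, fun t ht x => (h t ht x).trans ?_⟩
  gcongr
  exact mul_le_of_le_one_right (by linarith) (Real.exp_le_one_iff.2 (by nlinarith))

theorem ExpStable.tendsto_op {ι : Type*} {l : Filter ι} (hT : T.ExpStable) {s : ι → ℝ} {s₀ : ℝ}
    {x : ι → Z} {x₀ : Z} (hs : Tendsto s l (𝓝 s₀)) (hs' : ∀ᶠ i in l, 0 ≤ s i) (hs₀ : 0 ≤ s₀)
    (hx : Tendsto x l (𝓝 x₀)) : Tendsto (fun i => T.op (s i) (x i)) l (𝓝 (T.op s₀ x₀)) := by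
  obtain ⟨M, hM, h⟩ := hT.bounded
  have h1 : Tendsto (fun i => T.op (s i) x₀) l (𝓝 (T.op s₀ x₀)) :=
    (T.strong_cont x₀ s₀ hs₀).tendsto.comp (tendsto_nhdsWithin_iff.2 ⟨hs, hs'⟩)
  have h2 : Tendsto (fun i => T.op (s i) (x i - x₀)) l (𝓝 0) := by
    refine squeeze_zero_norm' (a := fun i => M * ‖x i - x₀‖) ?_ ?_
    · filter_upwards [hs'] with i hi using h _ hi _
    · simpa using ((tendsto_iff_norm_sub_tendsto_zero.1 hx).const_mul M)
  simpa using h2.add h1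

theorem integrableOn_smul_op {M ω : ℝ}
    (h : ∀ t : ℝ, 0 ≤ t → ∀ x, ‖T.op t x‖ ≤ M * Real.exp (-ω * t) * ‖x‖) {φ : ℝ → ℝ}
    (hφ : ContinuousOn φ (Ioi 0))
    (hψ : IntegrableOn (fun τ => |φ τ| * (M * Real.exp (-ω * τ))) (Ioi 0)) :
    (∀ x, IntegrableOn (fun τ => φ τ • T.op τ x) (Ioi 0)) ∧
      ∃ L : Z →L[ℝ] Z, ∀ x, L x = ∫ τ in Ioi (0 : ℝ), φ τ • T.op τ x := by
  refine exists_clm_integral (E := fun τ => φ τ • T.op τ)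
    (fun x => T.aestronglyMeasurable_smul_op hφ x) hψ ?_
  intro τ hτ x
  rw [smul_apply, norm_smul, mul_assoc, Real.norm_eq_abs]
  exact mul_le_mul_of_nonneg_left (h τ hτ.le x) (abs_nonneg _)

theorem continuousOn_rpow_Ioi (p : ℝ) : ContinuousOn (fun τ : ℝ => τ ^ p) (Ioi 0) :=
  fun τ hτ => (Real.continuousAt_rpow_const τ p (Or.inl (ne_of_gt hτ))).continuousWithinAt

theorem ExpStable.integrableOn_rpow_smul_op (hT : T.ExpStable) {s : ℝ} (hs : 0 < s) :
    (∀ x, IntegrableOn (fun τ => τ ^ (s - 1) • T.op τ x) (Ioi 0)) ∧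
      ∃ L : Z →L[ℝ] Z, ∀ x, L x = ∫ τ in Ioi (0 : ℝ), τ ^ (s - 1) • T.op τ x := by
  obtain ⟨M, ω, hM, hω, h⟩ := hT.norm_le
  refine integrableOn_smul_op h (continuousOn_rpow_Ioi _)
    ((integrableOn_rpow_mul_exp (p := s - 1) (by linarith) hω M).congr_fun ?_ measurableSet_Ioi)
  intro τ hτ
  simp only
  rw [abs_of_nonneg (Real.rpow_nonneg (le_of_lt hτ) _)]

theorem ExpStable.integrableOn_op (hT : T.ExpStable) (x : Z) :
    IntegrableOn (fun τ => T.op τ x) (Ioi 0) := by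
  simpa using (hT.integrableOn_rpow_smul_op one_pos).1 x

theorem ExpStable.exists_negPow_clm (hT : T.ExpStable) {s : ℝ} (hs : 0 ≤ s) :
    ∃ L : Z →L[ℝ] Z, ∀ x, L x = T.negPow s x := by
  rcases hs.eq_or_lt with rfl | hs
  · exact ⟨ContinuousLinearMap.id ℝ Z, fun x => by simp [negPow]⟩
  · obtain ⟨L, hL⟩ := (hT.integrableOn_rpow_smul_op hs).2
    exact ⟨(Real.Gamma s)⁻¹ • L, fun x => by simp [negPow, hs.ne', hL]⟩

open Classical in
/-- `(-A)^{-s}` as a bounded operator. -/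
def negPowL (T : C0Semigroup Z) (s : ℝ) : Z →L[ℝ] Z :=
  if h : ∃ L : Z →L[ℝ] Z, ∀ x, L x = T.negPow s x then h.choose else 0

theorem ExpStable.negPowL_apply (hT : T.ExpStable) {s : ℝ} (hs : 0 ≤ s) (x : Z) :
    T.negPowL s x = T.negPow s x := by
  have h := hT.exists_negPow_clm hs
  rw [negPowL, dif_pos h]
  exact h.choose_spec x

theorem ExpStable.coe_negPowL (hT : T.ExpStable) {s : ℝ} (hs : 0 ≤ s) :
    ⇑(T.negPowL s) = T.negPow s := funext fun x => hT.negPowL_apply hs x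

theorem ExpStable.negPowL_of_pos (hT : T.ExpStable) {s : ℝ} (hs : 0 < s) (x : Z) :
    T.negPowL s x = (Real.Gamma s)⁻¹ • ∫ τ in Ioi (0 : ℝ), τ ^ (s - 1) • T.op τ x := by
  rw [hT.negPowL_apply hs.le, negPow, if_neg hs.ne']

theorem ExpStable.negPowL_zero (hT : T.ExpStable) (x : Z) : T.negPowL 0 x = x := by
  rw [hT.negPowL_apply le_rfl, negPow, if_pos rfl]

theorem ExpStable.negPowL_one (hT : T.ExpStable) (x : Z) :
    T.negPowL 1 x = ∫ τ in Ioi (0 : ℝ), T.op τ x := by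
  rw [hT.negPowL_of_pos one_pos]; simp

theorem ExpStable.clm_negPowL (hT : T.ExpStable) {s : ℝ} (hs : 0 < s) (L : Z →L[ℝ] Z) (x : Z) :
    L (T.negPowL s x) = (Real.Gamma s)⁻¹ • ∫ τ in Ioi (0 : ℝ), τ ^ (s - 1) • L (T.op τ x) := by
  rw [hT.negPowL_of_pos hs, map_smul, ← ContinuousLinearMap.integral_comp_comm _
    ((hT.integrableOn_rpow_smul_op hs).1 x)]
  simp

/-- Operators commuting with the semigroup commute with the negative powers. -/
theorem ExpStable.negPowL_comm (hT : T.ExpStable) {s : ℝ} (hs : 0 ≤ s) {L : Z →L[ℝ] Z}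
    (hL : ∀ t, 0 < t → ∀ x, L (T.op t x) = T.op t (L x)) (x : Z) :
    L (T.negPowL s x) = T.negPowL s (L x) := by
  rcases hs.eq_or_lt with rfl | hs
  · simp [hT.negPowL_zero]
  · rw [hT.clm_negPowL hs, hT.negPowL_of_pos hs]
    congr 1
    exact setIntegral_congr_fun measurableSet_Ioi fun τ hτ => by rw [hL τ hτ]

theorem ExpStable.op_negPowL (hT : T.ExpStable) {s t : ℝ} (hs : 0 ≤ s) (ht : 0 ≤ t) (x : Z) :
    T.op t (T.negPowL s x) = T.negPowL s (T.op t x) :=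
  hT.negPowL_comm hs (fun _ hτ y => T.op_comm ht hτ.le y) x

theorem ExpStable.op_negPowL_one (hT : T.ExpStable) {t : ℝ} (ht : 0 ≤ t) (x : Z) :
    T.op t (T.negPowL 1 x) = ∫ τ in Ioi t, T.op τ x := by
  rw [hT.negPowL_one, ← ContinuousLinearMap.integral_comp_comm _ (hT.integrableOn_op x)]
  have h := integral_add_right_eq_self (μ := volume)
    ((Ioi t).indicator fun τ => T.op τ x) t
  rw [integral_indicator measurableSet_Ioi] at h
  rw [← h, ← integral_indicator measurableSet_Ioi]
  congr 1
  ext τ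
  by_cases hτ : 0 < τ
  · rw [indicator_of_mem (show τ ∈ Ioi 0 from hτ), indicator_of_mem (by simpa using hτ), add_comm,
      T.op_add_apply ht hτ.le]
  · rw [indicator_of_notMem (show τ ∉ Ioi 0 from hτ), indicator_of_notMem (by simpa using hτ)]

theorem ExpStable.negPowL_one_sub_op (hT : T.ExpStable) {t : ℝ} (ht : 0 ≤ t) (x : Z) :
    T.negPowL 1 x - T.op t (T.negPowL 1 x) = ∫ τ in (0 : ℝ)..t, T.op τ x := by
  rw [hT.op_negPowL_one ht, hT.negPowL_one, intervalIntegral.integral_Ioi_sub_Ioi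
    (hT.integrableOn_op x) ht]

theorem tendsto_average_op (T : C0Semigroup Z) (x : Z) :
    Tendsto (fun t : ℝ => t⁻¹ • ∫ τ in (0 : ℝ)..t, T.op τ x) (𝓝[>] 0) (𝓝 x) := by
  have h := intervalIntegral.integral_hasDerivWithinAt_right (a := 0) (b := 0)
    (f := fun τ => T.op τ x) (s := Ici 0) (t := Ioi 0) (by simp)
    (by
      refine ⟨Ioi 0, self_mem_nhdsWithin, T.aestronglyMeasurable_op x⟩)
    ((T.strong_cont x 0 self_mem_Ici).mono Ioi_subset_Ici_self)
  have h2 := (hasDerivWithinAt_iff_tendsto_slope.1 h)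
  simp only [op_zero_apply, Ici_sdiff_left] at h2
  refine h2.congr fun t => ?_
  simp [slope]

theorem ExpStable.gen_negPowL_one (hT : T.ExpStable) (x : Z) : T.Gen (T.negPowL 1 x) (-x) := by
  refine ((T.tendsto_average_op x).neg).congr' ?_
  filter_upwards [self_mem_nhdsWithin] with t ht
  rw [← hT.negPowL_one_sub_op (le_of_lt ht), ← smul_neg, neg_sub]

/-- The generator maps `T.negPowL 1 x` to `-x`, so a vanishing image forces `x = 0` by uniqueness of
limits. -/
theorem ExpStable.negPowL_one_injective (hT : T.ExpStable) :
    Function.Injective (T.negPowL 1) := by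
  rw [injective_iff_map_eq_zero]
  intro x hx
  have h := hT.gen_negPowL_one x
  rw [hx, Gen] at h
  simp only [map_zero, sub_zero, smul_zero] at h
  simpa using (tendsto_nhds_unique h tendsto_const_nhds)

/-- The averages of an orbit over [0, t] lie in the range and converge to the initial value as t →
0. -/
theorem ExpStable.denseRange_negPowL_one (hT : T.ExpStable) : DenseRange (T.negPowL 1) := by
  intro x
  refine mem_closure_of_tendsto (T.tendsto_average_op x) ?_
  filter_upwards [self_mem_nhdsWithin] with t ht
  rw [← hT.negPowL_one_sub_op (le_of_lt ht), hT.op_negPowL zero_le_one (le_of_lt ht), ← map_sub,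
    ← map_smul]
  exact mem_range_self _

theorem gen_map {x y : Z} (h : T.Gen x y) {L : Z →L[ℝ] Z}
    (hL : ∀ t, 0 < t → ∀ x, L (T.op t x) = T.op t (L x)) : T.Gen (L x) (L y) := by
  refine ((L.continuous.tendsto y).comp h).congr' ?_
  filter_upwards [self_mem_nhdsWithin] with t ht
  simp [hL t ht]

/-- The right derivative follows from the semigroup law alone, and it is all that the version of the
fundamental theorem of calculus used below needs. -/
theorem hasDerivWithinAt_op {x y : Z} (h : T.Gen x y) {t : ℝ} (ht : 0 ≤ t) :
    HasDerivWithinAt (fun τ => T.op τ x) (T.op t y) (Ioi t) t := by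
  rw [hasDerivWithinAt_iff_tendsto_slope' self_notMem_Ioi]
  have h1 := ((T.op t).continuous.tendsto y).comp h
  have h2 : Tendsto (fun s => s - t) (𝓝[>] t) (𝓝[>] 0) := by
    refine tendsto_nhdsWithin_iff.2 ⟨?_, ?_⟩
    · exact ((continuous_id.sub continuous_const).tendsto' t 0 (sub_self t)).mono_left
        nhdsWithin_le_nhds
    · filter_upwards [self_mem_nhdsWithin] with s hs
      exact sub_pos.2 (mem_Ioi.1 hs)
  refine (h1.comp h2).congr' ?_
  filter_upwards [self_mem_nhdsWithin] with s hs
  have hs' : 0 ≤ s - t := sub_nonneg.2 (le_of_lt hs)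
  have : T.op s x = T.op t (T.op (s - t) x) := by
    rw [← T.op_add_apply ht hs']; congr 2; ring
  simp [slope, this]

theorem ExpStable.tendsto_op_atTop (hT : T.ExpStable) (x : Z) :
    Tendsto (fun t => T.op t x) atTop (𝓝 0) := by
  obtain ⟨M, ω, hM, hω, h⟩ := hT.norm_le
  refine squeeze_zero_norm' (a := fun t => M * Real.exp (-ω * t) * ‖x‖) ?_ ?_
  · filter_upwards [eventually_ge_atTop 0] with t ht using h t ht x
  · have : Tendsto (fun t => Real.exp (-ω * t)) atTop (𝓝 0) :=
      Real.tendsto_exp_atBot.comp (tendsto_id.const_mul_atTop_of_neg (by linarith))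
    simpa using (this.const_mul M).mul_const ‖x‖

end C0Semigroup

/-! ### The law of exponents, by way of the Beta integral. -/

theorem integral_rpow_mul_sub_rpow {a b u : ℝ} (ha : 0 < a) (hb : 0 < b) (hu : 0 < u) :
    ∫ σ in (0 : ℝ)..u, σ ^ (a - 1) * (u - σ) ^ (b - 1) =
      u ^ (a + b - 1) * ProbabilityTheory.beta a b := by
  have h := Complex.betaIntegral_scaled (a : ℂ) (b : ℂ) hu
  rw [Complex.betaIntegral_eq_Gamma_mul_div _ _ (by simpa) (by simpa)] at h
  have h1 : ∫ σ in (0 : ℝ)..u, (σ : ℂ) ^ ((a : ℂ) - 1) * ((u : ℂ) - σ) ^ ((b : ℂ) - 1) =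
      ∫ σ in (0 : ℝ)..u, ((σ ^ (a - 1) * (u - σ) ^ (b - 1) : ℝ) : ℂ) := by
    refine intervalIntegral.integral_congr fun σ hσ => ?_
    rw [uIcc_of_le hu.le] at hσ
    rw [Complex.ofReal_mul, Complex.ofReal_cpow hσ.1, Complex.ofReal_cpow (sub_nonneg.2 hσ.2)]
    push_cast; rfl
  rw [h1, intervalIntegral.integral_ofReal] at h
  have h2 : (u : ℂ) ^ ((a : ℂ) + b - 1) *
      (Complex.Gamma a * Complex.Gamma b / Complex.Gamma (a + b)) =
      ((u ^ (a + b - 1) * ProbabilityTheory.beta a b : ℝ) : ℂ) := by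
    rw [Complex.ofReal_mul, Complex.ofReal_cpow hu.le, ProbabilityTheory.beta]
    simp only [Complex.ofReal_div, Complex.ofReal_mul, ← Complex.Gamma_ofReal]
    push_cast; rfl
  rw [h2] at h
  exact_mod_cast h

/-- The integral of a nonintegrable function is 0 by convention, whereas the value just computed is
positive. -/
theorem intervalIntegrable_rpow_mul_sub_rpow {a b u : ℝ} (ha : 0 < a) (hb : 0 < b) (hu : 0 < u) :
    IntervalIntegrable (fun σ : ℝ => σ ^ (a - 1) * (u - σ) ^ (b - 1)) volume 0 u := by
  by_contra h
  have h1 := integral_rpow_mul_sub_rpow ha hb hu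
  rw [intervalIntegral.integral_undef h] at h1
  have := mul_pos (Real.rpow_pos_of_pos hu (a + b - 1)) (ProbabilityTheory.beta_pos ha hb)
  linarith

namespace C0Semigroup

variable {T : C0Semigroup Z}

/-- Fubini with u = σ + τ leaves the scalar Beta integral over 0 < σ < u. For integrability on the
product, the decay of the semigroup is distributed over the two powers, making both `f` and `g`
integrable, while the compensating factor e^{ωu} is put into `H`, which stays bounded. -/
theorem ExpStable.integral_integral_rpow_smul_op (hT : T.ExpStable) {a b : ℝ} (ha : 0 < a)
    (hb : 0 < b) (x : Z) :
    ∫ σ in Ioi (0 : ℝ), σ ^ (a - 1) • T.op σ (∫ τ in Ioi (0 : ℝ), τ ^ (b - 1) • T.op τ x) =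
      ProbabilityTheory.beta a b • ∫ u in Ioi (0 : ℝ), u ^ (a + b - 1) • T.op u x := by
  obtain ⟨M, ω, hM, hω, h⟩ := hT.norm_le
  set f : ℝ → ℝ := (Ioi 0).indicator fun σ => σ ^ (a - 1) * Real.exp (-ω * σ) with hf
  set g : ℝ → ℝ := (Ioi 0).indicator fun σ => σ ^ (b - 1) * Real.exp (-ω * σ) with hg
  set H : ℝ → Z := (Ioi 0).indicator fun u => Real.exp (ω * u) • T.op u x with hH
  have hfi : Integrable f := by
    have := integrableOn_rpow_mul_exp (p := a - 1) (by linarith) hω 1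
    simpa only [one_mul] using this.integrable_indicator measurableSet_Ioi
  have hgi : Integrable g := by
    have := integrableOn_rpow_mul_exp (p := b - 1) (by linarith) hω 1
    simpa only [one_mul] using this.integrable_indicator measurableSet_Ioi
  have hHm : AEStronglyMeasurable H volume := by
    rw [hH, aestronglyMeasurable_indicator_iff measurableSet_Ioi]
    exact T.aestronglyMeasurable_smul_op (by fun_prop) x
  have hHb : ∀ u, ‖H u‖ ≤ M * ‖x‖ := by
    intro u
    by_cases hu : u ∈ Ioi (0 : ℝ)
    · rw [hH, indicator_of_mem hu, norm_smul, Real.norm_eq_abs, abs_of_pos (Real.exp_pos _)]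
      calc _ ≤ Real.exp (ω * u) * (M * Real.exp (-ω * u) * ‖x‖) := by
            gcongr; exact h u (le_of_lt hu) x
        _ = (Real.exp (ω * u) * Real.exp (-ω * u)) * (M * ‖x‖) := by ring
        _ = M * ‖x‖ := by rw [← Real.exp_add]; simp
    · rw [hH, indicator_of_notMem hu, norm_zero]; positivity
  have hconv := hfi.convolution_integrand (ContinuousLinearMap.mul ℝ ℝ) hgi
  simp only [ContinuousLinearMap.mul_apply'] at hconv
  have hintg : Integrable (fun p : ℝ × ℝ => (f p.2 * g (p.1 - p.2)) • H p.1)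
      ((volume : Measure ℝ).prod volume) := by
    refine (hconv.norm.mul_const (M * ‖x‖)).mono'
      (hconv.aestronglyMeasurable.smul hHm.comp_fst) (Eventually.of_forall fun p => ?_)
    rw [norm_smul]
    exact mul_le_mul_of_nonneg_left (hHb _) (norm_nonneg _)
  have hswap := integral_integral_swap (f := fun u σ => (f σ * g (u - σ)) • H u) hintg
  have hL : ∀ σ, ∫ u, (f σ * g (u - σ)) • H u = (Ioi (0 : ℝ)).indicator
      (fun σ => σ ^ (a - 1) • T.op σ (∫ τ in Ioi (0 : ℝ), τ ^ (b - 1) • T.op τ x)) σ := by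
    intro σ
    by_cases hσ : σ ∈ Ioi (0 : ℝ)
    · rw [indicator_of_mem hσ, ← ContinuousLinearMap.integral_comp_comm _
        ((hT.integrableOn_rpow_smul_op hb).1 x), ← integral_smul,
        ← integral_indicator measurableSet_Ioi, ← integral_add_right_eq_self _ σ]
      congr 1
      ext τ
      by_cases hτ : τ ∈ Ioi (0 : ℝ)
      · have hστ : τ + σ ∈ Ioi (0 : ℝ) := add_pos (mem_Ioi.1 hτ) (mem_Ioi.1 hσ)
        rw [hf, hg, hH, indicator_of_mem hσ, add_sub_cancel_right, indicator_of_mem hτ,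
          indicator_of_mem hστ, indicator_of_mem hτ, map_smul, smul_smul, smul_smul, add_comm τ σ,
          T.op_add_apply (le_of_lt hσ) (le_of_lt hτ)]
        congr 1
        have : Real.exp (ω * (σ + τ)) = (Real.exp (-ω * σ) * Real.exp (-ω * τ))⁻¹ := by
          rw [← Real.exp_add, ← Real.exp_neg]; congr 1; ring
        rw [this]
        field_simp
      · rw [hg, add_sub_cancel_right, indicator_of_notMem hτ, indicator_of_notMem hτ]; simp
    · rw [indicator_of_notMem hσ, hf]
      simp [indicator_of_notMem hσ]
  have hR : ∀ u, ∫ σ, (f σ * g (u - σ)) • H u = (Ioi (0 : ℝ)).indicator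
      (fun u => ProbabilityTheory.beta a b • u ^ (a + b - 1) • T.op u x) u := by
    intro u
    rw [integral_smul_const]
    by_cases hu : u ∈ Ioi (0 : ℝ)
    · have : ∫ σ, f σ * g (u - σ) =
          Real.exp (-ω * u) * (u ^ (a + b - 1) * ProbabilityTheory.beta a b) := by
        rw [← integral_rpow_mul_sub_rpow ha hb hu, intervalIntegral.integral_of_le (le_of_lt hu),
          integral_Ioc_eq_integral_Ioo, ← integral_const_mul, ← integral_indicator measurableSet_Ioo]
        congr 1
        ext σ
        by_cases hσ : σ ∈ Ioo 0 u
        · rw [indicator_of_mem hσ, hf, hg, indicator_of_mem (mem_Ioi.2 hσ.1),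
            indicator_of_mem (mem_Ioi.2 (sub_pos.2 hσ.2))]
          have : Real.exp (-ω * u) = Real.exp (-ω * σ) * Real.exp (-ω * (u - σ)) := by
            rw [← Real.exp_add]; congr 1; ring
          rw [this]; ring
        · rw [indicator_of_notMem hσ]
          by_cases hσ0 : σ ∈ Ioi (0 : ℝ)
          · have : u - σ ∉ Ioi (0 : ℝ) := fun hc => hσ ⟨hσ0, sub_pos.1 hc⟩
            rw [hg, indicator_of_notMem this, mul_zero]
          · rw [hf, indicator_of_notMem hσ0, zero_mul]
      rw [this, hH, indicator_of_mem hu, indicator_of_mem hu, smul_smul, smul_smul]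
      congr 1
      have : Real.exp (ω * u) = (Real.exp (-ω * u))⁻¹ := by rw [← Real.exp_neg]; congr 1; ring
      rw [this]
      field_simp
    · rw [hH, indicator_of_notMem hu, indicator_of_notMem hu, smul_zero]
  simp only [hL, hR] at hswap
  rw [integral_indicator measurableSet_Ioi, integral_indicator measurableSet_Ioi, integral_smul]
    at hswap
  exact hswap.symm

/-- The law of exponents `(-A)^{-a} (-A)^{-b} = (-A)^{-(a + b)}`. -/
theorem ExpStable.negPowL_negPowL (hT : T.ExpStable) {a b : ℝ} (ha : 0 ≤ a) (hb : 0 ≤ b) (x : Z) :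
    T.negPowL a (T.negPowL b x) = T.negPowL (a + b) x := by
  rcases ha.eq_or_lt with rfl | ha
  · rw [hT.negPowL_zero, zero_add]
  rcases hb.eq_or_lt with rfl | hb
  · rw [hT.negPowL_zero, add_zero]
  have hΓa := (Real.Gamma_pos_of_pos ha).ne'
  have hΓb := (Real.Gamma_pos_of_pos hb).ne'
  have h := hT.integral_integral_rpow_smul_op ha hb x
  rw [hT.negPowL_of_pos ha, hT.negPowL_of_pos hb, hT.negPowL_of_pos (add_pos ha hb)]
  simp only [map_smul, smul_comm _ (Real.Gamma b)⁻¹]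
  rw [integral_smul, h, smul_smul, smul_smul, ProbabilityTheory.beta]
  congr 1
  field_simp

theorem ExpStable.negPowL_injective (hT : T.ExpStable) {s : ℝ} (hs : 0 ≤ s) (hs1 : s ≤ 1) :
    Function.Injective (T.negPowL s) := by
  intro x y hxy
  apply hT.negPowL_one_injective
  have := hT.negPowL_negPowL (a := 1 - s) (b := s) (by linarith) hs
  rw [sub_add_cancel] at this
  rw [← this, ← this, hxy]

theorem ExpStable.denseRange_negPowL (hT : T.ExpStable) {s : ℝ} (hs : 0 ≤ s) (hs1 : s ≤ 1) :
    DenseRange (T.negPowL s) := by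
  refine hT.denseRange_negPowL_one.mono ?_
  rintro _ ⟨x, rfl⟩
  have := hT.negPowL_negPowL (a := s) (b := 1 - s) hs (by linarith) x
  rw [add_sub_cancel] at this
  exact ⟨_, this⟩

end C0Semigroup

/-! ### Laplace transforms, resolvent bounds and the smoothing property. -/

namespace C0Semigroup

variable {T : C0Semigroup Z}

/-- A continuous scalar function of at most quadratic growth on `[0, ∞)`. -/
def QuadGrowth (φ : ℝ → ℝ) : Prop := Continuous φ ∧ ∃ c, ∀ t, 0 ≤ t → |φ t| ≤ c * (1 + t ^ 2)

theorem ExpStable.integrableOn_quadGrowth (hT : T.ExpStable) {φ : ℝ → ℝ} (hφ : QuadGrowth φ) :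
    (∀ x, IntegrableOn (fun τ => φ τ • T.op τ x) (Ioi 0)) ∧
      ∃ L : Z →L[ℝ] Z, ∀ x, L x = ∫ τ in Ioi (0 : ℝ), φ τ • T.op τ x := by
  obtain ⟨M, ω, hM, hω, h⟩ := hT.norm_le
  obtain ⟨hc, c, hb⟩ := hφ
  refine integrableOn_smul_op h hc.continuousOn ?_
  have h1 := ((integrableOn_rpow_mul_exp (p := 0) (by norm_num) hω M).add
    (integrableOn_rpow_mul_exp (p := 2) (by norm_num) hω M)).const_mul c
  refine h1.mono' (by fun_prop) ((ae_restrict_iff' measurableSet_Ioi).2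
    (Eventually.of_forall fun τ hτ => ?_))
  have hpos : 0 ≤ M * Real.exp (-ω * τ) := by positivity
  rw [Real.norm_eq_abs, abs_mul, abs_abs, abs_of_nonneg hpos]
  simp only [Real.rpow_zero, Real.rpow_two, Pi.add_apply]
  calc _ ≤ c * (1 + τ ^ 2) * (M * Real.exp (-ω * τ)) :=
        mul_le_mul_of_nonneg_right (hb τ (le_of_lt hτ)) hpos
    _ = _ := by ring

theorem ExpStable.tendsto_quadGrowth (hT : T.ExpStable) {φ : ℝ → ℝ} (hφ : QuadGrowth φ) (x : Z) :
    Tendsto (fun t => φ t • T.op t x) atTop (𝓝 0) := by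
  obtain ⟨M, ω, hM, hω, h⟩ := hT.norm_le
  obtain ⟨hc, c, hb⟩ := hφ
  have h0 := (tendsto_rpow_mul_exp_neg_mul_atTop_nhds_zero 0 ω hω).add
    (tendsto_rpow_mul_exp_neg_mul_atTop_nhds_zero 2 ω hω)
  have h1 := h0.const_mul (c * M * ‖x‖)
  rw [add_zero, mul_zero] at h1
  refine squeeze_zero_norm' ?_ h1
  filter_upwards [eventually_ge_atTop 0] with t ht
  rw [norm_smul, Real.norm_eq_abs]
  simp only [Real.rpow_zero, Real.rpow_two]
  calc _ ≤ (c * (1 + t ^ 2)) * (M * Real.exp (-ω * t) * ‖x‖) :=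
        mul_le_mul (hb t ht) (h t ht x) (norm_nonneg _) ((abs_nonneg _).trans (hb t ht))
    _ = _ := by ring

/-- Integration by parts for φ(τ)T(τ)x; exponential decay beats quadratic growth, so only the
boundary term at 0 survives. -/
theorem ExpStable.integral_deriv_smul_add (hT : T.ExpStable) {x y : Z} (hxy : T.Gen x y)
    {φ φ' : ℝ → ℝ} (hd : ∀ t, HasDerivAt φ (φ' t) t) (hφ : QuadGrowth φ) (hφ' : QuadGrowth φ') :
    (∫ τ in Ioi (0 : ℝ), φ' τ • T.op τ x) + ∫ τ in Ioi (0 : ℝ), φ τ • T.op τ y = -(φ 0 • x) := by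
  have i1 := (hT.integrableOn_quadGrowth hφ').1 x
  have i2 := (hT.integrableOn_quadGrowth hφ).1 y
  rw [← integral_add i1 i2]
  refine tendsto_nhds_unique
    (intervalIntegral_tendsto_integral_Ioi 0 (i1.add i2) tendsto_id) ?_
  have h := (hT.tendsto_quadGrowth hφ x).sub_const (φ 0 • x)
  rw [zero_sub] at h
  refine h.congr' ?_
  filter_upwards [eventually_ge_atTop 0] with t ht
  have hsub : uIcc 0 t ⊆ Ici 0 := by rw [uIcc_of_le ht]; exact Icc_subset_Ici_self
  have := intervalIntegral.integral_eq_sub_of_hasDeriv_right_of_le ht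
    (f := fun τ => φ τ • T.op τ x) (f' := fun τ => φ' τ • T.op τ x + φ τ • T.op τ y)
    (hφ.1.continuousOn.smul ((T.strong_cont x).mono Icc_subset_Ici_self))
    (fun s hs => by
      have := (hd s).hasDerivWithinAt.smul (hasDerivWithinAt_op hxy hs.1.le)
      rwa [add_comm] at this)
    (((hφ'.1.continuousOn.smul ((T.strong_cont x).mono hsub)).add
      (hφ.1.continuousOn.smul ((T.strong_cont y).mono hsub))).intervalIntegrable)
  simp only [id, this, op_zero_apply]

/-- The real part of `t^k e^{-(a + i b) t}`. -/
def lapCos (a b : ℝ) (k : ℕ) (t : ℝ) : ℝ := t ^ k * Real.exp (-a * t) * Real.cos (b * t)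

/-- The negative of the imaginary part of `t^k e^{-(a + i b) t}`. -/
def lapSin (a b : ℝ) (k : ℕ) (t : ℝ) : ℝ := t ^ k * Real.exp (-a * t) * Real.sin (b * t)

theorem pow_le_one_add_sq {k : ℕ} (hk : k ≤ 2) (t : ℝ) : t ^ k ≤ 1 + t ^ 2 := by
  interval_cases k
  · nlinarith
  · nlinarith [sq_nonneg (t - 1)]
  · nlinarith

theorem quadGrowth_of_trig {a : ℝ} (ha : 0 ≤ a) {k : ℕ} (hk : k ≤ 2) {g : ℝ → ℝ} (hg : Continuous g)
    (hg1 : ∀ t, |g t| ≤ 1) : QuadGrowth fun t => t ^ k * Real.exp (-a * t) * g t := by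
  refine ⟨by fun_prop, 1, fun t ht => ?_⟩
  rw [abs_mul, abs_mul, abs_of_nonneg (pow_nonneg ht k), abs_of_pos (Real.exp_pos _), one_mul]
  have h1 : Real.exp (-a * t) ≤ 1 := Real.exp_le_one_iff.2 (by nlinarith)
  calc _ ≤ t ^ k * 1 * 1 := by gcongr; exact hg1 t
    _ ≤ _ := by simpa using pow_le_one_add_sq hk t

theorem quadGrowth_lapCos {a : ℝ} (ha : 0 ≤ a) (b : ℝ) {k : ℕ} (hk : k ≤ 2) :
    QuadGrowth (lapCos a b k) :=
  quadGrowth_of_trig ha hk (by fun_prop) fun _ => Real.abs_cos_le_one _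

theorem quadGrowth_lapSin {a : ℝ} (ha : 0 ≤ a) (b : ℝ) {k : ℕ} (hk : k ≤ 2) :
    QuadGrowth (lapSin a b k) :=
  quadGrowth_of_trig ha hk (by fun_prop) fun _ => Real.abs_sin_le_one _

theorem QuadGrowth.const_mul {φ : ℝ → ℝ} (hφ : QuadGrowth φ) (c : ℝ) :
    QuadGrowth fun t => c * φ t := by
  obtain ⟨h, C, hC⟩ := hφ
  refine ⟨by fun_prop, |c| * C, fun t ht => ?_⟩
  rw [abs_mul, mul_assoc]
  exact mul_le_mul_of_nonneg_left (hC t ht) (abs_nonneg c)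

theorem QuadGrowth.add {φ ψ : ℝ → ℝ} (hφ : QuadGrowth φ) (hψ : QuadGrowth ψ) :
    QuadGrowth fun t => φ t + ψ t := by
  obtain ⟨h, C, hC⟩ := hφ
  obtain ⟨h', C', hC'⟩ := hψ
  refine ⟨by fun_prop, C + C', fun t ht => (abs_add_le _ _).trans ?_⟩
  rw [add_mul]
  exact add_le_add (hC t ht) (hC' t ht)

theorem hasDerivAt_lapCos (a b : ℝ) (k : ℕ) (t : ℝ) :
    HasDerivAt (lapCos a b k)
      (k * lapCos a b (k - 1) t + (-a * lapCos a b k t + -b * lapSin a b k t)) t := by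
  have h1 : HasDerivAt (fun t : ℝ => Real.exp (-a * t)) (Real.exp (-a * t) * (-a)) t := by
    simpa using ((hasDerivAt_id t).const_mul (-a)).exp
  have h2 : HasDerivAt (fun t : ℝ => Real.cos (b * t)) (-Real.sin (b * t) * b) t := by
    simpa using ((hasDerivAt_id t).const_mul b).cos
  refine (((hasDerivAt_pow k t).mul h1).mul h2).congr_deriv ?_
  simp only [lapCos, lapSin, Pi.mul_apply]; ring

theorem hasDerivAt_lapSin (a b : ℝ) (k : ℕ) (t : ℝ) :
    HasDerivAt (lapSin a b k)
      (k * lapSin a b (k - 1) t + (-a * lapSin a b k t + b * lapCos a b k t)) t := by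
  have h1 : HasDerivAt (fun t : ℝ => Real.exp (-a * t)) (Real.exp (-a * t) * (-a)) t := by
    simpa using ((hasDerivAt_id t).const_mul (-a)).exp
  have h2 : HasDerivAt (fun t : ℝ => Real.sin (b * t)) (Real.cos (b * t) * b) t := by
    simpa using ((hasDerivAt_id t).const_mul b).sin
  refine (((hasDerivAt_pow k t).mul h1).mul h2).congr_deriv ?_
  simp only [lapCos, lapSin, Pi.mul_apply]; ring

/-- `∫₀^∞ φ(t) e^{At} x dt`. -/
def lap (T : C0Semigroup Z) (φ : ℝ → ℝ) (x : Z) : Z := ∫ τ in Ioi (0 : ℝ), φ τ • T.op τ x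

/-- The weighted orbit integral is a bounded operator commuting with the semigroup, hence it
respects the generator relation. This puts the Laplace integrals of a domain vector into the domain.
-/
theorem ExpStable.lap_gen (hT : T.ExpStable) {φ : ℝ → ℝ} (hφ : QuadGrowth φ) {x y : Z}
    (hxy : T.Gen x y) : T.Gen (T.lap φ x) (T.lap φ y) := by
  obtain ⟨hi, L, hL⟩ := hT.integrableOn_quadGrowth hφ
  have h := gen_map hxy (L := L) ?_
  · rwa [hL, hL] at h
  · intro t ht z
    rw [hL, hL, ← ContinuousLinearMap.integral_comp_comm _ (hi z)]
    refine setIntegral_congr_fun measurableSet_Ioi fun τ hτ => ?_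
    simp only [map_smul]
    rw [T.op_comm (le_of_lt hτ) ht.le]

theorem ExpStable.lap_lin3 (hT : T.ExpStable) {φ₁ φ₂ φ₃ : ℝ → ℝ} (h₁ : QuadGrowth φ₁)
    (h₂ : QuadGrowth φ₂) (h₃ : QuadGrowth φ₃) (c₁ c₂ c₃ : ℝ) (x : Z) :
    T.lap (fun t => c₁ * φ₁ t + (c₂ * φ₂ t + c₃ * φ₃ t)) x =
      c₁ • T.lap φ₁ x + (c₂ • T.lap φ₂ x + c₃ • T.lap φ₃ x) := by
  have i1 := ((hT.integrableOn_quadGrowth h₁).1 x).smul c₁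
  have i2 := ((hT.integrableOn_quadGrowth h₂).1 x).smul c₂
  have i3 := ((hT.integrableOn_quadGrowth h₃).1 x).smul c₃
  have := integral_add i1 (i2.add i3)
  rw [integral_add' i2 i3] at this
  simp only [Pi.smul_apply, Pi.add_apply, integral_smul] at this
  simp only [lap, ← this, add_smul, mul_smul]

/-- With λ = a + ib, this is the real part of (λ - A)∫tᵏe^{-λt}T(t)x dt = k∫tᵏ⁻¹e^{-λt}T(t)x dt +
0ᵏx, where 0ᵏ is the boundary value at t = 0. For `k = 0` the truncated index `k - 1` is harmless
because its coefficient vanishes. -/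
theorem ExpStable.lapCos_rec (hT : T.ExpStable) {a : ℝ} (ha : 0 ≤ a) (b : ℝ) {k : ℕ} (hk : k ≤ 2)
    {x y : Z} (hxy : T.Gen x y) :
    a • T.lap (lapCos a b k) x + b • T.lap (lapSin a b k) x - T.lap (lapCos a b k) y =
      (k : ℝ) • T.lap (lapCos a b (k - 1)) x + (0 : ℝ) ^ k • x := by
  have gc := quadGrowth_lapCos ha b hk
  have gs := quadGrowth_lapSin ha b hk
  have gc' := quadGrowth_lapCos ha b (k := k - 1) (by omega)
  have h := hT.integral_deriv_smul_add hxy (hasDerivAt_lapCos a b k) gc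
    ((gc'.const_mul _).add ((gc.const_mul _).add (gs.const_mul _)))
  have h' := hT.lap_lin3 gc' gc gs k (-a) (-b) x
  rw [lap] at h'
  rw [h'] at h
  have h0 : lapCos a b k 0 = 0 ^ k := by simp [lapCos]
  rw [h0] at h
  change _ + T.lap (lapCos a b k) y = _ at h
  rw [eq_sub_of_add_eq' h]
  simp only [neg_smul]
  abel

theorem ExpStable.lapSin_rec (hT : T.ExpStable) {a : ℝ} (ha : 0 ≤ a) (b : ℝ) {k : ℕ} (hk : k ≤ 2)
    {x y : Z} (hxy : T.Gen x y) :
    a • T.lap (lapSin a b k) x - b • T.lap (lapCos a b k) x - T.lap (lapSin a b k) y =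
      (k : ℝ) • T.lap (lapSin a b (k - 1)) x := by
  have gc := quadGrowth_lapCos ha b hk
  have gs := quadGrowth_lapSin ha b hk
  have gs' := quadGrowth_lapSin ha b (k := k - 1) (by omega)
  have h := hT.integral_deriv_smul_add hxy (hasDerivAt_lapSin a b k) gs
    ((gs'.const_mul _).add ((gs.const_mul _).add (gc.const_mul _)))
  have h' := hT.lap_lin3 gs' gs gc k (-a) b x
  rw [lap] at h'
  rw [h'] at h
  have h0 : lapSin a b k 0 = 0 := by simp [lapSin]
  rw [h0, zero_smul, neg_zero] at h
  change _ + T.lap (lapSin a b k) y = _ at h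
  rw [eq_sub_of_add_eq' h]
  simp only [neg_smul]
  abel

/-- In the complexification the Laplace integral is the pair with real part the cosine integral and
imaginary part minus the sine integral. The recursions identify its image under λ - A, so the
resolvent bound applies to it. -/
theorem ExpStable.lap_bound (hT : T.ExpStable) {A : Z →ₗ.[ℝ] Z}
    (hA : T.GeneratedBy (A.graph : Set (Z × Z))) {a b M : ℝ} (ha : 0 ≤ a)
    (hR : ResolventBound A ⟨a, b⟩ M) {k : ℕ} (hk : k ≤ 2) {x y : Z} (hxy : T.Gen x y) :
    (a ^ 2 + b ^ 2) * (‖T.lap (lapCos a b k) x‖ ^ 2 + ‖T.lap (lapSin a b k) x‖ ^ 2) ≤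
      M ^ 2 * (‖(k : ℝ) • T.lap (lapCos a b (k - 1)) x + (0 : ℝ) ^ k • x‖ ^ 2 +
        ‖(k : ℝ) • T.lap (lapSin a b (k - 1)) x‖ ^ 2) := by
  obtain ⟨X, hX1, hX2⟩ := (LinearPMap.mem_graph_iff A).1
    ((hA _ _).2 (hT.lap_gen (quadGrowth_lapCos ha b hk) hxy))
  obtain ⟨Y, hY1, hY2⟩ := (LinearPMap.mem_graph_iff A).1
    ((hA _ _).2 (hT.lap_gen (quadGrowth_lapSin ha b hk) hxy))
  have h := hR.2 X (-Y)
  have hn : ‖(⟨a, b⟩ : ℂ)‖ ^ 2 = a ^ 2 + b ^ 2 := by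
    rw [Complex.sq_norm, Complex.normSq_mk]; ring
  rw [hn, LinearPMap.map_neg, Submodule.coe_neg, hX1, hX2, hY1, hY2, norm_neg] at h
  simp only at h
  have h1 : a • T.lap (lapCos a b k) x - b • -T.lap (lapSin a b k) x - T.lap (lapCos a b k) y =
      (k : ℝ) • T.lap (lapCos a b (k - 1)) x + (0 : ℝ) ^ k • x := by
    rw [← hT.lapCos_rec ha b hk hxy, smul_neg, sub_neg_eq_add]
  have h2 : a • -T.lap (lapSin a b k) x + b • T.lap (lapCos a b k) x - -T.lap (lapSin a b k) y =
      -((k : ℝ) • T.lap (lapSin a b (k - 1)) x) := by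
    rw [← hT.lapSin_rec ha b hk hxy, smul_neg]; abel
  rwa [h1, h2, norm_neg] at h

/-- With R = (λ - A)⁻¹ the integrals for k = 0, 1, 2 are Rx, R²x and 2R³x, and 2R³Ax = 2λR³x - 2R²x.
Each resolvent costs M/|λ|, which leaves |λ|⁻². The power t² is the smallest one for which this
bound is integrable along a vertical line. -/
theorem ExpStable.lap_two_bound (hT : T.ExpStable) {A : Z →ₗ.[ℝ] Z}
    (hA : T.GeneratedBy (A.graph : Set (Z × Z))) {a b M : ℝ} (ha : 0 < a) (hM : 1 ≤ M)
    (hR : ResolventBound A ⟨a, b⟩ M) {x y : Z} (hxy : T.Gen x y) :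
    ‖T.lap (lapCos a b 2) y‖ ≤ 6 * M ^ 3 / (a ^ 2 + b ^ 2) * ‖x‖ ∧
      ‖T.lap (lapSin a b 2) y‖ ≤ 6 * M ^ 3 / (a ^ 2 + b ^ 2) * ‖x‖ := by
  have h0 := hT.lap_bound hA ha.le hR (k := 0) (by norm_num) hxy
  have h1 := hT.lap_bound hA ha.le hR (k := 1) (by norm_num) hxy
  have h2 := hT.lap_bound hA ha.le hR (k := 2) (by norm_num) hxy
  have e1 := hT.lapCos_rec ha.le b (k := 2) le_rfl hxy
  have e2 := hT.lapSin_rec ha.le b (k := 2) le_rfl hxy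
  simp only [Nat.cast_zero, zero_smul, zero_add, pow_zero, one_smul, norm_zero, Nat.cast_one,
    Nat.sub_self, pow_one, add_zero, Nat.cast_ofNat, norm_smul, Real.norm_ofNat,
    Nat.add_one_sub_one, zero_pow, ne_eq, OfNat.ofNat_ne_zero, not_false_eq_true,
    Nat.reduceSub, mul_pow] at h0 h1 h2 e1 e2
  set R := Real.sqrt (a ^ 2 + b ^ 2) with hRdef
  have hR2 : R ^ 2 = a ^ 2 + b ^ 2 := Real.sq_sqrt (by positivity)
  have hRpos : 0 < R := Real.sqrt_pos.2 (by positivity)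
  rw [← hR2] at h0 h1 h2 ⊢
  set c2 := T.lap (lapCos a b 2) x
  set s2 := T.lap (lapSin a b 2) x
  set c1 := T.lap (lapCos a b 1) x
  set s1 := T.lap (lapSin a b 1) x
  set n0 := ‖T.lap (lapCos a b 0) x‖ ^ 2 + ‖T.lap (lapSin a b 0) x‖ ^ 2
  have g1 : R ^ 2 * R ^ 2 * (‖c1‖ ^ 2 + ‖s1‖ ^ 2) ≤ (M ^ 2) ^ 2 * ‖x‖ ^ 2 := by
    calc _ = R ^ 2 * (R ^ 2 * (‖c1‖ ^ 2 + ‖s1‖ ^ 2)) := by ring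
      _ ≤ R ^ 2 * (M ^ 2 * n0) := by gcongr
      _ = M ^ 2 * (R ^ 2 * n0) := by ring
      _ ≤ M ^ 2 * (M ^ 2 * (‖x‖ ^ 2 + 0)) := by
        rw [add_zero]; exact mul_le_mul_of_nonneg_left (by simpa using h0) (by positivity)
      _ = _ := by ring
  have g2 : R ^ 2 * R ^ 2 * R ^ 2 * (‖c2‖ ^ 2 + ‖s2‖ ^ 2) ≤ (2 * M ^ 3) ^ 2 * ‖x‖ ^ 2 := by
    calc _ = R ^ 2 * R ^ 2 * (R ^ 2 * (‖c2‖ ^ 2 + ‖s2‖ ^ 2)) := by ring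
      _ ≤ R ^ 2 * R ^ 2 * (M ^ 2 * (2 ^ 2 * ‖c1‖ ^ 2 + 2 ^ 2 * ‖s1‖ ^ 2)) := by gcongr
      _ = 2 ^ 2 * M ^ 2 * (R ^ 2 * R ^ 2 * (‖c1‖ ^ 2 + ‖s1‖ ^ 2)) := by ring
      _ ≤ 2 ^ 2 * M ^ 2 * ((M ^ 2) ^ 2 * ‖x‖ ^ 2) := by gcongr
      _ = _ := by ring
  have key1 : ∀ v : Z, ‖v‖ ^ 2 ≤ ‖c1‖ ^ 2 + ‖s1‖ ^ 2 → R ^ 2 * ‖v‖ ≤ M ^ 3 * ‖x‖ := by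
    intro v hv
    have : R ^ 2 * ‖v‖ ≤ M ^ 2 * ‖x‖ := by
      refine abs_le_of_sq_le_sq' ?_ (by positivity) |>.2
      calc (R ^ 2 * ‖v‖) ^ 2 = R ^ 2 * R ^ 2 * ‖v‖ ^ 2 := by ring
        _ ≤ R ^ 2 * R ^ 2 * (‖c1‖ ^ 2 + ‖s1‖ ^ 2) := by gcongr
        _ ≤ _ := g1
        _ = _ := by ring
    refine this.trans ?_
    exact mul_le_mul_of_nonneg_right (pow_le_pow_right₀ hM (by norm_num)) (norm_nonneg _)
  have key2 : ∀ v : Z, ‖v‖ ^ 2 ≤ ‖c2‖ ^ 2 + ‖s2‖ ^ 2 → R ^ 2 * (R * ‖v‖) ≤ 2 * M ^ 3 * ‖x‖ := by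
    intro v hv
    refine abs_le_of_sq_le_sq' ?_ (by positivity) |>.2
    calc (R ^ 2 * (R * ‖v‖)) ^ 2 = R ^ 2 * R ^ 2 * R ^ 2 * ‖v‖ ^ 2 := by ring
      _ ≤ R ^ 2 * R ^ 2 * R ^ 2 * (‖c2‖ ^ 2 + ‖s2‖ ^ 2) := by gcongr
      _ ≤ _ := g2
      _ = _ := by ring
  have haR : |a| ≤ R := Real.abs_le_sqrt (by nlinarith [sq_nonneg b])
  have hbR : |b| ≤ R := Real.abs_le_sqrt (by nlinarith [sq_nonneg a])
  have kc1 := key1 c1 (by nlinarith [sq_nonneg ‖s1‖])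
  have ks1 := key1 s1 (by nlinarith [sq_nonneg ‖c1‖])
  have kc2 := key2 c2 (by nlinarith [sq_nonneg ‖s2‖])
  have ks2 := key2 s2 (by nlinarith [sq_nonneg ‖c2‖])
  -- The constant is 6 = 2 + 2 + 2: the terms in `u`, `v` and `w` each contribute `2 * M ^ 3`.
  have fin : ∀ (u v w z : Z) (α β : ℝ), |α| ≤ R → |β| ≤ R → z = α • u + β • v - (2 : ℝ) • w →
      R ^ 2 * (R * ‖u‖) ≤ 2 * M ^ 3 * ‖x‖ → R ^ 2 * (R * ‖v‖) ≤ 2 * M ^ 3 * ‖x‖ →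
      R ^ 2 * ‖w‖ ≤ M ^ 3 * ‖x‖ → ‖z‖ ≤ 6 * M ^ 3 / R ^ 2 * ‖x‖ := by
    intro u v w z α β hα hβ hz hu hv hw
    have h1 : ‖z‖ ≤ R * ‖u‖ + R * ‖v‖ + 2 * ‖w‖ := by
      rw [hz]
      refine (norm_sub_le _ _).trans (add_le_add ((norm_add_le _ _).trans ?_) ?_)
      · rw [norm_smul, norm_smul, Real.norm_eq_abs, Real.norm_eq_abs]
        gcongr
      · rw [norm_smul]; simp
    rw [div_mul_eq_mul_div, le_div_iff₀ (by positivity)]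
    calc ‖z‖ * R ^ 2 ≤ (R * ‖u‖ + R * ‖v‖ + 2 * ‖w‖) * R ^ 2 := by gcongr
      _ = R ^ 2 * (R * ‖u‖) + R ^ 2 * (R * ‖v‖) + 2 * (R ^ 2 * ‖w‖) := by ring
      _ ≤ _ := by linarith
  refine ⟨fin c2 s2 c1 _ a b haR hbR ?_ kc2 ks2 kc1,
    fin s2 c2 s1 _ a (-b) haR (by rwa [abs_neg]) ?_ ks2 kc2 ks1⟩
  · rw [← e1]; abel
  · rw [← e2, neg_smul]; abel

end C0Semigroup

-- Fourier inversion, with the integral of (1 + (ξ/a)²)⁻¹ equal to πa. The factor (2π)² only helps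
-- and is dropped.
open scoped FourierTransform in
theorem norm_le_of_fourier_decay {φ : ℝ → ℂ} (hc : Continuous φ) (hi : Integrable φ) {a κ : ℝ}
    (ha : 0 < a) (h : ∀ ξ, ‖𝓕 φ ξ‖ ≤ κ / (a ^ 2 + (2 * Real.pi * ξ) ^ 2)) (t : ℝ) :
    ‖φ t‖ ≤ κ * Real.pi / a := by
  have hκ : 0 ≤ κ := by
    have := (norm_nonneg _).trans (h 0)
    by_contra hneg
    exact absurd this (not_le.2 (div_neg_of_neg_of_pos (not_le.1 hneg) (by positivity)))
  have hb : ∀ ξ, ‖𝓕 φ ξ‖ ≤ κ / a ^ 2 * (1 + (ξ / a) ^ 2)⁻¹ := by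
    intro ξ
    refine (h ξ).trans ?_
    have h1 : a ^ 2 * (1 + (ξ / a) ^ 2) ≤ a ^ 2 + (2 * Real.pi * ξ) ^ 2 := by
      have : a ^ 2 * (1 + (ξ / a) ^ 2) = a ^ 2 + ξ ^ 2 := by field_simp
      rw [this]
      have hpi := Real.pi_gt_three
      nlinarith [sq_nonneg ξ, mul_nonneg (sq_nonneg ξ) (by nlinarith : (0 : ℝ) ≤ 4 * Real.pi ^ 2 - 1)]
    calc κ / (a ^ 2 + (2 * Real.pi * ξ) ^ 2) ≤ κ / (a ^ 2 * (1 + (ξ / a) ^ 2)) := by gcongr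
      _ = _ := by field_simp
  have hbi : Integrable fun ξ : ℝ => κ / a ^ 2 * (1 + (ξ / a) ^ 2)⁻¹ :=
    (integrable_inv_one_add_sq.comp_div ha.ne').const_mul _
  have hFc : Continuous (𝓕 φ) :=
    VectorFourier.fourierIntegral_continuous Real.continuous_fourierChar
      (by exact continuous_inner) hi
  have hFi : Integrable (𝓕 φ) :=
    hbi.mono' hFc.aestronglyMeasurable (Eventually.of_forall hb)
  rw [← hi.fourierInv_fourier_eq hFi hc.continuousAt, Real.fourierInv_eq']
  refine (norm_integral_le_of_norm_le hbi (Eventually.of_forall fun ξ => ?_)).trans_eq ?_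
  · rw [norm_smul]
    have : ‖Complex.exp (↑(2 * Real.pi * inner ℝ ξ t) * Complex.I)‖ = 1 :=
      Complex.norm_exp_ofReal_mul_I _
    rw [this, one_mul]
    exact hb ξ
  · rw [integral_const_mul, Measure.integral_comp_div (fun x : ℝ => (1 + x ^ 2)⁻¹) a,
      integral_univ_inv_one_add_sq, abs_of_pos ha, smul_eq_mul]
    field_simp

namespace C0Semigroup

variable {T : C0Semigroup Z}

-- This is where sectoriality is used, and only on Re λ > 0. The Fourier transform of s²e^{-as}⟨w,
-- T(s)y⟩ is a Laplace transform at a + 2πiξ and decays like ‖A⁻¹y‖‖w‖/|λ|². Inversion at s = t with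
-- a = 1/t costs a factor proportional to t on the right, against t²e⁻¹ on the left, which leaves
-- 1/t.
open scoped FourierTransform in
theorem ExpStable.norm_op_le_div (hT : T.ExpStable) {A : Z →ₗ.[ℝ] Z}
    (hA : T.GeneratedBy (A.graph : Set (Z × Z))) (hsec : IsSectorial A) :
    ∃ c : ℝ, 0 ≤ c ∧ ∀ t, 0 < t → ∀ y, ‖T.op t y‖ ≤ c / t * ‖T.negPowL 1 y‖ := by
  obtain ⟨δ, hδ, -, hsec⟩ := hsec
  obtain ⟨M, hM, hres⟩ := hsec (δ / 2) (by linarith) (by linarith)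
  have hres' : ∀ a b : ℝ, 0 < a → ResolventBound A ⟨a, b⟩ M := by
    intro a b ha
    refine hres _ (fun h => ha.ne' (congrArg Complex.re h)) ?_
    have := Complex.abs_arg_lt_pi_div_two_iff.2 (Or.inl (show 0 < (⟨a, b⟩ : ℂ).re from ha))
    linarith
  refine ⟨12 * M ^ 3 * Real.pi * Real.exp 1, by positivity, fun t ht y => ?_⟩
  set x := T.negPowL 1 y with hx
  have hxy : T.Gen (-x) y := by
    have := gen_map (hT.gen_negPowL_one y) (L := -ContinuousLinearMap.id ℝ Z) (by simp)
    simpa [hx] using this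
  have main : ∀ w : Z, |inner ℝ w (T.op t y)| ≤
      12 * M ^ 3 * Real.pi * Real.exp 1 / t * ‖x‖ * ‖w‖ := by
    intro w
    set a := t⁻¹ with ha'
    have ha : 0 < a := inv_pos.2 ht
    -- The maximum extends the function by 0 to negative times; the square makes the extension
    -- continuous at 0, as pointwise Fourier inversion requires.
    set ψ : ℝ → ℝ := fun s => (max s 0) ^ 2 * Real.exp (-a * s) * inner ℝ w (T.op (max s 0) y)
      with hψ
    have hψc : Continuous ψ := by
      have : Continuous fun s : ℝ => T.op (max s 0) y :=
        (T.strong_cont y).comp_continuous (by fun_prop) fun s => le_max_right s 0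
      fun_prop
    have hψ0 : ∀ s, s ∉ Ioi (0 : ℝ) → ψ s = 0 := by
      intro s hs
      have : max s 0 = 0 := max_eq_right (not_lt.1 hs)
      simp [hψ, this]
    have hψpos : ∀ s ∈ Ioi (0 : ℝ), ψ s = inner ℝ w ((s ^ 2 * Real.exp (-a * s)) • T.op s y) := by
      intro s hs
      rw [hψ]
      simp only
      rw [max_eq_left (le_of_lt hs), real_inner_smul_right]
    have hg : QuadGrowth fun s => s ^ 2 * Real.exp (-a * s) := by
      have := quadGrowth_lapCos ha.le 0 (k := 2) le_rfl
      unfold lapCos at this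
      simpa using this
    have hψi : Integrable ψ := by
      have h1 : IntegrableOn ψ (Ioi 0) :=
        ((innerSL ℝ w).integrable_comp ((hT.integrableOn_quadGrowth hg).1 y)).congr
          ((ae_restrict_iff' measurableSet_Ioi).2 (Eventually.of_forall fun s hs =>
            (hψpos s hs).symm))
      refine (integrableOn_iff_integrable_of_support_subset ?_).1 h1
      intro s hs
      by_contra hns
      exact hs (hψ0 s hns)
    have hF : ∀ ξ, 𝓕 (fun s => (ψ s : ℂ)) ξ =
        ((inner ℝ w (T.lap (lapCos a (2 * Real.pi * ξ) 2) y) : ℝ) : ℂ) -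
        ((inner ℝ w (T.lap (lapSin a (2 * Real.pi * ξ) 2) y) : ℝ) : ℂ) * Complex.I := by
      intro ξ
      set b := 2 * Real.pi * ξ with hb
      have hc := (hT.integrableOn_quadGrowth (quadGrowth_lapCos ha.le b (k := 2) le_rfl)).1 y
      have hs := (hT.integrableOn_quadGrowth (quadGrowth_lapSin ha.le b (k := 2) le_rfl)).1 y
      have e1 : inner ℝ w (T.lap (lapCos a b 2) y) =
          ∫ s in Ioi (0 : ℝ), inner ℝ w (lapCos a b 2 s • T.op s y) :=
        ((innerSL ℝ w).integral_comp_comm hc).symm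
      have e2 : inner ℝ w (T.lap (lapSin a b 2) y) =
          ∫ s in Ioi (0 : ℝ), inner ℝ w (lapSin a b 2 s • T.op s y) :=
        ((innerSL ℝ w).integral_comp_comm hs).symm
      have i1 : IntegrableOn (fun s => ((inner ℝ w (lapCos a b 2 s • T.op s y) : ℝ) : ℂ)) (Ioi 0) :=
        ((innerSL ℝ w).integrable_comp hc).ofReal
      have i2 : IntegrableOn (fun s => ((inner ℝ w (lapSin a b 2 s • T.op s y) : ℝ) : ℂ)) (Ioi 0) :=
        ((innerSL ℝ w).integrable_comp hs).ofReal
      rw [e1, e2, ← integral_complex_ofReal, ← integral_complex_ofReal, ← integral_mul_const,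
        ← integral_sub i1 (i2.mul_const _), Real.fourier_real_eq_integral_exp_smul,
        ← setIntegral_eq_integral_of_forall_compl_eq_zero (s := Ioi 0)]
      · refine setIntegral_congr_fun measurableSet_Ioi fun s hs => ?_
        have : Complex.exp (↑(-2 * Real.pi * s * ξ) * Complex.I) =
            (Real.cos (b * s) : ℂ) - (Real.sin (b * s) : ℂ) * Complex.I := by
          rw [Complex.exp_mul_I, ← Complex.ofReal_cos, ← Complex.ofReal_sin]
          have : -2 * Real.pi * s * ξ = -(b * s) := by rw [hb]; ring
          rw [this, Real.cos_neg, Real.sin_neg]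
          push_cast; ring
        rw [this, hψpos s hs]
        simp only [real_inner_smul_right, lapCos, lapSin, smul_eq_mul]
        push_cast
        ring
      · intro s hs
        simp [hψ0 s hs]
    have hFb : ∀ ξ, ‖𝓕 (fun s => (ψ s : ℂ)) ξ‖ ≤
        (12 * M ^ 3 * ‖x‖ * ‖w‖) / (a ^ 2 + (2 * Real.pi * ξ) ^ 2) := by
      intro ξ
      obtain ⟨h1, h2⟩ := hT.lap_two_bound hA ha hM (hres' a (2 * Real.pi * ξ) ha) hxy
      rw [norm_neg] at h1 h2
      rw [hF]
      refine (norm_sub_le _ _).trans ?_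
      rw [norm_mul, Complex.norm_I, mul_one, Complex.norm_real, Complex.norm_real]
      calc _ ≤ ‖w‖ * ‖T.lap (lapCos a (2 * Real.pi * ξ) 2) y‖ +
            ‖w‖ * ‖T.lap (lapSin a (2 * Real.pi * ξ) 2) y‖ :=
            add_le_add (norm_inner_le_norm _ _) (norm_inner_le_norm _ _)
        _ ≤ ‖w‖ * (6 * M ^ 3 / (a ^ 2 + (2 * Real.pi * ξ) ^ 2) * ‖x‖) +
            ‖w‖ * (6 * M ^ 3 / (a ^ 2 + (2 * Real.pi * ξ) ^ 2) * ‖x‖) := by gcongr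
        _ = _ := by ring
    have hfin := norm_le_of_fourier_decay (Complex.continuous_ofReal.comp hψc) hψi.ofReal ha hFb t
    have hval : ψ t = t ^ 2 * (Real.exp 1)⁻¹ * inner ℝ w (T.op t y) := by
      rw [hψpos t ht, real_inner_smul_right, ← Real.exp_neg]
      congr 3
      rw [ha']
      field_simp
    simp only [Function.comp_apply, Complex.norm_real, Real.norm_eq_abs] at hfin
    rw [hval, abs_mul, abs_of_pos (by positivity), ha', div_inv_eq_mul] at hfin
    have hte : 0 < t ^ 2 * (Real.exp 1)⁻¹ := by positivity
    rw [← mul_le_mul_iff_right₀ hte]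
    refine hfin.trans_eq ?_
    field_simp
  -- Testing with `w = T.op t y` itself turns the scalar bound into the norm bound.
  have hm := main (T.op t y)
  rw [real_inner_self_eq_norm_sq, abs_of_nonneg (sq_nonneg _), sq] at hm
  rcases (norm_nonneg (T.op t y)).eq_or_lt with h0 | h0
  · rw [← h0]; positivity
  · exact le_of_mul_le_mul_right hm h0

end C0Semigroup

/-- The norm of the range of `L`, with value `∞` off the range. -/
def imgNorm (L : Z →L[ℝ] Z) (x : Z) : ℝ≥0∞ := ⨅ (y : Z) (_ : L y = x), ‖y‖ₑ

/-! ### The norm on the range of an injective operator with dense range, and its dual description.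
-/

section imgNorm

variable {L : Z →L[ℝ] Z}

theorem imgNorm_apply_le (L : Z →L[ℝ] Z) (y : Z) : imgNorm L (L y) ≤ ‖y‖ₑ :=
  iInf₂_le (f := fun (y' : Z) (_ : L y' = L y) => ‖y'‖ₑ) y rfl

theorem imgNorm_zero (L : Z →L[ℝ] Z) : imgNorm L 0 = 0 := by
  simpa using imgNorm_apply_le L 0

theorem exists_of_imgNorm_lt {x : Z} {c : ℝ≥0∞} (h : imgNorm L x < c) : ∃ y, L y = x ∧ ‖y‖ₑ < c := by
  simpa [imgNorm, iInf_lt_iff] using h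

theorem imgNorm_add_le (L : Z →L[ℝ] Z) (x x' : Z) :
    imgNorm L (x + x') ≤ imgNorm L x + imgNorm L x' := by
  refine le_of_forall_gt fun c hc => ?_
  rcases eq_or_ne (imgNorm L x) ⊤ with h | h
  · simp [h] at hc
  rcases eq_or_ne (imgNorm L x') ⊤ with h' | h'
  · simp [h'] at hc
  obtain ⟨a, b, ha, hb, hab⟩ : ∃ a b, imgNorm L x < a ∧ imgNorm L x' < b ∧ a + b ≤ c := by
    obtain ⟨e, he, hlt⟩ := ENNReal.lt_iff_exists_add_pos_lt.1 hc
    refine ⟨imgNorm L x + e / 2, imgNorm L x' + e / 2, ENNReal.lt_add_right h (by simpa using he.ne'),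
      ENNReal.lt_add_right h' (by simpa using he.ne'), ?_⟩
    calc _ = imgNorm L x + imgNorm L x' + (e / 2 + e / 2) := by ring
      _ ≤ c := by rw [ENNReal.add_halves]; exact hlt.le
  obtain ⟨y, rfl, hy⟩ := exists_of_imgNorm_lt ha
  obtain ⟨y', rfl, hy'⟩ := exists_of_imgNorm_lt hb
  rw [← map_add]
  calc _ ≤ ‖y + y'‖ₑ := imgNorm_apply_le L _
    _ ≤ ‖y‖ₑ + ‖y'‖ₑ := enorm_add_le _ _
    _ < a + b := ENNReal.add_lt_add hy hy'
    _ ≤ c := hab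

theorem imgNorm_smul_le (L : Z →L[ℝ] Z) (c : ℝ) (x : Z) :
    imgNorm L (c • x) ≤ ‖c‖ₑ * imgNorm L x := by
  rcases eq_or_ne c 0 with rfl | hc
  · simp [imgNorm_zero]
  have hc' : ‖c‖ₑ ≠ 0 := by simpa using hc
  rw [mul_comm, ← ENNReal.div_le_iff hc' enorm_ne_top]
  refine le_iInf₂ fun y hy => ?_
  rw [ENNReal.div_le_iff hc' enorm_ne_top, ← hy, ← map_smul, mul_comm, ← enorm_smul]
  exact imgNorm_apply_le L _

/-- The orthogonal complement of the range of the adjoint is the kernel of `L`. -/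
theorem denseRange_adjoint (hL : Function.Injective L) :
    DenseRange (ContinuousLinearMap.adjoint L) := by
  have h := Submodule.dense_iff_topologicalClosure_eq_top
    (s := (ContinuousLinearMap.adjoint L).range)
  rw [Submodule.topologicalClosure_eq_top_iff] at h
  refine h.2 ((Submodule.eq_bot_iff _).2 fun x hx => hL ?_)
  rw [map_zero]
  refine ext_inner_left ℝ fun v => ?_
  rw [inner_zero_right, ← ContinuousLinearMap.adjoint_inner_left]
  exact hx _ ⟨v, rfl⟩

/-- Cauchy–Schwarz for ⟨v, Ly⟩ = ⟨L*v, y⟩ over all preimages y. If L*v = 0 then v = 0 by density,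
which settles the case where the right side is ∞ · 0. -/
theorem enorm_inner_le_imgNorm (hd : DenseRange L) (v x : Z) :
    ‖(inner ℝ v x : ℝ)‖ₑ ≤ imgNorm L x * ‖ContinuousLinearMap.adjoint L v‖ₑ := by
  rcases eq_or_ne (ContinuousLinearMap.adjoint L v) 0 with h0 | h0
  · have : v = 0 := by
      refine hd.eq_zero_of_inner_left (𝕜 := ℝ) fun w => ?_
      rw [← ContinuousLinearMap.adjoint_inner_left, h0, inner_zero_left]
    simp [this]
  · have h0' : ‖ContinuousLinearMap.adjoint L v‖ₑ ≠ 0 := by simpa using h0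
    rw [← ENNReal.div_le_iff h0' enorm_ne_top]
    refine le_iInf₂ fun y hy => ?_
    rw [ENNReal.div_le_iff h0' enorm_ne_top, ← hy, ← ContinuousLinearMap.adjoint_inner_left,
      mul_comm, ← ofReal_norm, ← ofReal_norm, ← ofReal_norm,
      ← ENNReal.ofReal_mul (norm_nonneg _)]
    exact ENNReal.ofReal_le_ofReal (norm_inner_le_norm _ _)

/-- The bound on the right says that L*v ↦ ⟨x, v⟩ is well defined and bounded by c on a dense
subspace. Its Riesz representative y has norm at most c and satisfies Ly = x. Sublevel sets of the
range norm thereby become intersections of closed conditions on x. -/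
theorem imgNorm_le_iff (hL : Function.Injective L) (hd : DenseRange L) {x : Z} {c : ℝ≥0∞}
    (hc : c ≠ ⊤) : imgNorm L x ≤ c ↔
      ∀ v, ‖(inner ℝ v x : ℝ)‖ₑ ≤ c * ‖ContinuousLinearMap.adjoint L v‖ₑ := by
  refine ⟨fun h v => (enorm_inner_le_imgNorm hd v x).trans (by gcongr), fun h => ?_⟩
  lift c to NNReal using hc
  have hb : ∀ v, ‖(innerSL ℝ x).toLinearMap v‖ ≤
      c * ‖(ContinuousLinearMap.adjoint L).toLinearMap v‖ := by
    intro v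
    have := h v
    rw [← ofReal_norm, ← ofReal_norm, ← ENNReal.ofReal_coe_nnreal,
      ← ENNReal.ofReal_mul (NNReal.coe_nonneg c), ENNReal.ofReal_le_ofReal_iff (by positivity)] at this
    simpa [real_inner_comm] using this
  have hdA : DenseRange (ContinuousLinearMap.adjoint L).toLinearMap := denseRange_adjoint hL
  set ℓ := (innerSL ℝ x).toLinearMap.extendOfNorm (ContinuousLinearMap.adjoint L).toLinearMap
  have hℓ : ∀ v, ℓ (ContinuousLinearMap.adjoint L v) = inner ℝ x v := fun v =>
    LinearMap.extendOfNorm_eq hdA ⟨c, hb⟩ v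
  have hℓn : ‖ℓ‖ ≤ c := LinearMap.opNorm_extendOfNorm_le hdA c.2 hb
  set y := (InnerProductSpace.toDual ℝ Z).symm ℓ
  have hy : L y = x := by
    refine ext_inner_right ℝ fun v => ?_
    rw [← ContinuousLinearMap.adjoint_inner_right, InnerProductSpace.toDual_symm_apply, hℓ]
  rw [← hy]
  refine (imgNorm_apply_le L y).trans ?_
  rw [← ofReal_norm, ← ENNReal.ofReal_coe_nnreal]
  refine ENNReal.ofReal_le_ofReal ?_
  rwa [LinearIsometryEquiv.norm_map]

theorem lowerSemicontinuous_imgNorm (hL : Function.Injective L) (hd : DenseRange L) :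
    LowerSemicontinuous (imgNorm L) := by
  rw [lowerSemicontinuous_iff_isClosed_preimage]
  intro c
  rcases eq_or_ne c ⊤ with rfl | hc
  · simp
  have : imgNorm L ⁻¹' Iic c =
      ⋂ v, {x | ‖(inner ℝ v x : ℝ)‖ₑ ≤ c * ‖ContinuousLinearMap.adjoint L v‖ₑ} := by
    ext x
    simp only [mem_preimage, mem_Iic, mem_iInter, mem_ofPred_eq]
    exact imgNorm_le_iff hL hd hc
  rw [this]
  exact isClosed_iInter fun v => isClosed_le (by fun_prop) continuous_const

theorem aemeasurable_imgNorm (hL : Function.Injective L) (hd : DenseRange L) {α : Type*}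
    [MeasurableSpace α] {μ : Measure α} {F : α → Z} (hF : AEStronglyMeasurable F μ) :
    AEMeasurable (fun τ => imgNorm L (F τ)) μ := by
  borelize Z
  exact (lowerSemicontinuous_imgNorm hL hd).measurable.comp_aemeasurable hF.aemeasurable

/-- Minkowski's inequality in the finer norm, although the integral is only taken in `Z`: by duality
it reduces to the scalar integrals of ⟨v, F⟩. -/
theorem imgNorm_integral_le (hL : Function.Injective L) (hd : DenseRange L) {α : Type*}
    [MeasurableSpace α] {μ : Measure α} {F : α → Z} (hF : Integrable F μ) :
    imgNorm L (∫ τ, F τ ∂μ) ≤ ∫⁻ τ, imgNorm L (F τ) ∂μ := by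
  rcases eq_or_ne (∫⁻ τ, imgNorm L (F τ) ∂μ) ⊤ with h | h
  · simp [h]
  rw [imgNorm_le_iff hL hd h]
  intro v
  have : (inner ℝ v (∫ τ, F τ ∂μ) : ℝ) = ∫ τ, inner ℝ v (F τ) ∂μ :=
    ((innerSL ℝ v).integral_comp_comm hF).symm
  rw [this, ← lintegral_mul_const' _ _ enorm_ne_top]
  exact (enorm_integral_le_lintegral_enorm _).trans
    (lintegral_mono fun τ => enorm_inner_le_imgNorm hd v (F τ))

theorem imgNorm_intervalIntegral_le (hL : Function.Injective L) (hd : DenseRange L) {F : ℝ → Z}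
    {a b : ℝ} (hab : a ≤ b) (hF : IntervalIntegrable F volume a b) :
    imgNorm L (∫ τ in a..b, F τ) ≤ ∫⁻ τ in Ioo a b, imgNorm L (F τ) := by
  rw [intervalIntegral.integral_of_le hab, integral_Ioc_eq_integral_Ioo]
  exact imgNorm_integral_le hL hd ((intervalIntegrable_iff_integrableOn_Ioo_of_le hab).1 hF)

variable {C : Z →ₗ[ℝ] ℝ} {c : ℝ}

theorem enorm_le_mul_imgNorm (hC : ∀ y, |C (L y)| ≤ c * ‖y‖) (hc : 0 < c) (x : Z) :
    ‖C x‖ₑ ≤ ENNReal.ofReal c * imgNorm L x := by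
  have hc' : ENNReal.ofReal c ≠ 0 := by simpa using hc
  rw [mul_comm, ← ENNReal.div_le_iff hc' ENNReal.ofReal_ne_top]
  refine le_iInf₂ fun y hy => ?_
  rw [ENNReal.div_le_iff hc' ENNReal.ofReal_ne_top, ← hy, mul_comm, ← ofReal_norm,
    ← ofReal_norm, ← ENNReal.ofReal_mul hc.le]
  exact ENNReal.ofReal_le_ofReal (hC y)

/-- A functional bounded on the range of `L` commutes with integrals that converge in the norm of
this range. -/
theorem integrable_and_map_integral (hL : Function.Injective L) (hd : DenseRange L)
    (hC : ∀ y, |C (L y)| ≤ c * ‖y‖) (hc : 0 < c) {α : Type*} [MeasurableSpace α] {μ : Measure α}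
    {F : α → Z} (hF : Integrable F μ) (hfin : ∫⁻ τ, imgNorm L (F τ) ∂μ ≠ ⊤) :
    Integrable (fun τ => C (F τ)) μ ∧ C (∫ τ, F τ ∂μ) = ∫ τ, C (F τ) ∂μ := by
  -- By Riesz, C ∘ L is ⟨c₀, ·⟩, and c₀ is a limit of vectors L*vₙ. On the range of `L`, C is
  -- therefore the pointwise limit of the functionals ⟨vₙ, ·⟩, which are continuous on `Z` and
  -- commute with the integral. The range norm supplies the dominating function.
  set Cb : Z →L[ℝ] ℝ := LinearMap.mkContinuous (C.comp L.toLinearMap) c hC with hCb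
  set c₀ := (InnerProductSpace.toDual ℝ Z).symm Cb with hc₀
  have hCc : ∀ y, C (L y) = inner ℝ c₀ y := fun y => by
    rw [hc₀, InnerProductSpace.toDual_symm_apply]; rfl
  obtain ⟨u, hu, hut⟩ := mem_closure_iff_seq_limit.1 (denseRange_adjoint hL c₀)
  choose v hv using hu
  have hlim : ∀ x, imgNorm L x ≠ ⊤ → Tendsto (fun n => (inner ℝ (v n) x : ℝ)) atTop (𝓝 (C x)) := by
    intro x hx
    obtain ⟨y, rfl, -⟩ := exists_of_imgNorm_lt (lt_top_iff_ne_top.2 hx)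
    simp only [hCc, ← ContinuousLinearMap.adjoint_inner_left, hv]
    exact hut.inner tendsto_const_nhds
  have hmeas := aemeasurable_imgNorm hL hd hF.aestronglyMeasurable
  have hae : ∀ᵐ τ ∂μ, imgNorm L (F τ) < ⊤ := ae_lt_top' hmeas hfin
  have hgi : Integrable (fun τ => (imgNorm L (F τ)).toReal) μ :=
    integrable_toReal_of_lintegral_ne_top hmeas hfin
  obtain ⟨K, hK⟩ : ∃ K, ∀ n, ‖u n‖ ≤ K := by
    obtain ⟨K, hK⟩ := hut.norm.bddAbove_range
    exact ⟨K, fun n => hK ⟨n, rfl⟩⟩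
  have hbound : ∀ n, ∀ᵐ τ ∂μ, ‖(inner ℝ (v n) (F τ) : ℝ)‖ ≤ K * (imgNorm L (F τ)).toReal := by
    intro n
    filter_upwards [hae] with τ hτ
    have h1 := ENNReal.toReal_mono (ENNReal.mul_ne_top hτ.ne enorm_ne_top)
      (enorm_inner_le_imgNorm hd (v n) (F τ))
    rw [toReal_enorm, ENNReal.toReal_mul, toReal_enorm, hv, mul_comm] at h1
    exact h1.trans (by gcongr; exact hK n)
  have hCm : AEStronglyMeasurable (fun τ => C (F τ)) μ := by
    refine aestronglyMeasurable_of_tendsto_ae (u := atTop)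
      (f := fun n τ => (inner ℝ (v n) (F τ) : ℝ)) (fun n => ?_) ?_
    · exact ((innerSL ℝ (v n)).integrable_comp hF).aestronglyMeasurable
    · filter_upwards [hae] with τ hτ using hlim _ hτ.ne
  have hdct := tendsto_integral_of_dominated_convergence
    (F := fun n τ => (inner ℝ (v n) (F τ) : ℝ)) (f := fun τ => C (F τ))
    (fun τ => K * (imgNorm L (F τ)).toReal)
    (fun n => ((innerSL ℝ (v n)).integrable_comp hF).aestronglyMeasurable)
    (hgi.const_mul K) hbound (by filter_upwards [hae] with τ hτ using hlim _ hτ.ne)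
  refine ⟨(hgi.const_mul c).mono' hCm ?_, ?_⟩
  · filter_upwards [hae] with τ hτ
    have h1 := ENNReal.toReal_mono (ENNReal.mul_ne_top ENNReal.ofReal_ne_top hτ.ne)
      (enorm_le_mul_imgNorm hC hc (F τ))
    rwa [toReal_enorm, ENNReal.toReal_mul, ENNReal.toReal_ofReal hc.le] at h1
  · refine tendsto_nhds_unique (hlim _ (ne_top_of_le_ne_top hfin (imgNorm_integral_le hL hd hF)))
      (hdct.congr fun n => ?_)
    exact (innerSL ℝ (v n)).integral_comp_comm hF

theorem integrableOn_and_map_intervalIntegral (hL : Function.Injective L) (hd : DenseRange L)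
    (hC : ∀ y, |C (L y)| ≤ c * ‖y‖) (hc : 0 < c) {F : ℝ → Z} {a b : ℝ} (hab : a ≤ b)
    (hF : IntervalIntegrable F volume a b) (hfin : ∫⁻ τ in Ioo a b, imgNorm L (F τ) ≠ ⊤) :
    IntegrableOn (fun τ => C (F τ)) (Ioo a b) ∧
      C (∫ τ in a..b, F τ) = ∫ τ in Ioo a b, C (F τ) := by
  rw [intervalIntegral.integral_of_le hab, integral_Ioc_eq_integral_Ioo]
  exact integrable_and_map_integral hL hd hC hc
    ((intervalIntegrable_iff_integrableOn_Ioo_of_le hab).1 hF) hfin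

end imgNorm

theorem C0Semigroup.ExpStable.fracNorm_eq {T : C0Semigroup Z} (hT : T.ExpStable) {s : ℝ}
    (hs : 0 ≤ s) (x : Z) : T.fracNorm s x = imgNorm (T.negPowL s) x := by
  simp only [C0Semigroup.fracNorm, imgNorm, hT.negPowL_apply hs]

/-! ### Extension of a semigroup to extrapolation spaces, and fractional smoothing. -/

namespace C0Semigroup

section extL

variable {S : C0Semigroup Z} {L : Z →L[ℝ] Z}

/-- `S(t)` extended by continuity to the completion of `Z` in the norm `‖L x‖`, the elements of
which are represented by their images under `L`. -/
def extL (S : C0Semigroup Z) (L : Z →L[ℝ] Z) (t : ℝ) : Z →L[ℝ] Z :=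
  (S.op t).toLinearMap.extendOfNorm L.toLinearMap

/-- For `t > 0`, `S(t)` is bounded with respect to the norm `‖L x‖`. -/
def Smooths (S : C0Semigroup Z) (L : Z →L[ℝ] Z) : Prop :=
  ∀ t, 0 < t → ∃ c, ∀ x, ‖S.op t x‖ ≤ c * ‖L x‖

theorem Smooths.extL_apply (h : S.Smooths L) (hd : DenseRange L) {t : ℝ} (ht : 0 < t) (x : Z) :
    S.extL L t (L x) = S.op t x :=
  LinearMap.extendOfNorm_eq (f := (S.op t).toLinearMap) (e := L.toLinearMap) hd (h t ht) x

theorem norm_extL_le (hd : DenseRange L) {t c : ℝ} (h : ∀ x, ‖S.op t x‖ ≤ c * ‖L x‖) (v : Z) :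
    ‖S.extL L t v‖ ≤ c * ‖v‖ :=
  LinearMap.norm_extendOfNorm_apply_le (f := (S.op t).toLinearMap) (e := L.toLinearMap) hd c h v

theorem Smooths.comm_extL (h : S.Smooths L) (hd : DenseRange L) {R : Z →L[ℝ] Z}
    (hR : ∀ t, 0 < t → ∀ x, R (S.op t x) = S.op t (R x)) (hRL : ∀ x, R (L x) = L (R x)) {t : ℝ}
    (ht : 0 < t) (v : Z) : R (S.extL L t v) = S.extL L t (R v) := by
  refine hd.induction_on v (isClosed_eq (by fun_prop) (by fun_prop)) fun x => ?_
  rw [h.extL_apply hd ht, hRL, h.extL_apply hd ht, hR t ht]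

theorem Smooths.op_extL (h : S.Smooths L) (hd : DenseRange L) {t τ : ℝ} (hτ : 0 ≤ τ) (ht : 0 < t)
    (v : Z) : S.op τ (S.extL L t v) = S.extL L (τ + t) v := by
  refine hd.induction_on v (isClosed_eq (by fun_prop) (by fun_prop)) fun x => ?_
  rw [h.extL_apply hd ht, h.extL_apply hd (by linarith), S.op_add_apply hτ ht.le]

theorem Smooths.continuousOn_extL (h : S.Smooths L) (hd : DenseRange L) (v : Z) :
    ContinuousOn (fun t => S.extL L t v) (Ioi 0) := by
  intro t ht
  have ht : 0 < t := ht
  refine ContinuousAt.continuousWithinAt ?_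
  have h1 : ContinuousAt (fun τ => S.op (τ - t / 2) (S.extL L (t / 2) v)) t := by
    have h2 : ContinuousAt (fun τ => S.op τ (S.extL L (t / 2) v)) (t - t / 2) :=
      (S.strong_cont _).continuousAt (Ici_mem_nhds (by linarith))
    exact ContinuousAt.comp (f := fun τ => τ - t / 2) h2 (by fun_prop)
  refine h1.congr ?_
  filter_upwards [Ioi_mem_nhds (show t / 2 < t by linarith)] with τ hτ
  rw [h.op_extL hd (sub_nonneg.2 (le_of_lt hτ)) (by linarith), sub_add_cancel]

/-- This links the limit in the definition of `Plant.extOp` to `extL`. Density of the range makes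
the filter nontrivial, and on `Z` the semigroup is a continuous function of `L x`. -/
theorem Smooths.limUnder_eq (h : S.Smooths L) (hd : DenseRange L) {t : ℝ} (ht : 0 < t) (v : Z) :
    limUnder (comap L (𝓝 v)) (fun x => S.op t x) = S.extL L t v := by
  have hne : (comap L (𝓝 v)).NeBot := by
    rw [comap_neBot_iff]
    intro s hs
    obtain ⟨y, hy, x, rfl⟩ := mem_closure_iff_nhds.1 (hd v) s hs
    exact ⟨x, hy⟩
  refine Tendsto.limUnder_eq ?_
  have : (fun x => S.op t x) = (S.extL L t) ∘ L := funext fun x => (h.extL_apply hd ht x).symm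
  rw [this]
  exact ((S.extL L t).continuous.tendsto v).comp tendsto_comap

end extL

variable {T : C0Semigroup Z}

/-- Smoothing of fractional order for an analytic semigroup. -/
theorem ExpStable.norm_op_le_rpow (hT : T.ExpStable) {c : ℝ} (hc : 0 ≤ c)
    (h1 : ∀ t, 0 < t → ∀ y, ‖T.op t y‖ ≤ c / t * ‖T.negPowL 1 y‖) {s : ℝ} (hs : 0 ≤ s)
    (hs1 : s < 1) :
    ∃ c' : ℝ, 0 ≤ c' ∧ ∀ t, 0 < t → ∀ x, ‖T.op t x‖ ≤ c' * t ^ (-s) * ‖T.negPowL s x‖ := by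
  rcases hs.eq_or_lt with rfl | hs0
  · obtain ⟨M, hM, h⟩ := hT.bounded
    refine ⟨M, by linarith, fun t ht x => ?_⟩
    rw [hT.negPowL_zero, neg_zero, Real.rpow_zero, mul_one]
    exact h t ht.le x
  have hsm : T.Smooths (T.negPowL 1) := fun t ht => ⟨_, h1 t ht⟩
  have hd := hT.denseRange_negPowL_one
  have hs1' : 0 < 1 - s := by linarith
  have hΓ := Real.Gamma_pos_of_pos hs1'
  refine ⟨(Real.Gamma (1 - s))⁻¹ * (c * (1 / (1 - s) + 1 / s)), by positivity, fun t ht x => ?_⟩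
  set v := T.negPowL s x with hv
  -- The extension is T(t)(-A), so T(t)x = T(t)(-A)(-A)^{-(1-s)}v. The integral formula for the
  -- power 1 - s turns this into an average of T(t + τ)(-A)v against τ^{-s}.
  have e1 : T.op t x = T.extL (T.negPowL 1) t (T.negPowL (1 - s) v) := by
    rw [hv, hT.negPowL_negPowL hs1'.le hs, sub_add_cancel, hsm.extL_apply hd ht]
  rw [e1, hT.clm_negPowL hs1', norm_smul, norm_inv, Real.norm_eq_abs, abs_of_pos hΓ, mul_assoc,
    mul_assoc]
  refine mul_le_mul_of_nonneg_left ?_ (by positivity)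
  set F : ℝ → Z := fun τ => τ ^ (1 - s - 1) • T.extL (T.negPowL 1) t (T.op τ v) with hF
  have hFi : IntegrableOn F (Ioi 0) := by
    have := (T.extL (T.negPowL 1) t).integrable_comp ((hT.integrableOn_rpow_smul_op hs1').1 v)
    simp only [map_smul] at this
    exact this
  have hFn : ∀ τ, 0 < τ → ‖F τ‖ ≤ τ ^ (-s) * (c / (t + τ) * ‖v‖) := by
    intro τ hτ
    have h2 : T.extL (T.negPowL 1) t (T.op τ v) = T.extL (T.negPowL 1) (t + τ) v := by
      rw [← hsm.comm_extL hd (R := T.op τ) (fun _ h _ => T.op_comm hτ.le h.le _)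
        (fun y => hT.op_negPowL zero_le_one hτ.le y) ht, hsm.op_extL hd hτ.le ht, add_comm]
    rw [hF]
    simp only
    rw [h2, norm_smul, Real.norm_eq_abs, abs_of_nonneg (Real.rpow_nonneg hτ.le _),
      show 1 - s - 1 = -s by ring]
    exact mul_le_mul_of_nonneg_left (norm_extL_le hd (h1 _ (by linarith)) v)
      (Real.rpow_nonneg hτ.le _)
  -- Before t the factor c/(t + τ) is replaced by c/t, after t by c/τ. The two pieces give the
  -- constants 1/(1 - s) and 1/s.
  have hsplit : ∫ τ in Ioi 0, F τ = (∫ τ in (0 : ℝ)..t, F τ) + ∫ τ in Ioi t, F τ :=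
    (intervalIntegral.integral_interval_add_Ioi hFi (hFi.mono_set (Ioi_subset_Ioi ht.le))).symm
  have b1 : ‖∫ τ in (0 : ℝ)..t, F τ‖ ≤ c * (1 / (1 - s)) * (t ^ (-s) * ‖v‖) := by
    have hi : IntervalIntegrable (fun τ : ℝ => τ ^ (-s)) volume 0 t :=
      intervalIntegral.intervalIntegrable_rpow' (by linarith)
    calc _ ≤ ∫ τ in (0 : ℝ)..t, τ ^ (-s) * (c / t * ‖v‖) := by
          refine intervalIntegral.norm_integral_le_of_norm_le ht.le ?_ (hi.mul_const _)
          filter_upwards with τ hτ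
          refine (hFn τ hτ.1).trans ?_
          have := hτ.1
          have := Real.rpow_nonneg hτ.1.le (-s)
          gcongr
          linarith
      _ = _ := by
          rw [intervalIntegral.integral_mul_const, integral_rpow (Or.inl (by linarith)),
            Real.zero_rpow (by linarith), show -s + 1 = 1 + -s by ring, Real.rpow_add ht,
            Real.rpow_one, ← sub_eq_add_neg, sub_zero]
          field_simp
  have b2 : ‖∫ τ in Ioi t, F τ‖ ≤ c * (1 / s) * (t ^ (-s) * ‖v‖) := by
    have hi : IntegrableOn (fun τ : ℝ => τ ^ (-s - 1)) (Ioi t) :=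
      integrableOn_Ioi_rpow_of_lt (by linarith) ht
    calc _ ≤ ∫ τ in Ioi t, τ ^ (-s - 1) * (c * ‖v‖) := by
          refine norm_integral_le_of_norm_le (hi.mul_const _) ?_
          refine (ae_restrict_iff' measurableSet_Ioi).2 (Eventually.of_forall fun τ hτ => ?_)
          have hτ0 : 0 < τ := ht.trans hτ
          refine (hFn τ hτ0).trans ?_
          have := Real.rpow_nonneg hτ0.le (-s)
          calc _ ≤ τ ^ (-s) * (c / τ * ‖v‖) := by gcongr; linarith
            _ = _ := by rw [Real.rpow_sub_one hτ0.ne']; ring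
      _ = _ := by
          rw [integral_mul_const, integral_Ioi_rpow_of_lt (by linarith) ht, sub_add_cancel]
          field_simp
  calc _ ≤ _ := by rw [hsplit]; exact norm_add_le _ _
    _ ≤ c * (1 / (1 - s)) * (t ^ (-s) * ‖v‖) + c * (1 / s) * (t ^ (-s) * ‖v‖) := add_le_add b1 b2
    _ = _ := by ring

end C0Semigroup

theorem intervalIntegrable_smul_comp_sub {g : ℝ → ℝ} {F : ℝ → Z} {t c p : ℝ} (ht : 0 ≤ t)
    (hg : ContinuousOn g (Icc 0 t)) (hF : ContinuousOn F (Ioi 0))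
    (hb : ∀ σ, 0 < σ → σ ≤ t → ‖F σ‖ ≤ c * σ ^ (-p)) (hp : p < 1) :
    IntervalIntegrable (fun τ => g τ • F (t - τ)) volume 0 t := by
  obtain ⟨K, hK⟩ := isCompact_Icc.exists_bound_of_continuousOn hg
  have h1 : IntervalIntegrable (fun τ : ℝ => (t - τ) ^ (-p)) volume 0 t := by
    have := (intervalIntegral.intervalIntegrable_rpow' (a := t) (b := 0) (r := -p)
      (by linarith)).comp_sub_left t
    simpa using this
  rw [intervalIntegrable_iff_integrableOn_Ioo_of_le ht] at h1 ⊢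
  refine (h1.const_mul (K * c)).mono' ?_ ?_
  · refine ContinuousOn.aestronglyMeasurable ?_ measurableSet_Ioo
    refine (hg.mono Ioo_subset_Icc_self).smul (hF.comp (by fun_prop) ?_)
    intro τ hτ
    exact sub_pos.2 hτ.2
  · refine (ae_restrict_iff' measurableSet_Ioo).2 (Eventually.of_forall fun τ hτ => ?_)
    rw [norm_smul, mul_assoc]
    exact mul_le_mul (hK τ (Ioo_subset_Icc_self hτ))
      (hb _ (sub_pos.2 hτ.2) (by linarith [hτ.1])) (norm_nonneg _)
      ((norm_nonneg _).trans (hK τ (Ioo_subset_Icc_self hτ)))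

/-- A one-sided product rule: T(t-σ)w(σ) - T(t-τ)w(τ) equals T(t-σ) applied to (w(σ) - w(τ)) -
(T(σ-τ) - I)w(τ). -/
theorem C0Semigroup.ExpStable.hasDerivWithinAt_op_sub {T : C0Semigroup Z} (hT : T.ExpStable)
    {t τ : ℝ} (hτ : τ < t) {w : ℝ → Z} {w' z : Z} (hw : HasDerivWithinAt w w' (Ioi τ) τ)
    (hz : T.Gen (w τ) z) :
    HasDerivWithinAt (fun σ => T.op (t - σ) (w σ)) (T.op (t - τ) w' - T.op (t - τ) z) (Ioi τ) τ := by
  rw [hasDerivWithinAt_iff_tendsto_slope' self_notMem_Ioi] at hw ⊢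
  have hs : Tendsto (fun σ => t - σ) (𝓝[>] τ) (𝓝 (t - τ)) :=
    ((continuous_const.sub continuous_id).tendsto τ).mono_left nhdsWithin_le_nhds
  have hlt : ∀ᶠ σ in 𝓝[>] τ, σ < t := nhdsWithin_le_nhds (Iio_mem_nhds hτ)
  have hs' : ∀ᶠ σ in 𝓝[>] τ, 0 ≤ t - σ := by
    filter_upwards [hlt] with σ hσ using sub_nonneg.2 hσ.le
  have h1 := hT.tendsto_op hs hs' (sub_nonneg.2 hτ.le) hw
  have h2 : Tendsto (fun s => s - τ) (𝓝[>] τ) (𝓝[>] 0) := by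
    refine tendsto_nhdsWithin_iff.2 ⟨?_, ?_⟩
    · exact ((continuous_id.sub continuous_const).tendsto' τ 0 (sub_self τ)).mono_left
        nhdsWithin_le_nhds
    · filter_upwards [self_mem_nhdsWithin] with s hs
      exact sub_pos.2 (mem_Ioi.1 hs)
  have h3 := hT.tendsto_op hs hs' (sub_nonneg.2 hτ.le) (hz.comp h2)
  refine (h1.sub h3).congr' ?_
  filter_upwards [self_mem_nhdsWithin, hlt] with σ hσ hσt
  have e : T.op (t - τ) (w τ) = T.op (t - σ) (T.op (σ - τ) (w τ)) := by
    rw [← T.op_add_apply (by linarith) (sub_nonneg.2 (le_of_lt hσ))]; congr 2; ring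
  simp only [slope, vsub_eq_sub, Function.comp_apply, e]
  rw [← map_sub, ← smul_sub, map_smul, ← map_sub]
  congr 2
  abel

/-! ### The generator of the regulated plant and its Volterra equation. -/

namespace Plant

variable (P : Plant Z)

theorem exists_C_bound : ∃ c : ℝ, 0 < c ∧ ∀ y, |P.C (P.T.negPowL P.sc y)| ≤ c * ‖y‖ := by
  obtain ⟨c, hc⟩ := P.C_bdd
  refine ⟨|c| + 1, by positivity, fun y => ?_⟩
  rw [P.stable.negPowL_apply P.sc_mem.1]
  refine (hc y).trans ?_
  gcongr
  linarith [le_abs_self c]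

theorem exists_C_negPowL_clm {a : ℝ} (ha : P.sc ≤ a) :
    ∃ ℓ : Z →L[ℝ] ℝ, ∀ y, ℓ y = P.C (P.T.negPowL a y) := by
  obtain ⟨c, hc, h⟩ := P.exists_C_bound
  refine ⟨(LinearMap.mkContinuous (P.C.comp (P.T.negPowL P.sc).toLinearMap) c h).comp
    (P.T.negPowL (a - P.sc)), fun y => ?_⟩
  have := P.stable.negPowL_negPowL P.sc_mem.1 (b := a - P.sc) (by linarith) y
  rw [add_sub_cancel] at this
  rw [← this]
  rfl

open Classical in
/-- `C (-A)^{-a}` as a bounded functional, for `a ≥ s_c`. -/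
def CN (a : ℝ) : Z →L[ℝ] ℝ :=
  if h : ∃ ℓ : Z →L[ℝ] ℝ, ∀ y, ℓ y = P.C (P.T.negPowL a y) then h.choose else 0

theorem CN_apply {a : ℝ} (ha : P.sc ≤ a) (y : Z) : P.CN a y = P.C (P.T.negPowL a y) := by
  have h := P.exists_C_negPowL_clm ha
  rw [CN, dif_pos h]
  exact h.choose_spec y

theorem C_negPowL_B (hG : P.G ≠ 0) : P.C (P.T.negPowL (1 - P.sb) P.B) = 1 := by
  rw [B, map_smul, map_smul, P.stable.negPowL_apply (by linarith [P.sb_mem.2]), smul_eq_mul]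
  exact inv_mul_cancel₀ hG

variable {P} {β : ℝ} {S : C0Semigroup Z}

theorem gen_iff (hS : S.GeneratedBy (P.regGraph β)) {w y : Z} :
    S.Gen w y ↔ w ∈ range (P.T.negPowL P.sc) ∧
      -w - ((1 - β) / β * P.C w) • P.T.negPowL (1 - P.sb) P.B = P.T.negPowL 1 y := by
  rw [P.stable.negPowL_apply (by linarith [P.sb_mem.2]), P.stable.negPowL_apply zero_le_one,
    P.stable.coe_negPowL P.sc_mem.1]
  exact (hS w y).symm

/-- Applying C to the generator relation, with C(-A)⁻¹B = 1, makes its left side -(1 + (1-β)/β)Cw =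
-Cw/β. This static identity is the source of the exact tracking of r and of the cancellation of d.
-/
theorem C_of_gen (hG : P.G ≠ 0) (hβ : β ∈ Ioo (0 : ℝ) 1) (hS : S.GeneratedBy (P.regGraph β))
    {w y : Z} (h : S.Gen w y) : P.C w = -(β * P.C (P.T.negPowL 1 y)) := by
  have h1 := congrArg P.C ((gen_iff hS).1 h).2
  simp only [map_sub, map_neg, map_smul, P.C_negPowL_B hG, smul_eq_mul, mul_one] at h1
  have hβ0 := hβ.1.ne'
  rw [← h1]
  field_simp
  ring

theorem C_negPowL_one (hG : P.G ≠ 0) (hβ : β ∈ Ioo (0 : ℝ) 1)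
    (hS : S.GeneratedBy (P.regGraph β)) (hSs : S.ExpStable) (y : Z) :
    P.C (S.negPowL 1 y) = β * P.C (P.T.negPowL 1 y) := by
  rw [C_of_gen hG hβ hS (hSs.gen_negPowL_one y)]
  simp

/-- Once the output of the equilibrium is known, the generator relation becomes explicit, a rank-one
correction of (-A)⁻¹. -/
theorem negPowL_one_eq (hG : P.G ≠ 0) (hβ : β ∈ Ioo (0 : ℝ) 1)
    (hS : S.GeneratedBy (P.regGraph β)) (hSs : S.ExpStable) (y : Z) :
    S.negPowL 1 y = P.T.negPowL 1 y -
      ((1 - β) * P.C (P.T.negPowL 1 y)) • P.T.negPowL (1 - P.sb) P.B := by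
  have h := ((gen_iff hS).1 (hSs.gen_negPowL_one y)).2
  rw [C_negPowL_one hG hβ hS hSs, map_neg] at h
  have hβ0 := hβ.1.ne'
  have e : (1 - β) / β * (β * P.C (P.T.negPowL 1 y)) = (1 - β) * P.C (P.T.negPowL 1 y) := by
    field_simp
  rw [e] at h
  rw [← neg_inj, neg_sub, sub_eq_add_neg, ← h]
  abel

/-- C need not be bounded on `Z`, but on orbits starting in the domain it acts as the bounded
functional β C(-A)⁻¹ on another orbit. Continuity down to time 0 is what makes the supremum in
`short_time_dom` finite. -/
theorem continuousOn_C_op (hG : P.G ≠ 0) (hβ : β ∈ Ioo (0 : ℝ) 1)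
    (hS : S.GeneratedBy (P.regGraph β)) (hSs : S.ExpStable) (y : Z) :
    ContinuousOn (fun τ => P.C (S.op τ (S.negPowL 1 y))) (Ici 0) := by
  have : ContinuousOn (fun τ => β * P.CN 1 (S.op τ y)) (Ici 0) := by
    have := S.strong_cont y
    fun_prop
  refine this.congr fun τ hτ => ?_
  rw [hSs.op_negPowL zero_le_one hτ, C_negPowL_one hG hβ hS hSs]
  simp only [P.CN_apply P.sc_mem.2.le]

/-- Integrate the right derivative of τ ↦ T(t-τ)(-A)⁻¹S(τ)x over [0, t]. The factor (-A)⁻¹ keeps all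
terms, including the one with B, inside `Z`. -/
theorem negPowL_one_volterra (hG : P.G ≠ 0) (hβ : β ∈ Ioo (0 : ℝ) 1)
    (hS : S.GeneratedBy (P.regGraph β)) (hSs : S.ExpStable) (y : Z) {t : ℝ} (ht : 0 ≤ t) :
    P.T.negPowL 1 (S.op t (S.negPowL 1 y)) = P.T.op t (P.T.negPowL 1 (S.negPowL 1 y)) -
      ((1 - β) / β) • ∫ τ in (0 : ℝ)..t, P.C (S.op τ (S.negPowL 1 y)) •
        P.T.op (t - τ) (P.T.negPowL (1 - P.sb) P.B) := by
  set x := S.negPowL 1 y with hx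
  have hgen : S.Gen x (-y) := hSs.gen_negPowL_one y
  have hg := continuousOn_C_op hG hβ hS hSs y
  have hTc : ∀ v : Z, ContinuousOn (fun τ => P.T.op (t - τ) v) (Icc 0 t) := fun v =>
    (P.T.strong_cont v).comp (by fun_prop) fun τ hτ => sub_nonneg.2 hτ.2
  have hderiv : ∀ τ ∈ Ioo 0 t, HasDerivWithinAt
      (fun σ => P.T.op (t - σ) (P.T.negPowL 1 (S.op σ x)))
      (-(((1 - β) / β) • P.C (S.op τ x) • P.T.op (t - τ) (P.T.negPowL (1 - P.sb) P.B)))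
      (Ioi τ) τ := by
    intro τ hτ
    have h1 : HasDerivWithinAt (fun σ => P.T.negPowL 1 (S.op σ x))
        (P.T.negPowL 1 (S.op τ (-y))) (Ioi τ) τ :=
      (P.T.negPowL 1).hasFDerivAt.comp_hasDerivWithinAt τ
        (C0Semigroup.hasDerivWithinAt_op hgen hτ.1.le)
    have h2 := P.stable.hasDerivWithinAt_op_sub hτ.2 h1 (P.stable.gen_negPowL_one _)
    have h3 : S.Gen (S.op τ x) (S.op τ (-y)) :=
      C0Semigroup.gen_map hgen fun _ h _ => S.op_comm hτ.1.le h.le _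
    rw [← ((gen_iff hS).1 h3).2, ← map_sub] at h2
    convert h2 using 1
    rw [← map_smul, ← map_smul, ← map_neg, smul_smul]
    congr 1
    abel
  have hcont : ContinuousOn (fun σ => P.T.op (t - σ) (P.T.negPowL 1 (S.op σ x))) (Icc 0 t) := by
    intro σ hσ
    refine P.stable.tendsto_op (s := fun σ => t - σ)
      ((by fun_prop : Continuous fun σ : ℝ => t - σ).continuousWithinAt)
      ?_ (sub_nonneg.2 hσ.2) ?_
    · filter_upwards [self_mem_nhdsWithin] with τ hτ using sub_nonneg.2 hτ.2
    · exact ((P.T.negPowL 1).continuous.comp_continuousOn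
        ((S.strong_cont x).mono Icc_subset_Ici_self)) σ hσ
  have hintg : IntervalIntegrable (fun τ => -(((1 - β) / β) • P.C (S.op τ x) •
      P.T.op (t - τ) (P.T.negPowL (1 - P.sb) P.B))) volume 0 t := by
    refine ContinuousOn.intervalIntegrable ?_
    rw [uIcc_of_le ht]
    exact (((hg.mono Icc_subset_Ici_self).smul (hTc _)).const_smul _).neg
  have h := intervalIntegral.integral_eq_sub_of_hasDeriv_right_of_le ht hcont hderiv hintg
  rw [intervalIntegral.integral_neg, intervalIntegral.integral_smul, sub_self, sub_zero,
    C0Semigroup.op_zero_apply, C0Semigroup.op_zero_apply] at h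
  rw [sub_eq_add_neg, h]
  abel

end Plant

/-! ### Smoothing by e^{At} and short-time bounds for e^{A_β t}. -/

theorem imgNorm_le_ofReal_iff {L : Z →L[ℝ] Z} (hL : Function.Injective L) (hd : DenseRange L)
    {x : Z} {c : ℝ} (hc : 0 ≤ c) : imgNorm L x ≤ ENNReal.ofReal c ↔
      ∀ v, |(inner ℝ v x : ℝ)| ≤ c * ‖ContinuousLinearMap.adjoint L v‖ := by
  rw [imgNorm_le_iff hL hd ENNReal.ofReal_ne_top]
  refine forall_congr' fun v => ?_
  rw [← ofReal_norm, ← ofReal_norm, ← ENNReal.ofReal_mul hc,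
    ENNReal.ofReal_le_ofReal_iff (by positivity), Real.norm_eq_abs]

theorem lintegral_rpow_mul_sub_rpow {p q t : ℝ} (hp : p < 1) (hq : q < 1) (ht : 0 < t) {c : ℝ}
    (hc : 0 ≤ c) :
    ∫⁻ τ in Ioo 0 t, ENNReal.ofReal (c * (τ ^ (-p) * (t - τ) ^ (-q))) =
      ENNReal.ofReal (c * (t ^ (1 - p - q) * ProbabilityTheory.beta (1 - p) (1 - q))) := by
  have hp' : 0 < 1 - p := by linarith
  have hq' : 0 < 1 - q := by linarith
  have h1 := intervalIntegrable_rpow_mul_sub_rpow hp' hq' ht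
  have h2 := integral_rpow_mul_sub_rpow hp' hq' ht
  rw [show 1 - p - 1 = -p by ring, show 1 - q - 1 = -q by ring] at h1 h2
  rw [show 1 - p + (1 - q) - 1 = 1 - p - q by ring] at h2
  rw [← h2, intervalIntegral.integral_of_le ht.le, integral_Ioc_eq_integral_Ioo,
    ← integral_const_mul]
  rw [intervalIntegrable_iff_integrableOn_Ioo_of_le ht.le] at h1
  refine (ofReal_integral_eq_lintegral_ofReal (h1.const_mul c) ?_).symm
  refine (ae_restrict_iff' measurableSet_Ioo).2 (Eventually.of_forall fun τ hτ => ?_)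
  have := Real.rpow_nonneg hτ.1.le (-p)
  have := Real.rpow_nonneg (sub_nonneg.2 hτ.2.le) (-q)
  simp only [Pi.zero_apply]
  positivity

namespace Plant

variable {P : Plant Z} {β : ℝ} {S : C0Semigroup Z}

theorem smoothing (P : Plant Z) {s : ℝ} (hs : 0 ≤ s) (hs1 : s < 1) :
    ∃ c : ℝ, 0 ≤ c ∧ ∀ t, 0 < t → ∀ x, ‖P.T.op t x‖ ≤ c * t ^ (-s) * ‖P.T.negPowL s x‖ := by
  obtain ⟨c, hc, h⟩ := P.stable.norm_op_le_div P.generates P.sectorial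
  exact P.stable.norm_op_le_rpow hc h hs hs1

theorem smooths (P : Plant Z) {s : ℝ} (hs : 0 ≤ s) (hs1 : s < 1) : P.T.Smooths (P.T.negPowL s) := by
  obtain ⟨c, -, h⟩ := P.smoothing hs hs1
  exact fun t ht => ⟨_, h t ht⟩

theorem norm_extL_T_le (P : Plant Z) {s : ℝ} (hs : 0 ≤ s) (hs1 : s < 1) :
    ∃ c : ℝ, 0 ≤ c ∧ ∀ t, 0 < t → ∀ v, ‖P.T.extL (P.T.negPowL s) t v‖ ≤ c * t ^ (-s) * ‖v‖ := by
  obtain ⟨c, hc, h⟩ := P.smoothing hs hs1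
  exact ⟨c, hc, fun t ht v =>
    C0Semigroup.norm_extL_le (P.stable.denseRange_negPowL hs hs1.le) (h t ht) v⟩

/-- Half of the time is spent on passing from Z^{-s} to `Z`, the other half on passing from `Z` to
Z^{s_c}. -/
theorem imgNorm_extL_T_le (P : Plant Z) {s : ℝ} (hs : 0 ≤ s) (hs1 : s < 1) :
    ∃ c : ℝ, 0 ≤ c ∧ ∀ t, 0 < t → ∀ v, imgNorm (P.T.negPowL P.sc) (P.T.extL (P.T.negPowL s) t v) ≤
      ENNReal.ofReal (c * t ^ (-(P.sc + s)) * ‖v‖) := by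
  obtain ⟨c, hc, h⟩ := P.norm_extL_T_le hs hs1
  obtain ⟨c', hc', h'⟩ := P.norm_extL_T_le P.sc_mem.1 P.sc_mem.2
  have hd := P.stable.denseRange_negPowL P.sc_mem.1 P.sc_mem.2.le
  have hsm := P.smooths P.sc_mem.1 P.sc_mem.2
  refine ⟨c' * c * (1 / 2) ^ (-(P.sc + s)), by positivity, fun t ht v => ?_⟩
  have ht2 : 0 < t / 2 := by linarith
  have e : P.T.extL (P.T.negPowL s) t v =
      P.T.negPowL P.sc (P.T.extL (P.T.negPowL P.sc) (t / 2) (P.T.extL (P.T.negPowL s) (t / 2) v)) := by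
    rw [hsm.comm_extL hd (fun τ hτ x => (P.stable.op_negPowL P.sc_mem.1 hτ.le x).symm)
      (fun _ => rfl) ht2, hsm.extL_apply hd ht2, (P.smooths hs hs1).op_extL
      (P.stable.denseRange_negPowL hs hs1.le) ht2.le ht2, add_halves]
  rw [e]
  refine (imgNorm_apply_le _ _).trans ?_
  rw [← ofReal_norm]
  refine ENNReal.ofReal_le_ofReal ((h' _ ht2 _).trans ?_)
  have := Real.rpow_nonneg ht2.le (-P.sc)
  calc _ ≤ c' * (t / 2) ^ (-P.sc) * (c * (t / 2) ^ (-s) * ‖v‖) := by gcongr; exact h _ ht2 v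
    _ = c' * c * ((t / 2) ^ (-P.sc) * (t / 2) ^ (-s)) * ‖v‖ := by ring
    _ = _ := by
      rw [← Real.rpow_add ht2, ← neg_add, show t / 2 = 1 / 2 * t by ring,
        Real.mul_rpow (by norm_num) ht.le]
      ring

theorem negPowL_one_extL_T (P : Plant Z) {s : ℝ} (hs : 0 ≤ s) (hs1 : s < 1) {t : ℝ} (ht : 0 < t)
    (v : Z) :
    P.T.negPowL 1 (P.T.extL (P.T.negPowL s) t v) = P.T.op t (P.T.negPowL (1 - s) v) := by
  have hd := P.stable.denseRange_negPowL hs hs1.le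
  refine hd.induction_on v (isClosed_eq (by fun_prop) (by fun_prop)) fun x => ?_
  rw [(P.smooths hs hs1).extL_apply hd ht, P.stable.negPowL_negPowL (by linarith) hs,
    sub_add_cancel, P.stable.op_negPowL zero_le_one ht.le]

/-- The perturbed semigroup satisfies the variation of constants formula. -/
theorem volterra (hG : P.G ≠ 0) (hβ : β ∈ Ioo (0 : ℝ) 1)
    (hS : S.GeneratedBy (P.regGraph β)) (hSs : S.ExpStable) (y : Z) {t : ℝ} (ht : 0 ≤ t) :
    IntervalIntegrable (fun τ => P.C (S.op τ (S.negPowL 1 y)) •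
        P.T.extL (P.T.negPowL P.sb) (t - τ) P.B) volume 0 t ∧
    S.op t (S.negPowL 1 y) = P.T.op t (S.negPowL 1 y) -
      ((1 - β) / β) • ∫ τ in (0 : ℝ)..t, P.C (S.op τ (S.negPowL 1 y)) •
        P.T.extL (P.T.negPowL P.sb) (t - τ) P.B := by
  obtain ⟨c, hc, hb⟩ := P.norm_extL_T_le P.sb_mem.1 P.sb_mem.2
  have hd := P.stable.denseRange_negPowL P.sb_mem.1 P.sb_mem.2.le
  have hintg : IntervalIntegrable (fun τ => P.C (S.op τ (S.negPowL 1 y)) •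
        P.T.extL (P.T.negPowL P.sb) (t - τ) P.B) volume 0 t :=
    intervalIntegrable_smul_comp_sub (F := fun σ => P.T.extL (P.T.negPowL P.sb) σ P.B)
      (c := c * ‖P.B‖) ht
      ((continuousOn_C_op hG hβ hS hSs y).mono Icc_subset_Ici_self)
      ((P.smooths P.sb_mem.1 P.sb_mem.2).continuousOn_extL hd P.B)
      (fun σ hσ _ => (hb σ hσ P.B).trans_eq (by ring)) P.sb_mem.2
  refine ⟨hintg, P.stable.negPowL_one_injective ?_⟩
  rw [negPowL_one_volterra hG hβ hS hSs y ht, map_sub, map_smul,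
    P.stable.op_negPowL zero_le_one ht,
    ← ContinuousLinearMap.intervalIntegral_comp_comm _ hintg]
  congr 2
  refine intervalIntegral.integral_congr_ae ?_
  -- The extension is only controlled at positive times, so the endpoint where `t - τ = 0` is
  -- removed.
  have : ∀ᵐ τ : ℝ, τ ≠ t := by simp [ae_iff]
  filter_upwards [this] with τ hτ hτ'
  rw [uIoc_of_le ht] at hτ'
  rw [map_smul, P.negPowL_one_extL_T P.sb_mem.1 P.sb_mem.2
    (sub_pos.2 (lt_of_le_of_ne hτ'.2 hτ))]

/-- Short-time bounds for the perturbed semigroup on the domain of its generator. -/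
theorem short_time_dom (hG : P.G ≠ 0) (hβ : β ∈ Ioo (0 : ℝ) 1)
    (hS : S.GeneratedBy (P.regGraph β)) (hSs : S.ExpStable) {s : ℝ} (hs : 0 ≤ s)
    (hs1 : P.sc + s < 1) :
    ∃ t₀ M : ℝ, 0 < t₀ ∧ t₀ ≤ 1 ∧ 0 ≤ M ∧ ∀ t, 0 < t → t ≤ t₀ → ∀ y,
      ‖S.op t (S.negPowL 1 y)‖ ≤ M * t ^ (-s) * ‖P.T.negPowL s (S.negPowL 1 y)‖ ∧
      imgNorm (P.T.negPowL P.sc) (S.op t (S.negPowL 1 y)) ≤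
        ENNReal.ofReal (M * t ^ (-(P.sc + s)) * ‖P.T.negPowL s (S.negPowL 1 y)‖) := by
  have hsc := P.sc_mem
  have hsb := P.sb_mem
  have hθ := P.sc_add_sb
  have hs1' : s < 1 := by linarith [hsc.1]
  obtain ⟨c, hc, hC⟩ := P.exists_C_bound
  obtain ⟨a₁, ha₁, hT⟩ := P.smoothing hs hs1'
  obtain ⟨a₂, ha₂, hTi⟩ := P.imgNorm_extL_T_le hs hs1'
  obtain ⟨b₁, hb₁, hB⟩ := P.norm_extL_T_le hsb.1 hsb.2
  obtain ⟨b₂, hb₂, hBi⟩ := P.imgNorm_extL_T_le hsb.1 hsb.2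
  have hinj := P.stable.negPowL_injective hsc.1 hsc.2.le
  have hden := P.stable.denseRange_negPowL hsc.1 hsc.2.le
  set p := P.sc + s with hp
  set θ := P.sc + P.sb with hθ'
  have hp0 : 0 ≤ p := add_nonneg hsc.1 hs
  set ζ := (1 - β) / β with hζ
  have hζ0 : 0 ≤ ζ := div_nonneg (by linarith [hβ.2]) hβ.1.le
  set Q₁ := ProbabilityTheory.beta (1 - p) (1 - P.sb) with hQ₁
  set Q₂ := ProbabilityTheory.beta (1 - p) (1 - θ) with hQ₂
  have hQ₁0 : 0 < Q₁ := ProbabilityTheory.beta_pos (by linarith) (by linarith [hsb.2])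
  have hQ₂0 : 0 < Q₂ := ProbabilityTheory.beta_pos (by linarith) (by linarith)
  set κ := ζ * (b₂ * ‖P.B‖ * Q₂) with hκ
  have hκ0 : 0 ≤ κ := by positivity
  -- As θ = s_c + s_b < 1, the feedback term carries a factor at most 1/2 on short intervals and can
  -- be absorbed.
  obtain ⟨t₀, ht₀, ht₀1, ht₀κ⟩ : ∃ t₀ : ℝ, 0 < t₀ ∧ t₀ ≤ 1 ∧ c * κ * t₀ ^ (1 - θ) ≤ 1 / 2 := by
    have h1 : Tendsto (fun t : ℝ => c * κ * t ^ (1 - θ)) (𝓝[>] 0) (𝓝 0) := by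
      have : Tendsto (fun t : ℝ => t ^ (1 - θ)) (𝓝[>] 0) (𝓝 0) := by
        have := (Real.continuousAt_rpow_const 0 (1 - θ) (Or.inr (by linarith))).tendsto
        rw [Real.zero_rpow (by linarith)] at this
        exact this.mono_left nhdsWithin_le_nhds
      simpa using this.const_mul (c * κ)
    have h2 := h1.eventually (Iic_mem_nhds (show (0 : ℝ) < 1 / 2 by norm_num))
    have h3 : ∀ᶠ t : ℝ in 𝓝[>] 0, t ≤ 1 := nhdsWithin_le_nhds (Iic_mem_nhds one_pos)
    obtain ⟨t, ht, ht', ht''⟩ := (h2.and (h3.and self_mem_nhdsWithin)).exists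
    exact ⟨t, ht'', ht', ht⟩
  -- One pass through the Volterra equation: an output bound γτ^{-p} yields a bound in Z^{s_c}. The
  -- convolution of τ^{-p} with τ^{-θ} is the Beta integral behind `Q₂`.
  have key : ∀ t, 0 < t → ∀ y, ∀ γ, 0 ≤ γ →
      (∀ τ, 0 < τ → τ < t → |P.C (S.op τ (S.negPowL 1 y))| ≤ γ * τ ^ (-p)) →
      imgNorm (P.T.negPowL P.sc) (S.op t (S.negPowL 1 y)) ≤
        ENNReal.ofReal (a₂ * t ^ (-p) * ‖P.T.negPowL s (S.negPowL 1 y)‖ +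
          κ * γ * t ^ (1 - p - θ)) := by
    intro t ht y γ hγ hg
    obtain ⟨hintg, hvol⟩ := volterra hG hβ hS hSs y ht.le
    rw [hvol, sub_eq_add_neg, ← neg_smul,
      ENNReal.ofReal_add (by positivity) (by positivity)]
    refine (imgNorm_add_le _ _ _).trans (add_le_add ?_ ?_)
    · rw [← (P.smooths hs hs1').extL_apply (P.stable.denseRange_negPowL hs hs1'.le) ht]
      exact hTi t ht _
    · refine (imgNorm_smul_le _ _ _).trans ?_
      have h1 := imgNorm_intervalIntegral_le hinj hden ht.le hintg
      have h2 : ∫⁻ τ in Ioo 0 t, imgNorm (P.T.negPowL P.sc) (P.C (S.op τ (S.negPowL 1 y)) •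
          P.T.extL (P.T.negPowL P.sb) (t - τ) P.B) ≤
          ∫⁻ τ in Ioo 0 t, ENNReal.ofReal ((γ * (b₂ * ‖P.B‖)) * (τ ^ (-p) * (t - τ) ^ (-θ))) := by
        refine setLIntegral_mono' measurableSet_Ioo fun τ hτ => ?_
        have hτ' : 0 < t - τ := sub_pos.2 hτ.2
        refine (imgNorm_smul_le _ _ _).trans ?_
        refine (mul_le_mul_right (hBi _ hτ' P.B) _).trans ?_
        rw [← ofReal_norm, ← ENNReal.ofReal_mul (norm_nonneg _), Real.norm_eq_abs]
        refine ENNReal.ofReal_le_ofReal ?_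
        calc _ ≤ γ * τ ^ (-p) * (b₂ * (t - τ) ^ (-θ) * ‖P.B‖) := by
              gcongr
              exact hg τ hτ.1 hτ.2
          _ = _ := by ring
      rw [lintegral_rpow_mul_sub_rpow hs1 hθ ht (by positivity)] at h2
      refine (mul_le_mul_right (h1.trans h2) _).trans ?_
      rw [← ofReal_norm, ← ENNReal.ofReal_mul (norm_nonneg _), norm_neg, Real.norm_eq_abs,
        abs_of_nonneg hζ0]
      exact ENNReal.ofReal_le_ofReal (le_of_eq (by rw [hκ]; ring))
  have gbound : ∀ y, ∀ t, 0 < t → t ≤ t₀ → |P.C (S.op t (S.negPowL 1 y))| ≤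
      (2 * (c * a₂) * ‖P.T.negPowL s (S.negPowL 1 y)‖) * t ^ (-p) := by
    intro y
    set ρ := ‖P.T.negPowL s (S.negPowL 1 y)‖ with hρ
    set g : ℝ → ℝ := fun τ => |P.C (S.op τ (S.negPowL 1 y))| with hg
    set A : Set ℝ := (fun τ => g τ * τ ^ p) '' Ioc 0 t₀ with hA
    have hAne : A.Nonempty := ⟨_, mem_image_of_mem _ ⟨ht₀, le_rfl⟩⟩
    -- The absorption below needs a finite supremum beforehand. It is finite because the orbit
    -- starts in the domain, so its output is continuous on [0, t₀], and `τ ^ p ≤ 1` there.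
    have hAbdd : BddAbove A := by
      obtain ⟨K, hK⟩ := isCompact_Icc.exists_bound_of_continuousOn
        ((continuousOn_C_op hG hβ hS hSs y).mono
          (Icc_subset_Ici_self : Icc 0 t₀ ⊆ Ici 0))
      refine ⟨K, ?_⟩
      rintro _ ⟨τ, hτ, rfl⟩
      have h1 : τ ^ p ≤ 1 := Real.rpow_le_one hτ.1.le (hτ.2.trans ht₀1) hp0
      have h2 : g τ ≤ K := hK τ ⟨hτ.1.le, hτ.2⟩
      have h3 : 0 ≤ g τ := abs_nonneg _
      have h4 := Real.rpow_nonneg hτ.1.le p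
      simp only
      nlinarith
    set γ := sSup A with hγ
    have hle : ∀ τ, 0 < τ → τ ≤ t₀ → g τ * τ ^ p ≤ γ := fun τ h1 h2 =>
      le_csSup hAbdd (mem_image_of_mem _ ⟨h1, h2⟩)
    have hγ0 : 0 ≤ γ :=
      (mul_nonneg (abs_nonneg _) (Real.rpow_nonneg ht₀.le p)).trans (hle t₀ ht₀ le_rfl)
    have hle' : ∀ τ, 0 < τ → τ ≤ t₀ → g τ ≤ γ * τ ^ (-p) := by
      intro τ h1 h2
      rw [Real.rpow_neg h1.le, ← div_eq_mul_inv, le_div_iff₀ (Real.rpow_pos_of_pos h1 p)]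
      exact hle τ h1 h2
    have hγle : γ ≤ c * a₂ * ρ + 1 / 2 * γ := by
      refine csSup_le hAne ?_
      rintro _ ⟨t, ht, rfl⟩
      have h1 := key t ht.1 y γ hγ0 fun τ h h' => hle' τ h (h'.le.trans ht.2)
      have h2 := (enorm_le_mul_imgNorm hC hc (S.op t (S.negPowL 1 y))).trans
        (mul_le_mul_right h1 _)
      have htp := Real.rpow_pos_of_pos ht.1 p
      have hpos1 := Real.rpow_nonneg ht.1.le (-p)
      have hpos2 := Real.rpow_nonneg ht.1.le (1 - p - θ)
      rw [← ENNReal.ofReal_mul hc.le, ← ofReal_norm,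
        ENNReal.ofReal_le_ofReal_iff (by positivity)] at h2
      have h3 : t ^ (-p) * t ^ p = 1 := by rw [← Real.rpow_add ht.1]; simp
      have h4 : t ^ (1 - p - θ) * t ^ p = t ^ (1 - θ) := by
        rw [← Real.rpow_add ht.1]; congr 1; ring
      have h5 : t ^ (1 - θ) ≤ t₀ ^ (1 - θ) :=
        Real.rpow_le_rpow ht.1.le ht.2 (by linarith)
      calc g t * t ^ p ≤ c * (a₂ * t ^ (-p) * ρ + κ * γ * t ^ (1 - p - θ)) * t ^ p := by
            gcongr
            exact h2
        _ = c * a₂ * ρ * (t ^ (-p) * t ^ p) + c * κ * γ * (t ^ (1 - p - θ) * t ^ p) := by ring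
        _ = c * a₂ * ρ + c * κ * γ * t ^ (1 - θ) := by rw [h3, h4]; ring
        _ ≤ c * a₂ * ρ + c * κ * γ * t₀ ^ (1 - θ) := by gcongr
        _ = c * a₂ * ρ + (c * κ * t₀ ^ (1 - θ)) * γ := by ring
        _ ≤ _ := by gcongr
    intro t ht ht'
    refine (hle' t ht ht').trans ?_
    have := Real.rpow_nonneg ht.le (-p)
    gcongr
    linarith
  set G₀ := 2 * (c * a₂) with hG₀
  have hG₀0 : 0 ≤ G₀ := by positivity
  refine ⟨t₀, (a₁ + ζ * (G₀ * (b₁ * ‖P.B‖) * Q₁)) + (a₂ + κ * G₀), ht₀, ht₀1, by positivity,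
    fun t ht htt y => ?_⟩
  set ρ := ‖P.T.negPowL s (S.negPowL 1 y)‖ with hρ
  have hgt : ∀ τ, 0 < τ → τ < t → |P.C (S.op τ (S.negPowL 1 y))| ≤ (G₀ * ρ) * τ ^ (-p) :=
    fun τ h h' => gbound y τ h (h'.le.trans htt)
  have hpow : ∀ {a b : ℝ}, b ≤ a → t ^ a ≤ t ^ b := fun h =>
    Real.rpow_le_rpow_of_exponent_ge ht (htt.trans ht₀1) h
  constructor
  · obtain ⟨hintg, hvol⟩ := volterra hG hβ hS hSs y ht.le
    have hI : ‖∫ τ in (0 : ℝ)..t, P.C (S.op τ (S.negPowL 1 y)) •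
        P.T.extL (P.T.negPowL P.sb) (t - τ) P.B‖ ≤
        (G₀ * ρ * (b₁ * ‖P.B‖)) * (t ^ (1 - p - P.sb) * Q₁) := by
      have hsb' : 0 < 1 - P.sb := by linarith [hsb.2]
      have e := integral_rpow_mul_sub_rpow (a := 1 - p) (by linarith) hsb' ht
      have hi := intervalIntegrable_rpow_mul_sub_rpow (a := 1 - p) (by linarith) hsb' ht
      rw [show 1 - p - 1 = -p by ring, show 1 - P.sb - 1 = -P.sb by ring] at e hi
      rw [show 1 - p + (1 - P.sb) - 1 = 1 - p - P.sb by ring] at e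
      rw [← e, ← intervalIntegral.integral_const_mul]
      refine intervalIntegral.norm_integral_le_of_norm_le ht.le ?_ (hi.const_mul _)
      have hne : ∀ᵐ τ : ℝ, τ ≠ t := by simp [ae_iff]
      filter_upwards [hne] with τ hτ hτ'
      have h1 : τ < t := lt_of_le_of_ne hτ'.2 hτ
      rw [norm_smul, Real.norm_eq_abs]
      have h2 := Real.rpow_nonneg hτ'.1.le (-p)
      calc _ ≤ (G₀ * ρ) * τ ^ (-p) * (b₁ * (t - τ) ^ (-P.sb) * ‖P.B‖) := by
            gcongr
            · exact hgt τ hτ'.1 h1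
            · exact hB _ (sub_pos.2 h1) _
        _ = _ := by ring
    rw [hvol]
    refine (norm_sub_le _ _).trans ?_
    rw [norm_smul, Real.norm_eq_abs, abs_of_nonneg hζ0]
    -- The exponents compare because s_c + s_b < 1, and the powers because t ≤ 1.
    have h1 : t ^ (1 - p - P.sb) ≤ t ^ (-s) := hpow (by rw [hp]; linarith)
    have h2 := Real.rpow_nonneg ht.le (-s)
    calc _ ≤ a₁ * t ^ (-s) * ρ + ζ * ((G₀ * ρ * (b₁ * ‖P.B‖)) * (t ^ (-s) * Q₁)) := by
          gcongr
          · exact hT t ht _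
          · exact hI.trans (by gcongr)
      _ = (a₁ + ζ * (G₀ * (b₁ * ‖P.B‖) * Q₁)) * t ^ (-s) * ρ := by ring
      _ ≤ _ := by
          refine mul_le_mul_of_nonneg_right (mul_le_mul_of_nonneg_right ?_ h2) (norm_nonneg _)
          linarith [mul_nonneg hκ0 hG₀0]
  · refine (key t ht y (G₀ * ρ) (by positivity) hgt).trans (ENNReal.ofReal_le_ofReal ?_)
    have h1 : t ^ (1 - p - θ) ≤ t ^ (-p) := hpow (by linarith)
    have h2 := Real.rpow_nonneg ht.le (-p)
    calc _ ≤ a₂ * t ^ (-p) * ρ + κ * (G₀ * ρ) * t ^ (-p) := by gcongr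
      _ = (a₂ + κ * G₀) * t ^ (-p) * ρ := by ring
      _ ≤ _ := by
          refine mul_le_mul_of_nonneg_right (mul_le_mul_of_nonneg_right ?_ h2) (norm_nonneg _)
          have : 0 ≤ ζ * (G₀ * (b₁ * ‖P.B‖) * Q₁) := by positivity
          linarith

end Plant

/-! ### Bounds for e^{A_β t} at all times. -/

/-- The weight `c (1 + t^{-p}) e^{-ω t}`. -/
def wt (c ω p t : ℝ) : ℝ := c * (1 + t ^ (-p)) * Real.exp (-ω * t)

theorem wt_nonneg {c ω p t : ℝ} (hc : 0 ≤ c) (ht : 0 ≤ t) : 0 ≤ wt c ω p t := by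
  have := Real.rpow_nonneg ht (-p)
  unfold wt
  positivity

theorem integrableOn_wt {ω p : ℝ} (c : ℝ) (hω : 0 < ω) (hp : p < 1) :
    IntegrableOn (wt c ω p) (Ioi 0) := by
  have h := (integrableOn_rpow_mul_exp (p := 0) (by norm_num) hω c).add
    (integrableOn_rpow_mul_exp (p := -p) (by linarith) hω c)
  refine h.congr (Eventually.of_forall fun t => ?_)
  simp only [Pi.add_apply, wt, Real.rpow_zero]
  ring

theorem tendsto_wt {ω p : ℝ} (c : ℝ) (hω : 0 < ω) : Tendsto (wt c ω p) atTop (𝓝 0) := by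
  have h := ((tendsto_rpow_mul_exp_neg_mul_atTop_nhds_zero 0 ω hω).add
    (tendsto_rpow_mul_exp_neg_mul_atTop_nhds_zero (-p) ω hω)).const_mul c
  rw [add_zero, mul_zero] at h
  refine h.congr fun t => ?_
  simp only [wt, Real.rpow_zero]
  ring

theorem rpow_neg_le_one_add {a p t : ℝ} (ht : 0 < t) (ha : 0 ≤ a) (hap : a ≤ p) :
    t ^ (-a) ≤ 1 + t ^ (-p) := by
  rcases le_total t 1 with h | h
  · have := Real.rpow_le_rpow_of_exponent_ge ht h (neg_le_neg hap)
    linarith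
  · have := Real.rpow_le_one_of_one_le_of_nonpos h (neg_nonpos.2 ha)
    linarith [Real.rpow_nonneg ht.le (-p)]

namespace Plant

variable {P : Plant Z} {β : ℝ} {S : C0Semigroup Z}

/-- The domain of A_β is dense and both inequalities are closed conditions on x; for the range norm
this is seen by testing against one v at a time. -/
theorem short_time (hG : P.G ≠ 0) (hβ : β ∈ Ioo (0 : ℝ) 1)
    (hS : S.GeneratedBy (P.regGraph β)) (hSs : S.ExpStable) {s : ℝ} (hs : 0 ≤ s)
    (hs1 : P.sc + s < 1) :
    ∃ t₀ M : ℝ, 0 < t₀ ∧ t₀ ≤ 1 ∧ 0 ≤ M ∧ ∀ t, 0 < t → t ≤ t₀ → ∀ x,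
      ‖S.op t x‖ ≤ M * t ^ (-s) * ‖P.T.negPowL s x‖ ∧
      imgNorm (P.T.negPowL P.sc) (S.op t x) ≤
        ENNReal.ofReal (M * t ^ (-(P.sc + s)) * ‖P.T.negPowL s x‖) := by
  obtain ⟨t₀, M, h0, h1, hM, h⟩ := short_time_dom hG hβ hS hSs hs hs1
  have hinj := P.stable.negPowL_injective P.sc_mem.1 P.sc_mem.2.le
  have hden := P.stable.denseRange_negPowL P.sc_mem.1 P.sc_mem.2.le
  refine ⟨t₀, M, h0, h1, hM, fun t ht htt x => ?_⟩
  have hp := Real.rpow_nonneg ht.le (-(P.sc + s))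
  constructor
  · exact hSs.denseRange_negPowL_one.induction_on x
      (isClosed_le (by fun_prop) (by fun_prop)) fun y => (h t ht htt y).1
  · rw [imgNorm_le_ofReal_iff hinj hden (by positivity)]
    intro v
    refine hSs.denseRange_negPowL_one.induction_on x
      (isClosed_le (by fun_prop) (by fun_prop)) fun y => ?_
    exact (imgNorm_le_ofReal_iff hinj hden (by positivity)).1 (h t ht htt y).2 v

/-- Beyond t₀ one writes S(t) = S(t-t₀)S(t₀): the second factor changes the norm, the first supplies
the decay. -/
theorem norm_op_le_wt (hG : P.G ≠ 0) (hβ : β ∈ Ioo (0 : ℝ) 1)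
    (hS : S.GeneratedBy (P.regGraph β)) (hSs : S.ExpStable) {s : ℝ} (hs : 0 ≤ s)
    (hs1 : P.sc + s < 1) :
    ∃ c ω : ℝ, 0 ≤ c ∧ 0 < ω ∧ ∀ t, 0 < t → ∀ x, ‖S.op t x‖ ≤ wt c ω s t * ‖P.T.negPowL s x‖ := by
  obtain ⟨t₀, M, ht₀, ht₀1, hM, h⟩ := short_time hG hβ hS hSs hs hs1
  obtain ⟨K, ω, hK, hω, hexp⟩ := hSs.norm_le
  have hr := Real.rpow_nonneg ht₀.le (-s)
  refine ⟨M * Real.exp ω * (1 + K * t₀ ^ (-s)), ω, by positivity, hω, fun t ht x => ?_⟩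
  have hrt := Real.rpow_nonneg ht.le (-s)
  rcases le_or_gt t t₀ with htt | htt
  · refine (h t ht htt x).1.trans ?_
    have h1 : 1 ≤ Real.exp ω * Real.exp (-ω * t) := by
      rw [← Real.exp_add]
      exact Real.one_le_exp (by nlinarith)
    unfold wt
    refine mul_le_mul_of_nonneg_right ?_ (norm_nonneg _)
    calc M * t ^ (-s) = M * (1 * t ^ (-s)) * 1 := by ring
      _ ≤ M * ((1 + K * t₀ ^ (-s)) * (1 + t ^ (-s))) * (Real.exp ω * Real.exp (-ω * t)) := by
          gcongr
          · linarith [mul_nonneg (by linarith : (0 : ℝ) ≤ K) hr]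
          · linarith
      _ = _ := by ring
  · have e : S.op t x = S.op (t - t₀) (S.op t₀ x) := by
      rw [← S.op_add_apply (by linarith) ht₀.le, sub_add_cancel]
    rw [e]
    refine (hexp _ (by linarith) _).trans ?_
    have h1 : Real.exp (-ω * (t - t₀)) ≤ Real.exp ω * Real.exp (-ω * t) := by
      rw [← Real.exp_add]
      exact Real.exp_le_exp.2 (by nlinarith)
    calc _ ≤ K * (Real.exp ω * Real.exp (-ω * t)) * (M * t₀ ^ (-s) * ‖P.T.negPowL s x‖) := by
          gcongr
          exact (h t₀ ht₀ le_rfl x).1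
      _ = M * Real.exp ω * (K * t₀ ^ (-s)) * 1 * Real.exp (-ω * t) * ‖P.T.negPowL s x‖ := by ring
      _ ≤ _ := by
          unfold wt
          gcongr
          · linarith
          · linarith

theorem smooths_S (hG : P.G ≠ 0) (hβ : β ∈ Ioo (0 : ℝ) 1)
    (hS : S.GeneratedBy (P.regGraph β)) (hSs : S.ExpStable) {s : ℝ} (hs : 0 ≤ s)
    (hs1 : P.sc + s < 1) : S.Smooths (P.T.negPowL s) := by
  obtain ⟨c, ω, -, -, h⟩ := norm_op_le_wt hG hβ hS hSs hs hs1
  exact fun t ht => ⟨_, h t ht⟩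

theorem norm_extL_le_wt (hG : P.G ≠ 0) (hβ : β ∈ Ioo (0 : ℝ) 1)
    (hS : S.GeneratedBy (P.regGraph β)) (hSs : S.ExpStable) {s : ℝ} (hs : 0 ≤ s)
    (hs1 : P.sc + s < 1) :
    ∃ c ω : ℝ, 0 ≤ c ∧ 0 < ω ∧ ∀ t, 0 < t → ∀ v,
      ‖S.extL (P.T.negPowL s) t v‖ ≤ wt c ω s t * ‖v‖ := by
  obtain ⟨c, ω, hc, hω, h⟩ := norm_op_le_wt hG hβ hS hSs hs hs1
  exact ⟨c, ω, hc, hω, fun t ht v => C0Semigroup.norm_extL_le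
    (P.stable.denseRange_negPowL hs (by linarith [P.sc_mem.1])) (h t ht) v⟩

theorem imgNorm_extL_le_wt (hG : P.G ≠ 0) (hβ : β ∈ Ioo (0 : ℝ) 1)
    (hS : S.GeneratedBy (P.regGraph β)) (hSs : S.ExpStable) {s : ℝ} (hs : 0 ≤ s)
    (hs1 : P.sc + s < 1) :
    ∃ c ω : ℝ, 0 ≤ c ∧ 0 < ω ∧ ∀ t, 0 < t → ∀ v,
      imgNorm (P.T.negPowL P.sc) (S.extL (P.T.negPowL s) t v) ≤
        ENNReal.ofReal (wt c ω (P.sc + s) t * ‖v‖) := by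
  have hsc := P.sc_mem
  obtain ⟨t₀, M, ht₀, ht₀1, hM, h⟩ := short_time hG hβ hS hSs le_rfl (by simpa using hsc.2)
  obtain ⟨c, ω, hc, hω, hE⟩ := norm_extL_le_wt hG hβ hS hSs hs hs1
  have hd := P.stable.denseRange_negPowL hs (by linarith [P.sc_mem.1])
  have hsm := smooths_S hG hβ hS hSs hs hs1
  have hr := Real.rpow_nonneg ht₀.le (-P.sc)
  have h2 := Real.rpow_nonneg (zero_le_two (α := ℝ)) P.sc
  have h2s := Real.rpow_nonneg (zero_le_two (α := ℝ)) s
  refine ⟨M * c * Real.exp ω * ((2 ^ P.sc + t₀ ^ (-P.sc)) * (1 + 2 ^ s)) * 4, ω, by positivity, hω,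
    fun t ht v => ?_⟩
  -- The last m units of time give the passage from `Z` to Z^{s_c}, where the short-time bound
  -- requires m ≤ t₀. The remaining t - m ≥ t/2 give the passage from Z^{-s} to `Z` together with
  -- the decay.
  set m := min (t / 2) t₀ with hm
  have hm0 : 0 < m := lt_min (by linarith) ht₀
  have hmt : m ≤ t / 2 := min_le_left _ _
  have hmt₀ : m ≤ t₀ := min_le_right _ _
  have htm : 0 < t - m := by linarith
  have e : S.extL (P.T.negPowL s) t v = S.op m (S.extL (P.T.negPowL s) (t - m) v) := by
    rw [hsm.op_extL hd hm0.le htm, add_sub_cancel]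
  rw [e]
  refine (h m hm0 hmt₀ _).2.trans (ENNReal.ofReal_le_ofReal ?_)
  rw [P.stable.negPowL_zero, add_zero]
  have ht2 : 0 < t / 2 := by linarith
  have half : ∀ a : ℝ, (t / 2) ^ (-a) = 2 ^ a * t ^ (-a) := by
    intro a
    rw [Real.div_rpow ht.le zero_le_two, Real.rpow_neg zero_le_two, div_inv_eq_mul, mul_comm]
  have pa := Real.rpow_nonneg ht.le (-P.sc)
  have pb := Real.rpow_nonneg ht.le (-s)
  have pc := Real.rpow_nonneg ht.le (-(P.sc + s))
  have b1 : m ^ (-P.sc) ≤ (2 ^ P.sc + t₀ ^ (-P.sc)) * (1 + t ^ (-P.sc)) := by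
    rcases min_choice (t / 2) t₀ with hc' | hc'
    · rw [hm, hc', half]
      nlinarith [mul_nonneg hr pa]
    · rw [hm, hc']
      nlinarith [mul_nonneg hr pa, mul_nonneg h2 pa]
  have b2 : 1 + (t - m) ^ (-s) ≤ (1 + 2 ^ s) * (1 + t ^ (-s)) := by
    have : (t - m) ^ (-s) ≤ (t / 2) ^ (-s) :=
      Real.rpow_le_rpow_of_nonpos ht2 (by linarith) (by linarith)
    rw [half] at this
    nlinarith
  have b3 : Real.exp (-ω * (t - m)) ≤ Real.exp ω * Real.exp (-ω * t) := by
    rw [← Real.exp_add]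
    exact Real.exp_le_exp.2 (by nlinarith)
  have b4 : (1 + t ^ (-P.sc)) * (1 + t ^ (-s)) ≤ 4 * (1 + t ^ (-(P.sc + s))) := by
    have e1 := rpow_neg_le_one_add ht hsc.1 (show P.sc ≤ P.sc + s by linarith)
    have e2 := rpow_neg_le_one_add ht hs (show s ≤ P.sc + s by linarith [hsc.1])
    have e3 : t ^ (-P.sc) * t ^ (-s) = t ^ (-(P.sc + s)) := by
      rw [← Real.rpow_add ht]; congr 1; ring
    nlinarith
  have pm := Real.rpow_nonneg hm0.le (-P.sc)
  have pm2 := Real.rpow_nonneg htm.le (-s)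
  calc M * m ^ (-P.sc) * ‖S.extL (P.T.negPowL s) (t - m) v‖
      ≤ M * m ^ (-P.sc) * (c * (1 + (t - m) ^ (-s)) * Real.exp (-ω * (t - m)) * ‖v‖) := by
        gcongr; exact hE _ htm v
    _ ≤ M * ((2 ^ P.sc + t₀ ^ (-P.sc)) * (1 + t ^ (-P.sc))) *
        (c * ((1 + 2 ^ s) * (1 + t ^ (-s))) * (Real.exp ω * Real.exp (-ω * t)) * ‖v‖) := by
        gcongr
    _ = M * c * Real.exp ω * ((2 ^ P.sc + t₀ ^ (-P.sc)) * (1 + 2 ^ s)) *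
        ((1 + t ^ (-P.sc)) * (1 + t ^ (-s))) * Real.exp (-ω * t) * ‖v‖ := by ring
    _ ≤ M * c * Real.exp ω * ((2 ^ P.sc + t₀ ^ (-P.sc)) * (1 + 2 ^ s)) *
        (4 * (1 + t ^ (-(P.sc + s)))) * Real.exp (-ω * t) * ‖v‖ := by gcongr
    _ = _ := by unfold wt; ring

end Plant

theorem wt_le_rpow {c ω p σ t : ℝ} (hc : 0 ≤ c) (hω : 0 < ω) (hp : 0 ≤ p) (hσ : 0 < σ)
    (hσt : σ ≤ t) : wt c ω p σ ≤ c * (t ^ p + 1) * σ ^ (-p) := by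
  have h1 : Real.exp (-ω * σ) ≤ 1 := Real.exp_le_one_iff.2 (by nlinarith)
  have h2 : 1 ≤ t ^ p * σ ^ (-p) := by
    rw [Real.rpow_neg hσ.le, ← div_eq_mul_inv, one_le_div (Real.rpow_pos_of_pos hσ p)]
    exact Real.rpow_le_rpow hσ.le hσt hp
  have h3 := Real.rpow_nonneg hσ.le (-p)
  calc _ ≤ c * (1 + σ ^ (-p)) * 1 := by unfold wt; gcongr
    _ ≤ c * (t ^ p * σ ^ (-p) + σ ^ (-p)) * 1 := by gcongr
    _ = _ := by ring

theorem IsCb1.continuousOn {r : ℝ → ℝ} (hr : IsCb1 r) : ContinuousOn r (Ici 0) := hr.1.continuousOn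

theorem IsCb1.continuousOn_deriv {r : ℝ → ℝ} (hr : IsCb1 r) :
    ContinuousOn (derivWithin r (Ici 0)) (Ici 0) :=
  hr.1.continuousOn_derivWithin (uniqueDiffOn_Ici 0) le_rfl

theorem IsCb1.hasDerivAt {r : ℝ → ℝ} (hr : IsCb1 r) {t : ℝ} (ht : 0 < t) :
    HasDerivAt r (derivWithin r (Ici 0) t) t :=
  ((hr.1.differentiableOn one_ne_zero t ht.le).hasDerivWithinAt).hasDerivAt (Ici_mem_nhds ht)

/-- Integration by parts against a tail integral. -/
theorem integral_smul_comp_sub {F : ℝ → Z} (hFc : ContinuousOn F (Ioi 0))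
    (hFi : IntegrableOn F (Ioi 0)) {r : ℝ → ℝ} (hr : IsCb1 r) {t : ℝ} (ht : 0 < t)
    (hi : IntervalIntegrable (fun τ => r τ • F (t - τ)) volume 0 t) :
    ∫ τ in (0 : ℝ)..t, r τ • F (t - τ) = r t • (∫ σ in Ioi (0 : ℝ), F σ) -
      r 0 • (∫ σ in Ioi t, F σ) -
      ∫ τ in (0 : ℝ)..t, derivWithin r (Ici 0) τ • ∫ σ in Ioi (t - τ), F σ := by
  -- On σ ≥ 0 this is the tail integral, in a form to which the fundamental theorem of calculus
  -- applies: q' = -F.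
  set q : ℝ → Z := fun σ => (∫ u in Ioi (0 : ℝ), F u) - ∫ u in (0 : ℝ)..σ, F u with hq
  have hFii : ∀ σ, 0 ≤ σ → IntervalIntegrable F volume 0 σ := fun σ hσ =>
    (intervalIntegrable_iff_integrableOn_Ioc_of_le hσ).2 (hFi.mono_set Ioc_subset_Ioi_self)
  have hqt : ∀ σ, 0 ≤ σ → ∫ u in Ioi σ, F u = q σ := by
    intro σ hσ
    rw [hq]
    simp only
    rw [← intervalIntegral.integral_interval_add_Ioi hFi (hFi.mono_set (Ioi_subset_Ioi hσ))]
    abel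
  have hqd : ∀ σ, 0 < σ → HasDerivAt q (-F σ) σ := by
    intro σ hσ
    have := intervalIntegral.integral_hasDerivAt_right (hFii σ hσ.le)
      (hFc.stronglyMeasurableAtFilter isOpen_Ioi σ hσ)
      (hFc.continuousAt (Ioi_mem_nhds hσ))
    exact this.const_sub _
  have hqc : ContinuousOn q (Icc 0 t) := by
    have h1 : IntegrableOn F (Icc 0 t) := by
      rw [integrableOn_Icc_iff_integrableOn_Ioc]
      exact hFi.mono_set Ioc_subset_Ioi_self
    have h2 := intervalIntegral.continuousOn_primitive_interval (a := 0) (b := t)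
      (by rwa [uIcc_of_le ht.le])
    rw [uIcc_of_le ht.le] at h2
    exact continuousOn_const.sub h2
  have hqc' : ContinuousOn (fun τ => q (t - τ)) (Icc 0 t) :=
    hqc.comp (by fun_prop) fun τ hτ => ⟨by linarith [hτ.2], by linarith [hτ.1]⟩
  have hrc := hr.continuousOn.mono (Icc_subset_Ici_self : Icc 0 t ⊆ Ici 0)
  have hrc' := hr.continuousOn_deriv.mono (Icc_subset_Ici_self : Icc 0 t ⊆ Ici 0)
  have hi2 : IntervalIntegrable (fun τ => derivWithin r (Ici 0) τ • q (t - τ)) volume 0 t := by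
    refine ContinuousOn.intervalIntegrable ?_
    rw [uIcc_of_le ht.le]
    exact hrc'.smul hqc'
  have h := intervalIntegral.integral_eq_sub_of_hasDerivAt_of_le ht.le
    (f := fun τ => r τ • q (t - τ))
    (f' := fun τ => r τ • F (t - τ) + derivWithin r (Ici 0) τ • q (t - τ))
    (hrc.smul hqc') (fun τ hτ => by
      have h1 : HasDerivAt (fun τ => q (t - τ)) (F (t - τ)) τ := by
        have := (hqd (t - τ) (sub_pos.2 hτ.2)).scomp τ ((hasDerivAt_id τ).const_sub t)
        exact this.congr_deriv (by simp)
      exact (hr.hasDerivAt hτ.1).smul h1) (hi.add hi2)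
  rw [intervalIntegral.integral_add hi hi2, sub_self, sub_zero, ← hqt 0 le_rfl, ← hqt t ht.le] at h
  rw [eq_sub_of_add_eq h]
  congr 1
  refine intervalIntegral.integral_congr fun τ hτ => ?_
  rw [uIcc_of_le ht.le] at hτ
  rw [hqt _ (sub_nonneg.2 hτ.2)]

/-! ### The output of the forced linear system. -/

namespace Plant

variable {P : Plant Z} {β : ℝ} {S : C0Semigroup Z}

theorem extOp_eq (hG : P.G ≠ 0) (hβ : β ∈ Ioo (0 : ℝ) 1)
    (hS : S.GeneratedBy (P.regGraph β)) (hSs : S.ExpStable) {s : ℝ} (hs : 0 ≤ s)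
    (hs1 : P.sc + s < 1) {t : ℝ} (ht : 0 < t) (v : Z) :
    P.extOp S s t v = S.extL (P.T.negPowL s) t v := by
  rw [extOp, ← P.stable.coe_negPowL hs]
  exact (smooths_S hG hβ hS hSs hs hs1).limUnder_eq
    (P.stable.denseRange_negPowL hs (by linarith [P.sc_mem.1])) ht v

theorem SB_eq (hG : P.G ≠ 0) (hβ : β ∈ Ioo (0 : ℝ) 1)
    (hS : S.GeneratedBy (P.regGraph β)) (hSs : S.ExpStable) {t : ℝ} (ht : 0 < t) :
    P.SB S t = S.extL (P.T.negPowL P.sb) t P.B :=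
  extOp_eq hG hβ hS hSs P.sb_mem.1 P.sc_add_sb ht _

theorem SI0_eq (P : Plant Z) (S : C0Semigroup Z) (t : ℝ) (x : Z) :
    P.SI0 S t x = S.op t x + (-P.CN 1 x) • P.SB S t := by
  rw [SI0, P.CN_apply P.sc_mem.2.le, P.stable.negPowL_apply zero_le_one]

theorem SI0Bd_eq (hG : P.G ≠ 0) (hβ : β ∈ Ioo (0 : ℝ) 1)
    (hS : S.GeneratedBy (P.regGraph β)) (hSs : S.ExpStable) {t : ℝ} (ht : 0 < t) :
    P.SI0Bd S t = S.extL (P.T.negPowL P.sd) t P.bd +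
      (-P.CN (1 - P.sd) P.bd) • S.extL (P.T.negPowL P.sb) t P.B := by
  rw [SI0Bd, extOp_eq hG hβ hS hSs P.sd_mem.1 P.sc_add_sd ht, SB_eq hG hβ hS hSs ht,
    P.CN_apply (by linarith [P.sc_add_sd]), P.stable.negPowL_apply (by linarith [P.sd_mem.2])]

theorem C_negPow_S (hG : P.G ≠ 0) (hβ : β ∈ Ioo (0 : ℝ) 1)
    (hS : S.GeneratedBy (P.regGraph β)) (hSs : S.ExpStable) (y : Z) :
    P.C (S.negPow 1 y) = β * P.CN 1 y := by
  rw [← hSs.negPowL_apply zero_le_one, C_negPowL_one hG hβ hS hSs, P.CN_apply P.sc_mem.2.le]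

theorem integrableOn_extL (hG : P.G ≠ 0) (hβ : β ∈ Ioo (0 : ℝ) 1)
    (hS : S.GeneratedBy (P.regGraph β)) (hSs : S.ExpStable) {s : ℝ} (hs : 0 ≤ s)
    (hs1 : P.sc + s < 1) :
    (∀ v, IntegrableOn (fun τ => S.extL (P.T.negPowL s) τ v) (Ioi 0)) ∧
      ∃ L : Z →L[ℝ] Z, ∀ v, L v = ∫ τ in Ioi (0 : ℝ), S.extL (P.T.negPowL s) τ v := by
  obtain ⟨c, ω, hc, hω, h⟩ := norm_extL_le_wt hG hβ hS hSs hs hs1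
  have hd := P.stable.denseRange_negPowL hs (by linarith [P.sc_mem.1])
  exact exists_clm_integral (fun v => ((smooths_S hG hβ hS hSs hs hs1).continuousOn_extL hd
    v).aestronglyMeasurable measurableSet_Ioi)
    (integrableOn_wt c hω (by linarith [P.sc_mem.1])) h

/-- `C ∫₀^∞ e^{A_β τ} v dτ = β C (-A)^{-1} v` for `v` in the extrapolation space. -/
theorem C_integral_extL (hG : P.G ≠ 0) (hβ : β ∈ Ioo (0 : ℝ) 1)
    (hS : S.GeneratedBy (P.regGraph β)) (hSs : S.ExpStable) {s : ℝ} (hs : 0 ≤ s)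
    (hs1 : P.sc + s < 1) (v : Z) :
    P.C (∫ τ in Ioi (0 : ℝ), S.extL (P.T.negPowL s) τ v) = β * P.CN (1 - s) v := by
  have hs' : s < 1 := by linarith [P.sc_mem.1]
  have hd := P.stable.denseRange_negPowL hs hs'.le
  obtain ⟨-, L, hL⟩ := integrableOn_extL hG hβ hS hSs hs hs1
  -- Both sides are continuous in v and agree on the dense image of `Z`, where the left side is
  -- (-A_β)⁻¹. Since C need not be continuous on `Z`, it is applied only after the identity holds
  -- for every v.
  have key : L v = P.T.negPowL (1 - s) v -
      ((1 - β) * P.CN (1 - s) v) • P.T.negPowL (1 - P.sb) P.B := by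
    refine hd.induction_on v (isClosed_eq (by fun_prop) (by fun_prop)) fun x => ?_
    have h1 : L (P.T.negPowL s x) = S.negPowL 1 x := by
      rw [hL, hSs.negPowL_one]
      exact setIntegral_congr_fun measurableSet_Ioi fun τ hτ =>
        (smooths_S hG hβ hS hSs hs hs1).extL_apply hd hτ x
    rw [h1, negPowL_one_eq hG hβ hS hSs, P.CN_apply (by linarith),
      P.stable.negPowL_negPowL (by linarith) hs, sub_add_cancel]
  rw [← hL, key, map_sub, map_smul, P.C_negPowL_B hG, ← P.CN_apply (by linarith), smul_eq_mul]
  ring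

/-- A shift of time shows that the tail of an orbit is (-A_β)⁻¹ of its value at t. The tail thus
lies in the domain, where C is given by a bounded functional. -/
theorem integral_Ioi_extL (hG : P.G ≠ 0) (hβ : β ∈ Ioo (0 : ℝ) 1)
    (hS : S.GeneratedBy (P.regGraph β)) (hSs : S.ExpStable) {s : ℝ} (hs : 0 ≤ s)
    (hs1 : P.sc + s < 1) {t : ℝ} (ht : 0 < t) (v : Z) :
    ∫ τ in Ioi t, S.extL (P.T.negPowL s) τ v = S.negPowL 1 (S.extL (P.T.negPowL s) t v) := by
  have hd := P.stable.denseRange_negPowL hs (by linarith [P.sc_mem.1])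
  have hsm := smooths_S hG hβ hS hSs hs hs1
  rw [hSs.negPowL_one]
  have h := integral_add_right_eq_self (μ := volume)
    ((Ioi t).indicator fun τ => S.extL (P.T.negPowL s) τ v) t
  rw [integral_indicator measurableSet_Ioi] at h
  rw [← h, ← integral_indicator measurableSet_Ioi]
  congr 1
  ext τ
  by_cases hτ : 0 < τ
  · rw [indicator_of_mem (show τ ∈ Ioi 0 from hτ), indicator_of_mem (by simpa using hτ),
      hsm.op_extL hd hτ.le ht]
  · rw [indicator_of_notMem (show τ ∉ Ioi 0 from hτ), indicator_of_notMem (by simpa using hτ)]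

/-- The response to an input `r` entering through an element of the extrapolation space. -/
theorem linear_response (hG : P.G ≠ 0) (hβ : β ∈ Ioo (0 : ℝ) 1)
    (hS : S.GeneratedBy (P.regGraph β)) (hSs : S.ExpStable) {s : ℝ} (hs : 0 ≤ s)
    (hs1 : P.sc + s < 1) (v : Z) {r : ℝ → ℝ} (hr : IsCb1 r) {t : ℝ} (ht : 0 < t) :
    IntervalIntegrable (fun τ => r τ • S.extL (P.T.negPowL s) (t - τ) v) volume 0 t ∧
    IntervalIntegrable (fun τ => derivWithin r (Ici 0) τ *
      P.CN 1 (S.extL (P.T.negPowL s) (t - τ) v)) volume 0 t ∧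
    P.C (∫ τ in (0 : ℝ)..t, r τ • S.extL (P.T.negPowL s) (t - τ) v) =
      β * (r t * P.CN (1 - s) v - r 0 * P.CN 1 (S.extL (P.T.negPowL s) t v) -
        ∫ τ in (0 : ℝ)..t, derivWithin r (Ici 0) τ *
          P.CN 1 (S.extL (P.T.negPowL s) (t - τ) v)) := by
  have hs' : s < 1 := by linarith [P.sc_mem.1]
  have hd := P.stable.denseRange_negPowL hs hs'.le
  obtain ⟨c, ω, hc, hω, hb⟩ := norm_extL_le_wt hG hβ hS hSs hs hs1
  have hFc := (smooths_S hG hβ hS hSs hs hs1).continuousOn_extL hd v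
  have hFb : ∀ σ, 0 < σ → σ ≤ t → ‖S.extL (P.T.negPowL s) σ v‖ ≤
      (c * (t ^ s + 1) * ‖v‖) * σ ^ (-s) := fun σ hσ hσt =>
    (hb σ hσ v).trans ((mul_le_mul_of_nonneg_right (wt_le_rpow hc hω hs hσ hσt)
      (norm_nonneg v)).trans_eq (by ring))
  have i1 := intervalIntegrable_smul_comp_sub (F := fun σ => S.extL (P.T.negPowL s) σ v) ht.le
    (hr.continuousOn.mono Icc_subset_Ici_self) hFc hFb hs'
  have i2 := intervalIntegrable_smul_comp_sub (F := fun σ => S.extL (P.T.negPowL s) σ v) ht.le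
    (hr.continuousOn_deriv.mono Icc_subset_Ici_self) hFc hFb hs'
  have i3 : IntervalIntegrable (fun τ => P.CN 1 (derivWithin r (Ici 0) τ •
      S.extL (P.T.negPowL s) (t - τ) v)) volume 0 t :=
    ⟨(P.CN 1).integrable_comp i2.1, (P.CN 1).integrable_comp i2.2⟩
  simp only [map_smul, smul_eq_mul] at i3
  refine ⟨i1, i3, ?_⟩
  rw [integral_smul_comp_sub hFc ((integrableOn_extL hG hβ hS hSs hs hs1).1 v) hr ht i1,
    integral_Ioi_extL hG hβ hS hSs hs hs1 ht]
  -- The remaining integral is (-A_β)⁻¹ of an integral converging in `Z`, and C(-A_β)⁻¹ is bounded,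
  -- so C passes under this integral at once.
  have e : ∫ τ in (0 : ℝ)..t, derivWithin r (Ici 0) τ •
      ∫ σ in Ioi (t - τ), S.extL (P.T.negPowL s) σ v =
      S.negPowL 1 (∫ τ in (0 : ℝ)..t, derivWithin r (Ici 0) τ •
        S.extL (P.T.negPowL s) (t - τ) v) := by
    rw [← ContinuousLinearMap.intervalIntegral_comp_comm _ i2]
    refine intervalIntegral.integral_congr_ae ?_
    have : ∀ᵐ τ : ℝ, τ ≠ t := by simp [ae_iff]
    filter_upwards [this] with τ hτ hτ'
    rw [uIoc_of_le ht.le] at hτ'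
    rw [map_smul, integral_Ioi_extL hG hβ hS hSs hs hs1 (sub_pos.2 (lt_of_le_of_ne hτ'.2 hτ))]
  rw [e]
  simp only [map_sub, map_smul, C_integral_extL hG hβ hS hSs hs hs1,
    C_negPowL_one hG hβ hS hSs, ← P.CN_apply P.sc_mem.2.le, smul_eq_mul]
  rw [← ContinuousLinearMap.intervalIntegral_comp_comm _ i2]
  simp only [map_smul, smul_eq_mul]
  ring

theorem K_eq (hG : P.G ≠ 0) (hβ : β ∈ Ioo (0 : ℝ) 1)
    (hS : S.GeneratedBy (P.regGraph β)) (hSs : S.ExpStable) {t : ℝ} (ht : 0 < t) :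
    P.K β S t = P.CN 1 (S.extL (P.T.negPowL P.sb) t P.B) := by
  rw [K, SB_eq hG hβ hS hSs ht, C_negPow_S hG hβ hS hSs, inv_mul_cancel_left₀ hβ.1.ne']

theorem Kd_eq (hG : P.G ≠ 0) (hβ : β ∈ Ioo (0 : ℝ) 1)
    (hS : S.GeneratedBy (P.regGraph β)) (hSs : S.ExpStable) {t : ℝ} (ht : 0 < t) :
    P.Kd S t = β * (P.CN 1 (S.extL (P.T.negPowL P.sd) t P.bd) -
      P.CN (1 - P.sd) P.bd * P.CN 1 (S.extL (P.T.negPowL P.sb) t P.B)) := by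
  rw [Kd, SI0Bd_eq hG hβ hS hSs ht, C_negPow_S hG hβ hS hSs, map_add, map_smul, smul_eq_mul]
  ring

theorem CN_B (hG : P.G ≠ 0) : P.CN (1 - P.sb) P.B = 1 := by
  rw [P.CN_apply (by linarith [P.sc_add_sb]), P.C_negPowL_B hG]

/-- The output of the linear part of the regulated plant. -/
theorem C_linear_part (hG : P.G ≠ 0) (hβ : β ∈ Ioo (0 : ℝ) 1)
    (hS : S.GeneratedBy (P.regGraph β)) (hSs : S.ExpStable) {r d : ℝ → ℝ} (hr : IsCb1 r)
    (hd : IsCb1 d) {t : ℝ} (ht : 0 < t) :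
    P.C (∫ τ in (0 : ℝ)..t, ((β⁻¹ * r τ) • P.SB S (t - τ) + d τ • P.SI0Bd S (t - τ))) =
      r t - (P.K β S t * r 0 + P.Kd S t * d 0) -
        (∫ τ in Ioo 0 t, derivWithin r (Ici 0) τ * P.K β S (t - τ)) -
        ∫ τ in Ioo 0 t, derivWithin d (Ici 0) τ * P.Kd S (t - τ) := by
  obtain ⟨i1, j1, h1⟩ := linear_response hG hβ hS hSs P.sb_mem.1 P.sc_add_sb P.B hr ht
  obtain ⟨i2, j2, h2⟩ := linear_response hG hβ hS hSs P.sb_mem.1 P.sc_add_sb P.B hd ht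
  obtain ⟨i3, j3, h3⟩ := linear_response hG hβ hS hSs P.sd_mem.1 P.sc_add_sd P.bd hd ht
  set κ := P.CN (1 - P.sd) P.bd with hκ
  set E := S.extL (P.T.negPowL P.sb)
  set E' := S.extL (P.T.negPowL P.sd)
  have hne : ∀ᵐ τ : ℝ, τ ≠ t := by simp [ae_iff]
  have e0 : ∫ τ in (0 : ℝ)..t, ((β⁻¹ * r τ) • P.SB S (t - τ) + d τ • P.SI0Bd S (t - τ)) =
      ∫ τ in (0 : ℝ)..t, (β⁻¹ • (r τ • E (t - τ) P.B) +
        (d τ • E' (t - τ) P.bd - κ • (d τ • E (t - τ) P.B))) := by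
    refine intervalIntegral.integral_congr_ae ?_
    filter_upwards [hne] with τ hτ hτ'
    rw [uIoc_of_le ht.le] at hτ'
    have hpos : 0 < t - τ := sub_pos.2 (lt_of_le_of_ne hτ'.2 hτ)
    rw [SB_eq hG hβ hS hSs hpos, SI0Bd_eq hG hβ hS hSs hpos]
    module
  have i1' : IntervalIntegrable (fun τ => β⁻¹ • (r τ • E (t - τ) P.B)) volume 0 t := i1.smul _
  have i2' : IntervalIntegrable (fun τ => κ • (d τ • E (t - τ) P.B)) volume 0 t := i2.smul _
  have i32 : IntervalIntegrable (fun τ => d τ • E' (t - τ) P.bd - κ • (d τ • E (t - τ) P.B))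
    volume 0 t := i3.sub i2'
  -- By `CN_B` the coefficient of `r t` is 1, while the two contributions to the coefficient of `d
  -- t` are κ and -κ up to a common factor. This cancellation is the purpose of I₀.
  rw [e0, intervalIntegral.integral_add i1' i32,
    intervalIntegral.integral_sub i3 i2', intervalIntegral.integral_smul,
    intervalIntegral.integral_smul, map_add, map_sub, map_smul, map_smul, h1, h2, h3, CN_B hG]
  have eK : ∫ τ in Ioo 0 t, derivWithin r (Ici 0) τ * P.K β S (t - τ) =
      ∫ τ in (0 : ℝ)..t, derivWithin r (Ici 0) τ * P.CN 1 (E (t - τ) P.B) := by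
    rw [intervalIntegral.integral_of_le ht.le, integral_Ioc_eq_integral_Ioo]
    exact setIntegral_congr_fun measurableSet_Ioo fun τ hτ => by
      rw [K_eq hG hβ hS hSs (sub_pos.2 hτ.2)]
  have eKd : ∫ τ in Ioo 0 t, derivWithin d (Ici 0) τ * P.Kd S (t - τ) =
      β * ((∫ τ in (0 : ℝ)..t, derivWithin d (Ici 0) τ * P.CN 1 (E' (t - τ) P.bd)) -
        κ * ∫ τ in (0 : ℝ)..t, derivWithin d (Ici 0) τ * P.CN 1 (E (t - τ) P.B)) := by
    rw [← intervalIntegral.integral_const_mul κ,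
      ← intervalIntegral.integral_sub j3 (j2.const_mul κ),
      ← intervalIntegral.integral_const_mul, intervalIntegral.integral_of_le ht.le,
      integral_Ioc_eq_integral_Ioo]
    refine setIntegral_congr_fun measurableSet_Ioo fun τ hτ => ?_
    rw [Kd_eq hG hβ hS hSs (sub_pos.2 hτ.2)]
    ring
  rw [eK, eKd, K_eq hG hβ hS hSs ht, Kd_eq hG hβ hS hSs ht]
  have hβ0 := hβ.1.ne'
  simp only [smul_eq_mul]
  field_simp
  ring

end Plant

/-! ### Convolution inequalities on the half line. -/

section conv

variable {k g : ℝ → ℝ≥0∞}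

/-- The convolution of nonnegative functions on the half line. -/
def conv (k g : ℝ → ℝ≥0∞) (t : ℝ) : ℝ≥0∞ := ∫⁻ τ in Ioo 0 t, k (t - τ) * g τ

theorem setLIntegral_comp_sub (k : ℝ → ℝ≥0∞) (a b t : ℝ) :
    ∫⁻ τ in Ioo a b, k (t - τ) = ∫⁻ σ in Ioo (t - b) (t - a), k σ := by
  rw [← lintegral_indicator measurableSet_Ioo, ← lintegral_indicator measurableSet_Ioo,
    ← lintegral_sub_left_eq_self ((Ioo (t - b) (t - a)).indicator k) t]
  congr 1
  ext τ
  by_cases h : τ ∈ Ioo a b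
  · rw [indicator_of_mem h, indicator_of_mem]
    exact ⟨by linarith [h.2], by linarith [h.1]⟩
  · rw [indicator_of_notMem h, indicator_of_notMem]
    exact fun h' => h ⟨by linarith [h'.2], by linarith [h'.1]⟩

theorem setLIntegral_comp_sub_mul_le {a t : ℝ} {M : ℝ≥0∞} (hM : M ≠ ⊤)
    (hg : ∀ τ ∈ Ioo a t, g τ ≤ M) :
    ∫⁻ τ in Ioo a t, k (t - τ) * g τ ≤ (∫⁻ σ in Ioo 0 (t - a), k σ) * M := by
  calc _ ≤ ∫⁻ τ in Ioo a t, k (t - τ) * M :=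
        setLIntegral_mono' measurableSet_Ioo fun τ hτ => by gcongr; exact hg τ hτ
    _ = _ := by rw [lintegral_mul_const' _ _ hM, setLIntegral_comp_sub, sub_self]

theorem conv_le {t : ℝ} {M : ℝ≥0∞} (hM : M ≠ ⊤) (hg : ∀ τ ∈ Ioo 0 t, g τ ≤ M) :
    conv k g t ≤ (∫⁻ σ in Ioo 0 t, k σ) * M := by
  simpa [conv] using setLIntegral_comp_sub_mul_le (k := k) hM hg

theorem conv_le_add {T t : ℝ} {M : ℝ≥0∞} (hM : M ≠ ⊤)
    (hg : ∀ τ ∈ Ioo T t, g τ ≤ M) :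
    conv k g t ≤ (∫⁻ τ in Ioc 0 T, k (t - τ) * g τ) + (∫⁻ σ in Ioi 0, k σ) * M := by
  calc conv k g t ≤ ∫⁻ τ in Ioc 0 T ∪ Ioo T t, k (t - τ) * g τ := by
        refine lintegral_mono_set fun τ hτ => ?_
        rcases le_or_gt τ T with h | h
        · exact Or.inl ⟨hτ.1, h⟩
        · exact Or.inr ⟨h, hτ.2⟩
    _ ≤ (∫⁻ τ in Ioc 0 T, k (t - τ) * g τ) + ∫⁻ τ in Ioo T t, k (t - τ) * g τ :=
        lintegral_union_le _ _ _
    _ ≤ _ := by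
        gcongr
        refine (setLIntegral_comp_sub_mul_le hM hg).trans ?_
        gcongr
        exact Ioo_subset_Ioi_self

theorem tendsto_setLIntegral_comp_sub_mul {T : ℝ} (hk : Tendsto k atTop (𝓝 0))
    (hg : ∫⁻ τ in Ioc 0 T, g τ ≠ ⊤) :
    Tendsto (fun t => ∫⁻ τ in Ioc 0 T, k (t - τ) * g τ) atTop (𝓝 0) := by
  rw [ENNReal.tendsto_nhds_zero]
  intro δ hδ
  rcases eq_or_ne δ ⊤ with rfl | hδt
  · simp
  -- Adding 1 keeps the quotient finite when the integral vanishes.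
  have hI : 0 < δ / ((∫⁻ τ in Ioc 0 T, g τ) + 1) :=
    ENNReal.div_pos hδ.ne' (by simp [hg])
  obtain ⟨T', hT'⟩ := eventually_atTop.1 ((ENNReal.tendsto_nhds_zero.1 hk) _ hI)
  filter_upwards [eventually_ge_atTop (T' + T)] with t ht
  calc _ ≤ ∫⁻ τ in Ioc 0 T, δ / ((∫⁻ τ in Ioc 0 T, g τ) + 1) * g τ :=
        setLIntegral_mono' measurableSet_Ioc fun τ hτ => by
          gcongr
          exact hT' _ (by linarith [hτ.2])
    _ = δ / ((∫⁻ τ in Ioc 0 T, g τ) + 1) * ∫⁻ τ in Ioc 0 T, g τ :=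
        lintegral_const_mul' _ _ (ENNReal.div_lt_top hδt (by simp)).ne
    _ ≤ δ / ((∫⁻ τ in Ioc 0 T, g τ) + 1) * ((∫⁻ τ in Ioc 0 T, g τ) + 1) := by
        gcongr
        exact le_self_add
    _ ≤ δ := by rw [mul_comm]; exact ENNReal.mul_div_le

/-- For M above the limsup, g < M beyond some T. The history before T fades because k → 0 and g is
locally integrable, and the rest is at most M times the mass of k. Finally M decreases to the
limsup. -/
theorem limsup_conv_le (hk : Tendsto k atTop (𝓝 0)) (hki : ∫⁻ σ in Ioi 0, k σ ≠ ⊤)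
    (hg : ∀ T, ∫⁻ τ in Ioc 0 T, g τ ≠ ⊤) (hgt : limsup g atTop ≠ ⊤) :
    limsup (conv k g) atTop ≤ (∫⁻ σ in Ioi 0, k σ) * limsup g atTop := by
  have key : ∀ M, limsup g atTop < M → M ≠ ⊤ →
      limsup (conv k g) atTop ≤ (∫⁻ σ in Ioi 0, k σ) * M := by
    intro M hM hMt
    obtain ⟨T, hT⟩ := eventually_atTop.1 (eventually_lt_of_limsup_lt hM)
    have h1 : ∀ t, conv k g t ≤ (∫⁻ τ in Ioc 0 (max T 0), k (t - τ) * g τ) +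
        (∫⁻ σ in Ioi 0, k σ) * M := fun t =>
      conv_le_add hMt fun τ hτ => (hT τ ((le_max_left _ _).trans hτ.1.le)).le
    have h2 := (tendsto_setLIntegral_comp_sub_mul hk (hg (max T 0))).add
      (tendsto_const_nhds (x := (∫⁻ σ in Ioi 0, k σ) * M))
    rw [zero_add] at h2
    calc _ ≤ _ := limsup_le_limsup (Eventually.of_forall h1)
      _ = _ := h2.limsup_eq
  have hcont : Tendsto (fun M => (∫⁻ σ in Ioi 0, k σ) * M) (𝓝[>] (limsup g atTop))
      (𝓝 ((∫⁻ σ in Ioi 0, k σ) * limsup g atTop)) :=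
    (ENNReal.Tendsto.const_mul tendsto_id (Or.inr hki)).mono_left nhdsWithin_le_nhds
  have hne : (𝓝[>] (limsup g atTop)).NeBot := nhdsGT_neBot_of_exists_gt ⟨⊤, hgt.lt_top⟩
  refine ge_of_tendsto hcont ?_
  filter_upwards [Ioo_mem_nhdsGT hgt.lt_top] with M hM using key M hM.1 hM.2.ne

theorem limsup_add_le_enn (u v : ℝ → ℝ≥0∞) :
    limsup (u + v) atTop ≤ limsup u atTop + limsup v atTop := by
  rcases eq_or_ne (limsup u atTop) ⊤ with h | h
  · simp [h]
  rcases eq_or_ne (limsup v atTop) ⊤ with h' | h'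
  · simp [h']
  refine ENNReal.le_of_forall_pos_le_add fun δ hδ _ => ?_
  have hδ' : ((δ / 2 : NNReal) : ℝ≥0∞) ≠ 0 := by simpa using hδ.ne'
  refine limsup_le_of_le (by isBoundedDefault) ?_
  filter_upwards [eventually_lt_of_limsup_lt (ENNReal.lt_add_right h hδ'),
    eventually_lt_of_limsup_lt (ENNReal.lt_add_right h' hδ')] with t h1 h2
  calc u t + v t ≤ (limsup u atTop + (δ / 2 : NNReal)) + (limsup v atTop + (δ / 2 : NNReal)) :=
        add_le_add h1.le h2.le
    _ = limsup u atTop + limsup v atTop + ((δ / 2 + δ / 2 : NNReal) : ℝ≥0∞) := by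
        rw [ENNReal.coe_add]; ring
    _ = _ := by rw [add_halves]

/-- Absorption of `q * x`. Finiteness of x is essential, since x = ∞ satisfies the inequality
whenever q > 0. -/
theorem le_div_one_sub {x y q : ℝ≥0∞} (hx : x ≠ ⊤) (hq : q < 1) (h : x ≤ y + q * x) :
    x ≤ y / (1 - q) := by
  have hq0 : 1 - q ≠ 0 := (tsub_pos_of_lt hq).ne'
  rw [ENNReal.le_div_iff_mul_le (Or.inl hq0) (Or.inl (ENNReal.sub_ne_top ENNReal.one_ne_top)),
    mul_comm, ENNReal.sub_mul fun _ _ => hx, one_mul]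
  exact tsub_le_iff_right.2 h

theorem add_mul_div_one_sub {y q : ℝ≥0∞} (hq : q < 1) :
    y + q * (y / (1 - q)) = y / (1 - q) := by
  have hq0 : 1 - q ≠ 0 := (tsub_pos_of_lt hq).ne'
  have hqt : 1 - q ≠ ⊤ := ENNReal.sub_ne_top ENNReal.one_ne_top
  calc y + q * (y / (1 - q)) = (1 - q) * (y / (1 - q)) + q * (y / (1 - q)) := by
        rw [ENNReal.mul_div_cancel hq0 hqt]
    _ = y / (1 - q) := by rw [← add_mul, tsub_add_cancel_of_le hq.le, one_mul]

variable {a n p : ℝ → ℝ≥0∞} {ε : ℝ≥0∞}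

/-- A generalized Gronwall inequality for kernels of mass less than `1`. -/
theorem le_of_le_add_conv {T : ℝ} {c : ℝ≥0∞} (hε : ε ≠ ⊤) (hc : c ≠ ⊤)
    (ha : AEMeasurable a (volume.restrict (Ioo 0 T)))
    (hn : AEMeasurable n (volume.restrict (Ioo 0 T)))
    (hni : ∫⁻ τ in Ioo 0 T, n τ ≠ ⊤) (hq : ε * ∫⁻ τ in Ioo 0 T, a τ < 1)
    (h : ∀ t ∈ Ioo 0 T, n t ≤ c + ε * conv a n t) {t : ℝ} (ht : t ∈ Ioo 0 T) :
    n t ≤ c / (1 - ε * ∫⁻ τ in Ioo 0 T, a τ) := by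
  set q := ε * ∫⁻ τ in Ioo 0 T, a τ with hqdef
  set c' := c / (1 - q) with hc'
  have hc't : c' ≠ ⊤ := (ENNReal.div_lt_top hc (tsub_pos_of_lt hq).ne').ne
  -- The truncated difference is the excess of n over c'. As c' = c + qc', it satisfies the
  -- homogeneous inequality, and Tonelli gives ∫m ≤ q∫m, hence m = 0 almost everywhere. Only
  -- integrability of n is needed, so n may be unbounded near 0.
  set m : ℝ → ℝ≥0∞ := fun t => n t - c' with hm
  have hmm : AEMeasurable m (volume.restrict (Ioo 0 T)) := hn.sub aemeasurable_const
  have ha' : AEMeasurable ((Ioo 0 T).indicator a) volume :=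
    (aemeasurable_indicator_iff measurableSet_Ioo).2 ha
  have hm' : AEMeasurable ((Ioo 0 T).indicator m) volume :=
    (aemeasurable_indicator_iff measurableSet_Ioo).2 hmm
  have hmt : ∀ t ∈ Ioo 0 T, m t ≤ ε * conv a m t := by
    intro t ht
    rw [hm]
    refine tsub_le_iff_left.2 ?_
    have h1 : conv a n t ≤ conv a m t + (∫⁻ τ in Ioo 0 T, a τ) * c' := by
      calc conv a n t ≤ ∫⁻ τ in Ioo 0 t, (a (t - τ) * m τ + a (t - τ) * c') := by
            refine lintegral_mono fun τ => ?_
            rw [← mul_add]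
            gcongr
            exact le_tsub_add
        _ = conv a m t + ∫⁻ τ in Ioo 0 t, a (t - τ) * c' := by
            refine lintegral_add_right' _ (AEMeasurable.mul_const ?_ _)
            have h2 : AEMeasurable (fun τ => (Ioo 0 T).indicator a (t - τ)) volume :=
              ha'.comp_quasiMeasurePreserving
                (quasiMeasurePreserving_sub_left_of_right_invariant volume t)
            refine (h2.restrict (s := Ioo 0 t)).congr ?_
            refine (ae_restrict_iff' measurableSet_Ioo).2 (Eventually.of_forall fun τ hτ => ?_)
            exact indicator_of_mem (s := Ioo 0 T) (a := t - τ)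
              ⟨by linarith [hτ.2], by linarith [hτ.1, ht.2]⟩ _
        _ ≤ _ := by
            gcongr
            rw [lintegral_mul_const' _ _ hc't, setLIntegral_comp_sub]
            gcongr
            · exact (sub_self t).ge
            · linarith [ht.2]
    calc n t ≤ c + ε * (conv a m t + (∫⁻ τ in Ioo 0 T, a τ) * c') :=
          (h t ht).trans (by gcongr)
      _ = (c + q * c') + ε * conv a m t := by rw [hqdef]; ring
      _ = c' + ε * conv a m t := by rw [hc', add_mul_div_one_sub hq]
  have hmi : ∫⁻ τ in Ioo 0 T, m τ ≠ ⊤ :=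
    ne_top_of_le_ne_top hni (lintegral_mono fun τ => tsub_le_self)
  have hle : ∫⁻ τ in Ioo 0 T, m τ ≤ 0 + q * ∫⁻ τ in Ioo 0 T, m τ := by
    rw [zero_add]
    have hconv : ∀ t ∈ Ioo 0 T, conv a m t ≤
        ∫⁻ τ, (Ioo 0 T).indicator a (t - τ) * (Ioo 0 T).indicator m τ := by
      intro t ht
      rw [conv, ← lintegral_indicator measurableSet_Ioo]
      refine lintegral_mono fun τ => ?_
      by_cases hτ : τ ∈ Ioo 0 t
      · rw [indicator_of_mem hτ, indicator_of_mem (s := Ioo 0 T) (a := τ) ⟨hτ.1, hτ.2.trans ht.2⟩,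
          indicator_of_mem (s := Ioo 0 T) ⟨by linarith [hτ.2], by linarith [hτ.1, ht.2]⟩]
      · rw [indicator_of_notMem hτ]
        exact zero_le
    have hprod : AEMeasurable (Function.uncurry fun t τ =>
        (Ioo 0 T).indicator a (t - τ) * (Ioo 0 T).indicator m τ)
        ((volume : Measure ℝ).prod volume) :=
      (ha'.comp_quasiMeasurePreserving (quasiMeasurePreserving_sub volume volume)).mul
        (hm'.comp_quasiMeasurePreserving Measure.quasiMeasurePreserving_snd)
    calc ∫⁻ τ in Ioo 0 T, m τ ≤ ∫⁻ t in Ioo 0 T, ε *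
          ∫⁻ τ, (Ioo 0 T).indicator a (t - τ) * (Ioo 0 T).indicator m τ :=
          setLIntegral_mono' measurableSet_Ioo fun t ht =>
            (hmt t ht).trans (by gcongr; exact hconv t ht)
      _ = ε * ∫⁻ t in Ioo 0 T,
          ∫⁻ τ, (Ioo 0 T).indicator a (t - τ) * (Ioo 0 T).indicator m τ :=
          lintegral_const_mul' _ _ hε
      _ ≤ ε * ∫⁻ t, ∫⁻ τ, (Ioo 0 T).indicator a (t - τ) * (Ioo 0 T).indicator m τ := by
          gcongr
          exact Measure.restrict_le_self
      _ = ε * ((∫⁻ τ in Ioo 0 T, a τ) * ∫⁻ τ in Ioo 0 T, m τ) := by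
          rw [lintegral_lintegral_swap hprod]
          congr 1
          calc _ = ∫⁻ τ, (∫⁻ t in Ioo 0 T, a t) * (Ioo 0 T).indicator m τ := by
                refine lintegral_congr fun τ => ?_
                have h3 : AEMeasurable (fun t => (Ioo 0 T).indicator a (t - τ)) volume :=
                  ha'.comp_quasiMeasurePreserving
                    (measurePreserving_sub_right volume τ).quasiMeasurePreserving
                rw [lintegral_mul_const'' _ h3, lintegral_sub_right_eq_self, lintegral_indicator measurableSet_Ioo]
            _ = _ := by
                rw [lintegral_const_mul'' _ hm', lintegral_indicator measurableSet_Ioo]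
      _ = _ := by rw [hqdef, mul_assoc]
  have hzero : ∫⁻ τ in Ioo 0 T, m τ = 0 := by
    simpa using le_div_one_sub hmi hq hle
  -- The convolution sees m only almost everywhere, so the pointwise inequality now gives m = 0 at
  -- every t.
  have hz : conv a m t = 0 := by
    have h0 : m =ᵐ[volume.restrict (Ioo 0 t)] 0 :=
      ae_mono (Measure.restrict_mono (Ioo_subset_Ioo le_rfl ht.2.le) le_rfl)
        ((lintegral_eq_zero_iff' hmm).1 hzero)
    rw [conv, lintegral_congr_ae (g := fun _ => 0)
      (by filter_upwards [h0] with τ hτ; rw [hτ, Pi.zero_apply, mul_zero]), lintegral_zero]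
  have := hmt t ht
  rw [hz, mul_zero] at this
  exact tsub_eq_zero_iff_le.1 (le_antisymm this zero_le)

/-- Pass to the limsup and absorb. Absorption needs a finite limsup of n, which comes from absorbing
first in the suprema over [1, T]: each is finite, and the resulting bound does not depend on T. -/
theorem limsup_le_of_le_add_conv (hε : ε ≠ ⊤) (ha : Tendsto a atTop (𝓝 0))
    (hai : ∫⁻ σ in Ioi 0, a σ ≠ ⊤) (hq : ε * ∫⁻ σ in Ioi 0, a σ < 1)
    (hn : ∀ T, ∫⁻ τ in Ioc 0 T, n τ ≠ ⊤)
    (hnb : ∀ T, ∃ M : ℝ≥0∞, M ≠ ⊤ ∧ ∀ t ∈ Icc 1 T, n t ≤ M) (hp : limsup p atTop ≠ ⊤)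
    (h : ∀ t, 0 < t → n t ≤ p t + ε * conv a n t) :
    limsup n atTop ≤ limsup p atTop / (1 - ε * ∫⁻ σ in Ioi 0, a σ) := by
  set q := ε * ∫⁻ σ in Ioi 0, a σ with hqdef
  have hnt : limsup n atTop ≠ ⊤ := by
    obtain ⟨c, hpc, hct⟩ := exists_between hp.lt_top
    have h1 := tendsto_setLIntegral_comp_sub_mul (T := 1) ha (hn 1)
    obtain ⟨T₂, hT₂⟩ := eventually_atTop.1 ((eventually_lt_of_limsup_lt hpc).and
      ((ENNReal.tendsto_nhds_zero.1 h1) 1 one_pos))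
    obtain ⟨M₀, hM₀, hM₀n⟩ := hnb T₂
    have key : ∀ T, 1 ≤ T → n T ≤ (M₀ + (c + ε)) / (1 - q) := by
      intro T hT
      set N : ℝ≥0∞ := ⨆ t ∈ Icc 1 T, n t with hN
      have hNle : ∀ t ∈ Icc 1 T, n t ≤ N := fun t ht => le_iSup₂ (f := fun t _ => n t) t ht
      have hNt : N ≠ ⊤ := by
        obtain ⟨M, hM, hMn⟩ := hnb T
        exact ne_top_of_le_ne_top hM (iSup₂_le hMn)
      refine (hNle T ⟨hT, le_rfl⟩).trans (le_div_one_sub hNt hq (iSup₂_le fun t ht => ?_))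
      rcases le_total t T₂ with htT | htT
      · exact (hM₀n t ⟨ht.1, htT⟩).trans (by rw [add_assoc]; exact le_self_add (a := M₀))
      · have h3 : conv a n t ≤ 1 + (∫⁻ σ in Ioi 0, a σ) * N :=
          (conv_le_add hNt fun τ hτ => hNle τ ⟨hτ.1.le, hτ.2.le.trans ht.2⟩).trans
            (by gcongr; exact (hT₂ t htT).2)
        calc n t ≤ c + ε * (1 + (∫⁻ σ in Ioi 0, a σ) * N) :=
              (h t (by linarith [ht.1])).trans (by gcongr; exact (hT₂ t htT).1.le)
          _ = c + ε + q * N := by rw [hqdef]; ring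
          _ ≤ M₀ + (c + ε) + q * N := add_le_add le_add_self le_rfl
    refine ne_top_of_le_ne_top (b := (M₀ + (c + ε)) / (1 - q)) ?_
      (limsup_le_of_le (by isBoundedDefault) ?_)
    · exact (ENNReal.div_lt_top (by simp [hM₀, hct.ne, hε]) (tsub_pos_of_lt hq).ne').ne
    · filter_upwards [eventually_ge_atTop 1] with t ht using key t ht
  refine le_div_one_sub hnt hq ?_
  calc limsup n atTop ≤ limsup (p + fun t => ε * conv a n t) atTop :=
        limsup_le_limsup (by filter_upwards [eventually_gt_atTop 0] with t ht using h t ht)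
    _ ≤ limsup p atTop + limsup (fun t => ε * conv a n t) atTop := limsup_add_le_enn _ _
    _ = limsup p atTop + ε * limsup (conv a n) atTop := by
        rw [ENNReal.limsup_const_mul_of_ne_top hε]
    _ ≤ limsup p atTop + ε * ((∫⁻ σ in Ioi 0, a σ) * limsup n atTop) := by
        gcongr
        exact limsup_conv_le ha hai hn hnt
    _ = _ := by rw [hqdef, mul_assoc]

end conv

/-! ### Weights. -/

/-- A nonnegative, nonincreasing, integrable weight on the open half line. -/
structure IsWeight (w : ℝ → ℝ) : Prop where
  nonneg : ∀ t, 0 < t → 0 ≤ w t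
  antitoneOn : AntitoneOn w (Ioi 0)
  integrableOn : IntegrableOn w (Ioi 0)
  tendsto : Tendsto w atTop (𝓝 0)

namespace IsWeight

variable {w v : ℝ → ℝ}

theorem wt {c ω p : ℝ} (hc : 0 ≤ c) (hω : 0 < ω) (hp : 0 ≤ p) (hp1 : p < 1) :
    IsWeight (wt c ω p) where
  nonneg t ht := wt_nonneg hc ht.le
  antitoneOn t ht u hu htu := by
    have ht : 0 < t := ht
    have hu : 0 < u := hu
    have h1 : u ^ (-p) ≤ t ^ (-p) := Real.rpow_le_rpow_of_nonpos ht htu (by linarith)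
    have h2 : Real.exp (-ω * u) ≤ Real.exp (-ω * t) := Real.exp_le_exp.2 (by nlinarith)
    have h3 := Real.rpow_nonneg hu.le (-p)
    have h4 := Real.rpow_nonneg ht.le (-p)
    unfold Regulation.wt
    gcongr
  integrableOn := integrableOn_wt c hω hp1
  tendsto := tendsto_wt c hω

theorem add (hw : IsWeight w) (hv : IsWeight v) : IsWeight fun t => w t + v t where
  nonneg t ht := add_nonneg (hw.nonneg t ht) (hv.nonneg t ht)
  antitoneOn := hw.antitoneOn.add hv.antitoneOn
  integrableOn := hw.integrableOn.add hv.integrableOn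
  tendsto := by simpa using hw.tendsto.add hv.tendsto

theorem const_mul (hw : IsWeight w) {c : ℝ} (hc : 0 ≤ c) : IsWeight fun t => c * w t where
  nonneg t ht := mul_nonneg hc (hw.nonneg t ht)
  antitoneOn t ht u hu htu := mul_le_mul_of_nonneg_left (hw.antitoneOn ht hu htu) hc
  integrableOn := hw.integrableOn.const_mul c
  tendsto := by simpa using hw.tendsto.const_mul c

theorem lintegral_ne_top (hw : IsWeight w) : ∫⁻ t in Ioi (0 : ℝ), ENNReal.ofReal (w t) ≠ ⊤ :=
  hw.integrableOn.lintegral_lt_top.ne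

theorem tendsto_ofReal (hw : IsWeight w) :
    Tendsto (fun t => ENNReal.ofReal (w t)) atTop (𝓝 0) := by
  simpa using ENNReal.tendsto_ofReal hw.tendsto

theorem lintegral_ne_top_of_le (hw : IsWeight w) {k : ℝ → ℝ≥0∞}
    (h : ∀ t, 0 < t → k t ≤ ENNReal.ofReal (w t)) : ∫⁻ t in Ioi (0 : ℝ), k t ≠ ⊤ :=
  ne_top_of_le_ne_top hw.lintegral_ne_top (setLIntegral_mono' measurableSet_Ioi h)

theorem tendsto_of_le (hw : IsWeight w) {k : ℝ → ℝ≥0∞}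
    (h : ∀ t, 0 < t → k t ≤ ENNReal.ofReal (w t)) : Tendsto k atTop (𝓝 0) :=
  tendsto_of_tendsto_of_tendsto_of_le_of_le' tendsto_const_nhds hw.tendsto_ofReal
    (Eventually.of_forall fun _ => zero_le)
    (by filter_upwards [eventually_gt_atTop 0] with t ht using h t ht)

/-- The singularities of w and g sit at opposite ends. Up to t/2, monotonicity bounds the weight by
`w (t / 2)` and g is integrable; after t/2, g is bounded and w is integrable. -/
theorem conv_ne_top (hw : IsWeight w) {g : ℝ → ℝ≥0∞} {t : ℝ} (ht : 0 < t)
    (hgi : ∫⁻ τ in Ioc 0 t, g τ ≠ ⊤) {M : ℝ≥0∞} (hM : M ≠ ⊤) (hg : ∀ τ ∈ Icc (t / 2) t, g τ ≤ M) :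
    conv (fun σ => ENNReal.ofReal (w σ)) g t ≠ ⊤ := by
  refine ne_top_of_le_ne_top ?_ (conv_le_add (T := t / 2) hM fun τ hτ => hg τ ⟨hτ.1.le, hτ.2.le⟩)
  refine ENNReal.add_ne_top.2 ⟨?_, ENNReal.mul_ne_top hw.lintegral_ne_top hM⟩
  have : ∫⁻ τ in Ioc 0 (t / 2), ENNReal.ofReal (w (t - τ)) * g τ ≤
      ∫⁻ τ in Ioc 0 (t / 2), ENNReal.ofReal (w (t / 2)) * g τ := by
    refine setLIntegral_mono' measurableSet_Ioc fun τ hτ => ?_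
    gcongr
    exact hw.antitoneOn (show 0 < t / 2 by linarith) (show 0 < t - τ by linarith [hτ.2])
      (by linarith [hτ.2])
  refine ne_top_of_le_ne_top ?_ this
  rw [lintegral_const_mul' _ _ ENNReal.ofReal_ne_top]
  refine ENNReal.mul_ne_top ENNReal.ofReal_ne_top (ne_top_of_le_ne_top hgi ?_)
  exact lintegral_mono_set (Ioc_subset_Ioc_right (by linarith))

end IsWeight

/-- A subhomogeneous function is bounded by its supremum over the unit ball times the norm. -/
theorem le_iSup_mul_enorm {Φ : Z → ℝ≥0∞} (hΦ : ∀ (c : ℝ) x, Φ (c • x) ≤ ‖c‖ₑ * Φ x) (x : Z) :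
    Φ x ≤ (⨆ (x : Z) (_ : ‖x‖ ≤ 1), Φ x) * ‖x‖ₑ := by
  rcases eq_or_ne x 0 with rfl | hx
  · have := hΦ 0 0
    simp only [zero_smul, enorm_zero, zero_mul] at this
    exact this.trans zero_le
  have hx' : ‖x‖ ≠ 0 := norm_ne_zero_iff.2 hx
  have h1 := hΦ ‖x‖ (‖x‖⁻¹ • x)
  rw [smul_smul, mul_inv_cancel₀ hx', one_smul, enorm_norm, mul_comm] at h1
  refine h1.trans ?_
  gcongr
  exact le_iSup₂ (f := fun (x : Z) (_ : ‖x‖ ≤ 1) => Φ x) (‖x‖⁻¹ • x)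
    (by rw [norm_smul, norm_inv, norm_norm, inv_mul_cancel₀ hx'])

theorem iSup_le_of_le_mul_enorm {Φ : Z → ℝ≥0∞} {M : ℝ≥0∞} (h : ∀ x, Φ x ≤ M * ‖x‖ₑ) :
    ⨆ (x : Z) (_ : ‖x‖ ≤ 1), Φ x ≤ M := by
  refine iSup₂_le fun x hx => (h x).trans ?_
  calc M * ‖x‖ₑ ≤ M * 1 := by
        gcongr
        rw [← ofReal_norm]
        exact ENNReal.ofReal_le_one.2 hx
    _ = M := mul_one M

/-- Extension by 0 off an open set preserves lower semicontinuity of a nonnegative function. -/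
theorem aemeasurable_of_lowerSemicontinuousOn {g : ℝ → ℝ≥0∞} {U : Set ℝ} (hU : IsOpen U)
    (hg : LowerSemicontinuousOn g U) : AEMeasurable g (volume.restrict U) := by
  have h : LowerSemicontinuous (U.indicator g) := by
    rw [lowerSemicontinuous_iff_isOpen_preimage]
    intro c
    obtain ⟨V, hV, h⟩ := lowerSemicontinuousOn_iff_preimage_Ioi.1 hg c
    have : U.indicator g ⁻¹' Ioi c = U ∩ V := by
      rw [← h]
      ext t
      by_cases ht : t ∈ U
      · simp [ht]
      · simp [ht]
    rw [this]
    exact hU.inter hV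
  exact (aemeasurable_indicator_iff hU.measurableSet).1 h.measurable.aemeasurable

/-! ### Bounds and measurability for the kernels. -/

namespace Plant

variable {P : Plant Z} {β : ℝ} {S : C0Semigroup Z}

/-- `‖C e^{A_β t} I_0‖` in `L(Z, ℝ)`. -/
def kerH (P : Plant Z) (S : C0Semigroup Z) (t : ℝ) : ℝ≥0∞ :=
  ⨆ (x : Z) (_ : ‖x‖ ≤ 1), ‖P.C (P.SI0 S t x)‖ₑ

/-- `‖e^{A_β t} I_0‖` in `L(Z, Z^{s₁})`. -/
def kerA (P : Plant Z) (S : C0Semigroup Z) (s₁ t : ℝ) : ℝ≥0∞ :=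
  ⨆ (x : Z) (_ : ‖x‖ ≤ 1), P.T.fracNorm s₁ (P.SI0 S t x)

theorem SI0_smul (P : Plant Z) (S : C0Semigroup Z) (t c : ℝ) (x : Z) :
    P.SI0 S t (c • x) = c • P.SI0 S t x := by
  simp only [SI0_eq, map_smul, smul_eq_mul, smul_add, smul_smul, mul_neg]

theorem fracNorm_smul_le (P : Plant Z) {s : ℝ} (hs : 0 ≤ s) (c : ℝ) (x : Z) :
    P.T.fracNorm s (c • x) ≤ ‖c‖ₑ * P.T.fracNorm s x := by
  rw [P.stable.fracNorm_eq hs, P.stable.fracNorm_eq hs]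
  exact imgNorm_smul_le _ c x

theorem fracNorm_add_le (P : Plant Z) {s : ℝ} (hs : 0 ≤ s) (x y : Z) :
    P.T.fracNorm s (x + y) ≤ P.T.fracNorm s x + P.T.fracNorm s y := by
  simp only [P.stable.fracNorm_eq hs]
  exact imgNorm_add_le _ x y

theorem enorm_C_SI0_le (P : Plant Z) (S : C0Semigroup Z) (t : ℝ) (x : Z) :
    ‖P.C (P.SI0 S t x)‖ₑ ≤ P.kerH S t * ‖x‖ₑ :=
  le_iSup_mul_enorm (Φ := fun x => ‖P.C (P.SI0 S t x)‖ₑ)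
    (fun c x => by rw [SI0_smul, map_smul, enorm_smul]) x

theorem fracNorm_SI0_le (P : Plant Z) (S : C0Semigroup Z) {s : ℝ} (hs : 0 ≤ s) (t : ℝ) (x : Z) :
    P.T.fracNorm s (P.SI0 S t x) ≤ P.kerA S s t * ‖x‖ₑ :=
  le_iSup_mul_enorm (Φ := fun x => P.T.fracNorm s (P.SI0 S t x))
    (fun c x => by rw [SI0_smul]; exact P.fracNorm_smul_le hs c _) x

theorem op_SB (hG : P.G ≠ 0) (hβ : β ∈ Ioo (0 : ℝ) 1) (hS : S.GeneratedBy (P.regGraph β))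
    (hSs : S.ExpStable) {τ t : ℝ} (hτ : 0 ≤ τ) (ht : 0 < t) :
    S.op τ (P.SB S t) = P.SB S (τ + t) := by
  rw [SB_eq hG hβ hS hSs ht, SB_eq hG hβ hS hSs (by linarith)]
  exact (smooths_S hG hβ hS hSs P.sb_mem.1 P.sc_add_sb).op_extL
    (P.stable.denseRange_negPowL P.sb_mem.1 P.sb_mem.2.le) hτ ht _

theorem op_SI0 (hG : P.G ≠ 0) (hβ : β ∈ Ioo (0 : ℝ) 1) (hS : S.GeneratedBy (P.regGraph β))
    (hSs : S.ExpStable) {τ t : ℝ} (hτ : 0 ≤ τ) (ht : 0 < t) (x : Z) :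
    S.op τ (P.SI0 S t x) = P.SI0 S (τ + t) x := by
  rw [SI0_eq, SI0_eq, map_add, map_smul, op_SB hG hβ hS hSs hτ ht, S.op_add_apply hτ ht.le]

theorem op_SI0Bd (hG : P.G ≠ 0) (hβ : β ∈ Ioo (0 : ℝ) 1) (hS : S.GeneratedBy (P.regGraph β))
    (hSs : S.ExpStable) {τ t : ℝ} (hτ : 0 ≤ τ) (ht : 0 < t) :
    S.op τ (P.SI0Bd S t) = P.SI0Bd S (τ + t) := by
  rw [SI0Bd, SI0Bd, map_add, map_smul, op_SB hG hβ hS hSs hτ ht,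
    extOp_eq hG hβ hS hSs P.sd_mem.1 P.sc_add_sd ht,
    extOp_eq hG hβ hS hSs P.sd_mem.1 P.sc_add_sd (by linarith),
    (smooths_S hG hβ hS hSs P.sd_mem.1 P.sc_add_sd).op_extL
    (P.stable.denseRange_negPowL P.sd_mem.1 P.sd_mem.2.le) hτ ht]

theorem continuousOn_of_op {F : ℝ → Z} (S : C0Semigroup Z)
    (hF : ∀ τ t, 0 ≤ τ → 0 < t → S.op τ (F t) = F (τ + t)) : ContinuousOn F (Ioi 0) := by
  intro t ht
  have ht : 0 < t := ht
  refine ContinuousAt.continuousWithinAt ?_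
  have h2 : ContinuousAt (fun τ => S.op τ (F (t / 2))) (t - t / 2) :=
    (S.strong_cont _).continuousAt (Ici_mem_nhds (by linarith))
  have h1 : ContinuousAt (fun τ => S.op (τ - t / 2) (F (t / 2))) t :=
    ContinuousAt.comp (f := fun τ => τ - t / 2) h2 (by fun_prop)
  refine h1.congr ?_
  filter_upwards [Ioi_mem_nhds (show t / 2 < t by linarith)] with τ hτ
  rw [hF _ _ (by linarith [mem_Ioi.1 hτ]) (by linarith), sub_add_cancel]

theorem exists_weight_extL (hG : P.G ≠ 0) (hβ : β ∈ Ioo (0 : ℝ) 1)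
    (hS : S.GeneratedBy (P.regGraph β)) (hSs : S.ExpStable) {s : ℝ} (hs : 0 ≤ s)
    (hs1 : P.sc + s < 1) :
    ∃ w, IsWeight w ∧ ∀ t, 0 < t → ∀ v, ‖S.extL (P.T.negPowL s) t v‖ ≤ w t * ‖v‖ := by
  obtain ⟨c, ω, hc, hω, h⟩ := norm_extL_le_wt hG hβ hS hSs hs hs1
  exact ⟨_, IsWeight.wt hc hω hs (by linarith [P.sc_mem.1]), h⟩

theorem exists_weight_SB (hG : P.G ≠ 0) (hβ : β ∈ Ioo (0 : ℝ) 1)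
    (hS : S.GeneratedBy (P.regGraph β)) (hSs : S.ExpStable) :
    ∃ w, IsWeight w ∧ ∀ t, 0 < t → ‖P.SB S t‖ ≤ w t := by
  obtain ⟨w, hw, h⟩ := exists_weight_extL hG hβ hS hSs P.sb_mem.1 P.sc_add_sb
  refine ⟨_, hw.const_mul (norm_nonneg P.B), fun t ht => ?_⟩
  rw [SB_eq hG hβ hS hSs ht, mul_comm]
  exact h t ht _

theorem exists_weight_SI0Bd (hG : P.G ≠ 0) (hβ : β ∈ Ioo (0 : ℝ) 1)
    (hS : S.GeneratedBy (P.regGraph β)) (hSs : S.ExpStable) :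
    ∃ w, IsWeight w ∧ ∀ t, 0 < t → ‖P.SI0Bd S t‖ ≤ w t := by
  obtain ⟨w, hw, h⟩ := exists_weight_extL hG hβ hS hSs P.sd_mem.1 P.sc_add_sd
  obtain ⟨v, hv, h'⟩ := exists_weight_SB hG hβ hS hSs
  refine ⟨_, (hw.const_mul (norm_nonneg P.bd)).add
    (hv.const_mul (norm_nonneg (P.CN (1 - P.sd) P.bd))), fun t ht => ?_⟩
  rw [SI0Bd_eq hG hβ hS hSs ht, ← SB_eq hG hβ hS hSs ht]
  refine (norm_add_le _ _).trans (add_le_add ?_ ?_)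
  · rw [mul_comm]
    exact h t ht _
  · rw [norm_smul, norm_neg]
    gcongr
    exact h' t ht

theorem exists_weight_SI0 (hG : P.G ≠ 0) (hβ : β ∈ Ioo (0 : ℝ) 1)
    (hS : S.GeneratedBy (P.regGraph β)) (hSs : S.ExpStable) :
    ∃ w, IsWeight w ∧ ∀ t, 0 < t → ∀ x, ‖P.SI0 S t x‖ ≤ w t * ‖x‖ := by
  obtain ⟨w, hw, h⟩ := exists_weight_extL hG hβ hS hSs le_rfl (by simpa using P.sc_mem.2)
  obtain ⟨v, hv, h'⟩ := exists_weight_SB hG hβ hS hSs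
  refine ⟨_, hw.add (hv.const_mul (norm_nonneg (P.CN 1))), fun t ht x => ?_⟩
  have e := (smooths_S hG hβ hS hSs le_rfl (by simpa using P.sc_mem.2)).extL_apply
    (P.stable.denseRange_negPowL le_rfl zero_le_one) ht x
  rw [P.stable.negPowL_zero] at e
  rw [SI0_eq, add_mul, ← e]
  refine (norm_add_le _ _).trans (add_le_add (h t ht x) ?_)
  rw [norm_smul, norm_neg, mul_right_comm]
  gcongr
  · exact (P.CN 1).le_opNorm x
  · exact h' t ht

/-- The semigroup contributes the singularity t^{-s_c} and the rank-one part of I₀ contributes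
t^{-(s_c+s_b)}; both are integrable at 0. -/
theorem exists_weight_imgNorm_SI0 (hG : P.G ≠ 0) (hβ : β ∈ Ioo (0 : ℝ) 1)
    (hS : S.GeneratedBy (P.regGraph β)) (hSs : S.ExpStable) :
    ∃ w, IsWeight w ∧ ∀ t, 0 < t → ∀ x,
      imgNorm (P.T.negPowL P.sc) (P.SI0 S t x) ≤ ENNReal.ofReal (w t) * ‖x‖ₑ := by
  obtain ⟨c, ω, hc, hω, h⟩ := imgNorm_extL_le_wt hG hβ hS hSs le_rfl (by simpa using P.sc_mem.2)
  obtain ⟨c', ω', hc', hω', h'⟩ := imgNorm_extL_le_wt hG hβ hS hSs P.sb_mem.1 P.sc_add_sb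
  have hw := IsWeight.wt hc hω (by simpa using P.sc_mem.1) (by simpa using P.sc_mem.2)
    (p := P.sc + 0)
  have hv := IsWeight.wt hc' hω' (add_nonneg P.sc_mem.1 P.sb_mem.1) P.sc_add_sb
  refine ⟨_, hw.add (hv.const_mul (mul_nonneg (norm_nonneg (P.CN 1)) (norm_nonneg P.B))),
    fun t ht x => ?_⟩
  have e := (smooths_S hG hβ hS hSs le_rfl (by simpa using P.sc_mem.2)).extL_apply
    (P.stable.denseRange_negPowL le_rfl zero_le_one) ht x
  rw [P.stable.negPowL_zero] at e
  have hw0 := hw.nonneg t ht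
  have hv0 := hv.nonneg t ht
  rw [SI0_eq, ← e, SB_eq hG hβ hS hSs ht, ← ofReal_norm, ← ENNReal.ofReal_mul (by positivity),
    add_mul, ENNReal.ofReal_add (by positivity) (by positivity)]
  refine (imgNorm_add_le _ _ _).trans (add_le_add (h t ht x) ?_)
  refine (imgNorm_smul_le _ _ _).trans ?_
  refine (mul_le_mul_right (h' t ht P.B) _).trans ?_
  rw [enorm_neg, ← ofReal_norm, ← ENNReal.ofReal_mul (norm_nonneg _)]
  refine ENNReal.ofReal_le_ofReal ?_
  calc ‖P.CN 1 x‖ * (Regulation.wt c' ω' (P.sc + P.sb) t * ‖P.B‖)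
      ≤ ‖P.CN 1‖ * ‖x‖ * (Regulation.wt c' ω' (P.sc + P.sb) t * ‖P.B‖) := by
        gcongr
        exact (P.CN 1).le_opNorm x
    _ = _ := by ring

theorem exists_weight_kerH (hG : P.G ≠ 0) (hβ : β ∈ Ioo (0 : ℝ) 1)
    (hS : S.GeneratedBy (P.regGraph β)) (hSs : S.ExpStable) :
    ∃ w, IsWeight w ∧ ∀ t, 0 < t → P.kerH S t ≤ ENNReal.ofReal (w t) := by
  obtain ⟨c, hc, hC⟩ := P.exists_C_bound
  obtain ⟨w, hw, h⟩ := exists_weight_imgNorm_SI0 hG hβ hS hSs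
  refine ⟨_, hw.const_mul hc.le, fun t ht => iSup_le_of_le_mul_enorm fun x => ?_⟩
  rw [ENNReal.ofReal_mul hc.le, mul_assoc]
  exact (enorm_le_mul_imgNorm hC hc _).trans (by gcongr; exact h t ht x)

theorem exists_weight_K (hG : P.G ≠ 0) (hβ : β ∈ Ioo (0 : ℝ) 1)
    (hS : S.GeneratedBy (P.regGraph β)) (hSs : S.ExpStable) :
    ∃ w, IsWeight w ∧ ∀ t, 0 < t → ‖P.K β S t‖ₑ ≤ ENNReal.ofReal (w t) := by
  obtain ⟨w, hw, h⟩ := exists_weight_SB hG hβ hS hSs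
  refine ⟨_, hw.const_mul (norm_nonneg (P.CN 1)), fun t ht => ?_⟩
  rw [K_eq hG hβ hS hSs ht, ← SB_eq hG hβ hS hSs ht, ← ofReal_norm]
  exact ENNReal.ofReal_le_ofReal (((P.CN 1).le_opNorm _).trans (by gcongr; exact h t ht))

theorem exists_weight_Kd (hG : P.G ≠ 0) (hβ : β ∈ Ioo (0 : ℝ) 1)
    (hS : S.GeneratedBy (P.regGraph β)) (hSs : S.ExpStable) :
    ∃ w, IsWeight w ∧ ∀ t, 0 < t → ‖P.Kd S t‖ₑ ≤ ENNReal.ofReal (w t) := by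
  obtain ⟨w, hw, h⟩ := exists_weight_SI0Bd hG hβ hS hSs
  refine ⟨_, hw.const_mul (mul_nonneg hβ.1.le (norm_nonneg (P.CN 1))), fun t ht => ?_⟩
  rw [Kd, C_negPow_S hG hβ hS hSs, ← ofReal_norm, norm_mul, Real.norm_of_nonneg hβ.1.le, mul_assoc]
  have := hβ.1.le
  exact ENNReal.ofReal_le_ofReal (by
    gcongr
    exact ((P.CN 1).le_opNorm _).trans (by gcongr; exact h t ht))

/-- The supremum runs over a possibly uncountable ball, so measurability is obtained from lower
semicontinuity, which suprema preserve. -/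
theorem aemeasurable_kerA (hG : P.G ≠ 0) (hβ : β ∈ Ioo (0 : ℝ) 1)
    (hS : S.GeneratedBy (P.regGraph β)) (hSs : S.ExpStable) {s : ℝ} (hs : s ∈ Ioo (0 : ℝ) 1) :
    AEMeasurable (P.kerA S s) (volume.restrict (Ioi 0)) := by
  refine aemeasurable_of_lowerSemicontinuousOn isOpen_Ioi
    (lowerSemicontinuousOn_biSup fun x hx => ?_)
  simp only [P.stable.fracNorm_eq hs.1.le]
  have hlsc := lowerSemicontinuous_imgNorm (P.stable.negPowL_injective hs.1.le hs.2.le)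
    (P.stable.denseRange_negPowL hs.1.le hs.2.le)
  have hc := continuousOn_of_op (F := fun t => P.SI0 S t x) S
    fun τ t hτ ht => op_SI0 hG hβ hS hSs hτ ht x
  exact (hlsc.lowerSemicontinuousOn univ).comp hc (mapsTo_univ _ _)

theorem aemeasurable_fracNorm_comp (P : Plant Z) {s : ℝ} (hs : s ∈ Ioo (0 : ℝ) 1) {F : ℝ → Z}
    {U : Set ℝ} (hU : MeasurableSet U) (hF : ContinuousOn F U) :
    AEMeasurable (fun t => P.T.fracNorm s (F t)) (volume.restrict U) := by
  simp only [P.stable.fracNorm_eq hs.1.le]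
  exact aemeasurable_imgNorm (P.stable.negPowL_injective hs.1.le hs.2.le)
    (P.stable.denseRange_negPowL hs.1.le hs.2.le) (hF.aestronglyMeasurable hU)

end Plant

theorem IsCb1.exists_bound {r : ℝ → ℝ} (hr : IsCb1 r) :
    ∃ M : ℝ≥0∞, M ≠ ⊤ ∧ ∀ t, 0 ≤ t → ‖r t‖ₑ ≤ M ∧ ‖derivWithin r (Ici 0) t‖ₑ ≤ M := by
  obtain ⟨M, hM⟩ := hr.2
  refine ⟨ENNReal.ofReal M, ENNReal.ofReal_ne_top, fun t ht => ?_⟩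
  rw [← ofReal_norm, ← ofReal_norm]
  exact ⟨ENNReal.ofReal_le_ofReal (hM t ht).1, ENNReal.ofReal_le_ofReal (hM t ht).2⟩

theorem setLIntegral_Ioc_ne_top_of_le {g : ℝ → ℝ≥0∞} {M : ℝ≥0∞} (hM : M ≠ ⊤)
    (h : ∀ t, 0 ≤ t → g t ≤ M) (T : ℝ) : ∫⁻ τ in Ioc 0 T, g τ ≠ ⊤ := by
  refine ne_top_of_le_ne_top ?_ (setLIntegral_mono' measurableSet_Ioc fun τ hτ => h τ hτ.1.le)
  rw [setLIntegral_const]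
  exact ENNReal.mul_ne_top hM (by simp)

theorem limsup_ne_top_of_le {g : ℝ → ℝ≥0∞} {M : ℝ≥0∞} (hM : M ≠ ⊤)
    (h : ∀ t, 0 ≤ t → g t ≤ M) : limsup g atTop ≠ ⊤ := by
  refine ne_top_of_le_ne_top hM (limsup_le_of_le (by isBoundedDefault) ?_)
  filter_upwards [eventually_ge_atTop 0] with t ht using h t ht

/-! ### Estimates for mild solutions. -/

namespace Plant

variable {P : Plant Z} {β : ℝ} {S : C0Semigroup Z} {s₁ : ℝ}

theorem continuousOn_SB (hG : P.G ≠ 0) (hβ : β ∈ Ioo (0 : ℝ) 1)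
    (hS : S.GeneratedBy (P.regGraph β)) (hSs : S.ExpStable) : ContinuousOn (P.SB S) (Ioi 0) :=
  continuousOn_of_op (F := P.SB S) S fun _ _ hτ ht => op_SB hG hβ hS hSs hτ ht

/-- No relation between s₁ and s_c is assumed, so smoothing into Z^{s₁} is read off from finiteness
of D_B and D_{A_β}: both integrands are finite at some t', and S(t') is S(t')I₀ plus a rank-one term
along S(t')B. -/
theorem exists_fracNorm_op_le (hG : P.G ≠ 0) (hβ : β ∈ Ioo (0 : ℝ) 1)
    (hS : S.GeneratedBy (P.regGraph β)) (hSs : S.ExpStable) (hs₁ : s₁ ∈ Ioo (0 : ℝ) 1)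
    (hDB : P.DB β S s₁ (Ioi 0) ≠ ⊤) (hDA : P.DA S s₁ (Ioi 0) ≠ ⊤) :
    ∃ (t' : ℝ) (Λ : ℝ≥0∞), 0 < t' ∧ Λ ≠ ⊤ ∧ ∀ w, P.T.fracNorm s₁ (S.op t' w) ≤ Λ * ‖w‖ₑ := by
  have hcB : ContinuousOn (fun t => β⁻¹ • P.SB S t) (Ioi 0) :=
    (continuousOn_SB hG hβ hS hSs).const_smul β⁻¹
  have h1 := ae_lt_top' (P.aemeasurable_fracNorm_comp hs₁ measurableSet_Ioi hcB) hDB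
  have h2 : ∀ᵐ t ∂(volume.restrict (Ioi 0)), P.kerA S s₁ t < ⊤ :=
    ae_lt_top' (aemeasurable_kerA hG hβ hS hSs hs₁) hDA
  have : (ae (volume.restrict (Ioi (0 : ℝ)))).NeBot := by
    rw [ae_neBot, Ne, Measure.restrict_eq_zero]
    simp
  obtain ⟨t', ⟨hB, hA⟩, ht'⟩ := ((h1.and h2).and (ae_restrict_mem measurableSet_Ioi)).exists
  refine ⟨t', P.kerA S s₁ t' + ‖P.CN 1‖ₑ * (‖β‖ₑ * P.T.fracNorm s₁ (β⁻¹ • P.SB S t')), ht',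
    ENNReal.add_ne_top.2 ⟨hA.ne, ENNReal.mul_ne_top enorm_ne_top
      (ENNReal.mul_ne_top enorm_ne_top hB.ne)⟩, fun w => ?_⟩
  have e : S.op t' w = P.SI0 S t' w + P.CN 1 w • P.SB S t' := by
    rw [SI0_eq]; module
  have e' : P.SB S t' = β • (β⁻¹ • P.SB S t') := by
    rw [smul_smul, mul_inv_cancel₀ hβ.1.ne', one_smul]
  rw [e, add_mul]
  refine (P.fracNorm_add_le hs₁.1.le _ _).trans
    (add_le_add (P.fracNorm_SI0_le S hs₁.1.le t' w) ?_)
  refine (P.fracNorm_smul_le hs₁.1.le _ _).trans ?_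
  rw [mul_right_comm]
  gcongr
  · exact (P.CN 1).le_opENorm w
  · conv_lhs => rw [e']
    exact P.fracNorm_smul_le hs₁.1.le _ _

/-- As F(t) = S(t')F(t-t'), smoothing over one fixed time turns decay in `Z` into decay in Z^{s₁}.
-/
theorem tendsto_fracNorm_of_op {t' : ℝ} {Λ : ℝ≥0∞} (ht' : 0 < t') (hΛ : Λ ≠ ⊤)
    (h : ∀ w, P.T.fracNorm s₁ (S.op t' w) ≤ Λ * ‖w‖ₑ) {F : ℝ → Z}
    (hF : ∀ τ t, 0 ≤ τ → 0 < t → S.op τ (F t) = F (τ + t)) (hF0 : Tendsto F atTop (𝓝 0)) :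
    Tendsto (fun t => P.T.fracNorm s₁ (F t)) atTop (𝓝 0) := by
  have h1 : Tendsto (fun t => Λ * ‖F (t - t')‖ₑ) atTop (𝓝 0) := by
    have h2 := (hF0.comp (tendsto_atTop_add_const_right atTop (-t') tendsto_id)).enorm
    rw [enorm_zero] at h2
    simpa [sub_eq_add_neg] using ENNReal.Tendsto.const_mul h2 (Or.inr hΛ)
  refine tendsto_of_tendsto_of_tendsto_of_le_of_le' tendsto_const_nhds h1
    (Eventually.of_forall fun _ => zero_le) ?_
  filter_upwards [eventually_gt_atTop t'] with t ht
  have := h (F (t - t'))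
  rwa [hF _ _ ht'.le (by linarith), add_sub_cancel] at this

theorem tendsto_kerA {t' : ℝ} {Λ : ℝ≥0∞} (hG : P.G ≠ 0) (hβ : β ∈ Ioo (0 : ℝ) 1)
    (hS : S.GeneratedBy (P.regGraph β)) (hSs : S.ExpStable) (ht' : 0 < t') (hΛ : Λ ≠ ⊤)
    (h : ∀ w, P.T.fracNorm s₁ (S.op t' w) ≤ Λ * ‖w‖ₑ) :
    Tendsto (P.kerA S s₁) atTop (𝓝 0) := by
  obtain ⟨w, hw, hwS⟩ := exists_weight_SI0 hG hβ hS hSs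
  have h1 : Tendsto (fun t => Λ * ENNReal.ofReal (w (t - t'))) atTop (𝓝 0) := by
    have h2 := hw.tendsto_ofReal.comp (tendsto_atTop_add_const_right atTop (-t') tendsto_id)
    simpa [sub_eq_add_neg] using ENNReal.Tendsto.const_mul h2 (Or.inr hΛ)
  refine tendsto_of_tendsto_of_tendsto_of_le_of_le' tendsto_const_nhds h1
    (Eventually.of_forall fun _ => zero_le) ?_
  filter_upwards [eventually_gt_atTop t'] with t ht
  refine iSup_le_of_le_mul_enorm fun x => ?_
  have h3 := h (P.SI0 S (t - t') x)
  rw [op_SI0 hG hβ hS hSs ht'.le (by linarith), add_sub_cancel] at h3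
  refine h3.trans ?_
  rw [mul_assoc, ← ofReal_norm, ← ofReal_norm,
    ← ENNReal.ofReal_mul (hw.nonneg _ (sub_pos.2 ht))]
  gcongr
  exact hwS _ (sub_pos.2 ht) x

section MildSolution

variable {ε : ℝ} {f : Z → Z} {r d : ℝ → ℝ} {z₀ : Z} {z : ℝ → Z}

theorem enorm_f_le (hf0 : f 0 = 0) (hs₁ : 0 ≤ s₁)
    (hf : ∀ φ₁ ∈ range (P.T.negPow s₁), ∀ φ₂ ∈ range (P.T.negPow s₁),
      ‖f φ₁ - f φ₂‖ₑ ≤ ENNReal.ofReal ε * P.T.fracNorm s₁ (φ₁ - φ₂))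
    (hz : P.IsMildSolution β S s₁ f r d z₀ z) {t : ℝ} (ht : 0 < t) :
    ‖f (z t)‖ₑ ≤ ENNReal.ofReal ε * P.T.fracNorm s₁ (z t) := by
  obtain ⟨⟨y, hy, -, -⟩, -⟩ := hz
  have h := hf (z t) ⟨y t, (hy t ht).symm⟩ 0
    ⟨0, by rw [← P.stable.negPowL_apply hs₁, map_zero]⟩
  rwa [hf0, sub_zero, sub_zero] at h

theorem IsMildSolution.fracNorm_le (hs₁ : 0 ≤ s₁) (hz : P.IsMildSolution β S s₁ f r d z₀ z) :
    ContinuousOn z (Ioi 0) ∧ (∀ T, ∫⁻ τ in Ioc 0 T, P.T.fracNorm s₁ (z τ) ≠ ⊤) ∧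
      ∀ t T, 0 < t → ∃ M : ℝ≥0∞, M ≠ ⊤ ∧ ∀ τ ∈ Icc t T, P.T.fracNorm s₁ (z τ) ≤ M := by
  obtain ⟨⟨y, hy, hyc, hyi⟩, -⟩ := hz
  have hy' : ∀ t, 0 < t → z t = P.T.negPowL s₁ (y t) := fun t ht => by
    rw [hy t ht, P.stable.negPowL_apply hs₁]
  have hle : ∀ t, 0 < t → P.T.fracNorm s₁ (z t) ≤ ‖y t‖ₑ := fun t ht => by
    rw [P.stable.fracNorm_eq hs₁, hy' t ht]
    exact imgNorm_apply_le _ _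
  refine ⟨?_, fun T => ?_, fun t T ht => ?_⟩
  · exact ((P.T.negPowL s₁).continuous.comp_continuousOn hyc).congr fun t ht => hy' t ht
  · rcases le_or_gt T 0 with hT | hT
    · simp [Ioc_eq_empty_of_le hT]
    · exact ne_top_of_le_ne_top (hyi T hT).2.ne
        (setLIntegral_mono' measurableSet_Ioc fun τ hτ => hle τ hτ.1)
  · obtain ⟨M, hM⟩ := isCompact_Icc.exists_bound_of_continuousOn
      (hyc.mono (fun τ hτ => ht.trans_le hτ.1 : Icc t T ⊆ Ioi 0))
    refine ⟨ENNReal.ofReal M, ENNReal.ofReal_ne_top, fun τ hτ =>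
      (hle τ (ht.trans_le hτ.1)).trans ?_⟩
    rw [← ofReal_norm]
    exact ENNReal.ofReal_le_ofReal (hM τ hτ)

/-- The mild formula measured in Z^{s₁}. Its integrals are only assumed to converge in `Z`, and
Minkowski's inequality for range norms bridges the gap. -/
theorem IsMildSolution.fracNorm_le_conv (hG : P.G ≠ 0) (hβ : β ∈ Ioo (0 : ℝ) 1)
    (hS : S.GeneratedBy (P.regGraph β)) (hSs : S.ExpStable) (hs₁ : s₁ ∈ Ioo (0 : ℝ) 1)
    (hf0 : f 0 = 0) (hf : ∀ φ₁ ∈ range (P.T.negPow s₁), ∀ φ₂ ∈ range (P.T.negPow s₁),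
      ‖f φ₁ - f φ₂‖ₑ ≤ ENNReal.ofReal ε * P.T.fracNorm s₁ (φ₁ - φ₂)) (hr : IsCb1 r)
    (hz : P.IsMildSolution β S s₁ f r d z₀ z) {t : ℝ} (ht : 0 < t) :
    P.T.fracNorm s₁ (z t) ≤ P.T.fracNorm s₁ (S.op t z₀) +
      (conv (fun σ => P.T.fracNorm s₁ (β⁻¹ • P.SB S σ)) (fun τ => ‖r τ‖ₑ) t +
        conv (fun σ => P.T.fracNorm s₁ (P.SI0Bd S σ)) (fun τ => ‖d τ‖ₑ) t) +
      ENNReal.ofReal ε * conv (P.kerA S s₁) (fun τ => P.T.fracNorm s₁ (z τ)) t := by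
  have hs := hs₁.1.le
  have hinj := P.stable.negPowL_injective hs hs₁.2.le
  have hden := P.stable.denseRange_negPowL hs hs₁.2.le
  obtain ⟨i1, i2, e⟩ := hz.2 t ht.le
  have hcB : ContinuousOn (fun t => β⁻¹ • P.SB S t) (Ioi 0) :=
    (continuousOn_SB hG hβ hS hSs).const_smul β⁻¹
  have hsub : ContinuousOn (fun τ => t - τ) (Ioo 0 t) := by fun_prop
  have hmB : AEMeasurable (fun τ => P.T.fracNorm s₁ (β⁻¹ • P.SB S (t - τ)) * ‖r τ‖ₑ)
      (volume.restrict (Ioo 0 t)) :=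
    (P.aemeasurable_fracNorm_comp hs₁ measurableSet_Ioo (F := fun τ => β⁻¹ • P.SB S (t - τ))
      (hcB.comp hsub fun τ hτ => sub_pos.2 hτ.2)).mul
      ((hr.continuousOn.mono fun τ hτ => hτ.1.le).aestronglyMeasurable
        measurableSet_Ioo).aemeasurable.enorm
  have hle1 : P.T.fracNorm s₁ (∫ τ in (0 : ℝ)..t,
      ((β⁻¹ * r τ) • P.SB S (t - τ) + d τ • P.SI0Bd S (t - τ))) ≤
      conv (fun σ => P.T.fracNorm s₁ (β⁻¹ • P.SB S σ)) (fun τ => ‖r τ‖ₑ) t +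
        conv (fun σ => P.T.fracNorm s₁ (P.SI0Bd S σ)) (fun τ => ‖d τ‖ₑ) t := by
    rw [conv, conv, ← lintegral_add_left' hmB, P.stable.fracNorm_eq hs]
    refine (imgNorm_intervalIntegral_le hinj hden ht.le i1).trans (lintegral_mono fun τ => ?_)
    rw [← P.stable.fracNorm_eq hs]
    refine (P.fracNorm_add_le hs _ _).trans (add_le_add ?_ ?_)
    · rw [mul_comm β⁻¹, ← smul_smul, mul_comm _ ‖r τ‖ₑ]
      exact P.fracNorm_smul_le hs _ _
    · rw [mul_comm]
      exact P.fracNorm_smul_le hs _ _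
  have hle2 : P.T.fracNorm s₁ (∫ τ in (0 : ℝ)..t, P.SI0 S (t - τ) (f (z τ))) ≤
      ENNReal.ofReal ε * conv (P.kerA S s₁) (fun τ => P.T.fracNorm s₁ (z τ)) t := by
    rw [conv, ← lintegral_const_mul' _ _ ENNReal.ofReal_ne_top, P.stable.fracNorm_eq hs]
    refine (imgNorm_intervalIntegral_le hinj hden ht.le i2).trans
      (setLIntegral_mono' measurableSet_Ioo fun τ hτ => ?_)
    rw [← P.stable.fracNorm_eq hs, mul_left_comm]
    refine (P.fracNorm_SI0_le S hs _ _).trans ?_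
    gcongr
    exact enorm_f_le hf0 hs hf hz hτ.1
  rw [e]
  refine (P.fracNorm_add_le hs _ _).trans (add_le_add ?_ hle2)
  exact (P.fracNorm_add_le hs _ _).trans (add_le_add le_rfl hle1)

/-- By `C_linear_part` the value r(t) cancels and d(t) does not occur, so only the derivatives and
the initial values of r and d remain in the linear terms. -/
theorem IsMildSolution.enorm_error_le (hG : P.G ≠ 0) (hβ : β ∈ Ioo (0 : ℝ) 1)
    (hS : S.GeneratedBy (P.regGraph β)) (hSs : S.ExpStable) (hs₁ : s₁ ∈ Ioo (0 : ℝ) 1)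
    (hf0 : f 0 = 0) (hf : ∀ φ₁ ∈ range (P.T.negPow s₁), ∀ φ₂ ∈ range (P.T.negPow s₁),
      ‖f φ₁ - f φ₂‖ₑ ≤ ENNReal.ofReal ε * P.T.fracNorm s₁ (φ₁ - φ₂)) (hr : IsCb1 r) (hd : IsCb1 d)
    (hz : P.IsMildSolution β S s₁ f r d z₀ z) {t : ℝ} (ht : 0 < t) :
    ‖r t - P.C (z t)‖ₑ ≤ ‖P.K β S t * r 0 + P.Kd S t * d 0‖ₑ + ‖P.C (S.op t z₀)‖ₑ +
      (conv (fun σ => ‖P.K β S σ‖ₑ) (fun τ => ‖derivWithin r (Ici 0) τ‖ₑ) t +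
        conv (fun σ => ‖P.Kd S σ‖ₑ) (fun τ => ‖derivWithin d (Ici 0) τ‖ₑ) t) +
      ENNReal.ofReal ε * conv (P.kerH S) (fun τ => P.T.fracNorm s₁ (z τ)) t := by
  have hs := hs₁.1.le
  obtain ⟨c, hc, hC⟩ := P.exists_C_bound
  obtain ⟨w, hw, hwS⟩ := exists_weight_imgNorm_SI0 hG hβ hS hSs
  obtain ⟨-, hni, hnb⟩ := hz.fracNorm_le hs
  obtain ⟨i1, i2, e⟩ := hz.2 t ht.le
  -- C may be moved inside the nonlinear integral once this is finite. The factor ‖z‖_{s₁} is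
  -- integrable near 0 and bounded on [t/2, t], which is the situation of `IsWeight.conv_ne_top`.
  have hfin : ∫⁻ τ in Ioo 0 t, imgNorm (P.T.negPowL P.sc) (P.SI0 S (t - τ) (f (z τ))) ≠ ⊤ := by
    obtain ⟨M, hM, hMn⟩ := hnb (t / 2) t (by linarith)
    have h1 := hw.conv_ne_top ht (hni t) hM hMn
    refine ne_top_of_le_ne_top (ENNReal.mul_ne_top (ENNReal.ofReal_ne_top (r := ε)) h1) ?_
    rw [conv, ← lintegral_const_mul' _ _ ENNReal.ofReal_ne_top]
    refine setLIntegral_mono' measurableSet_Ioo fun τ hτ => ?_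
    rw [mul_left_comm]
    refine (hwS _ (sub_pos.2 hτ.2) _).trans ?_
    gcongr
    exact enorm_f_le hf0 hs hf hz hτ.1
  obtain ⟨-, hC2⟩ := integrableOn_and_map_intervalIntegral
    (P.stable.negPowL_injective P.sc_mem.1 P.sc_mem.2.le)
    (P.stable.denseRange_negPowL P.sc_mem.1 P.sc_mem.2.le) hC hc ht.le i2 hfin
  have hid : r t - P.C (z t) = (P.K β S t * r 0 + P.Kd S t * d 0) + -P.C (S.op t z₀) +
      ((∫ τ in Ioo 0 t, derivWithin r (Ici 0) τ * P.K β S (t - τ)) +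
        ∫ τ in Ioo 0 t, derivWithin d (Ici 0) τ * P.Kd S (t - τ)) +
      -∫ τ in Ioo 0 t, P.C (P.SI0 S (t - τ) (f (z τ))) := by
    rw [e, map_add, map_add, C_linear_part hG hβ hS hSs hr hd ht, hC2]
    ring
  have hconv : ∀ (g h : ℝ → ℝ), ‖∫ τ in Ioo 0 t, g τ * h (t - τ)‖ₑ ≤
      conv (fun σ => ‖h σ‖ₑ) (fun τ => ‖g τ‖ₑ) t := fun g h => by
    refine (enorm_integral_le_lintegral_enorm _).trans (lintegral_mono fun τ => ?_)
    rw [enorm_mul, mul_comm]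
  rw [hid]
  refine (enorm_add_le _ _).trans (add_le_add ((enorm_add_le _ _).trans (add_le_add
    ((enorm_add_le _ _).trans_eq (by rw [enorm_neg])) ((enorm_add_le _ _).trans
    (add_le_add (hconv _ _) (hconv _ _))))) ?_)
  rw [enorm_neg, conv, ← lintegral_const_mul' _ _ ENNReal.ofReal_ne_top]
  refine (enorm_integral_le_lintegral_enorm _).trans
    (setLIntegral_mono' measurableSet_Ioo fun τ hτ => ?_)
  rw [mul_left_comm]
  refine (P.enorm_C_SI0_le S _ _).trans ?_
  gcongr
  exact enorm_f_le hf0 hs hf hz hτ.1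

end MildSolution

end Plant

/-! ### The error bounds. -/

namespace Plant

variable {P : Plant Z} {β : ℝ} {S : C0Semigroup Z} {s₁ : ℝ}

theorem tendsto_enorm_C_op (hG : P.G ≠ 0) (hβ : β ∈ Ioo (0 : ℝ) 1)
    (hS : S.GeneratedBy (P.regGraph β)) (hSs : S.ExpStable) (x : Z) :
    Tendsto (fun t => ‖P.C (S.op t x)‖ₑ) atTop (𝓝 0) := by
  obtain ⟨c, hc, hC⟩ := P.exists_C_bound
  obtain ⟨c', ω, hc', hω, h⟩ := imgNorm_extL_le_wt hG hβ hS hSs le_rfl (by simpa using P.sc_mem.2)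
  have hw := (IsWeight.wt hc' hω (by simpa using P.sc_mem.1) (by simpa using P.sc_mem.2)
    (p := P.sc + 0)).const_mul (mul_nonneg hc.le (norm_nonneg x))
  refine hw.tendsto_of_le fun t ht => ?_
  have e := (smooths_S hG hβ hS hSs le_rfl (by simpa using P.sc_mem.2)).extL_apply
    (P.stable.denseRange_negPowL le_rfl zero_le_one) ht x
  rw [P.stable.negPowL_zero] at e
  rw [mul_assoc, ENNReal.ofReal_mul hc.le, ← e, mul_comm ‖x‖]
  exact (enorm_le_mul_imgNorm hC hc _).trans (by gcongr; exact h t ht x)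

section MildSolution

variable {ε : ℝ} {f : Z → Z} {r d : ℝ → ℝ} {z₀ : Z} {z : ℝ → Z}

theorem error_bound_algebra (D Dd DH DB DBd ε q R R' : ℝ≥0∞) :
    D * R + Dd * R' + ε * (DH * ((DB * R + DBd * R') / q)) =
      (D + DH * (DB * ε / q)) * R + (Dd + DH * (DBd * ε / q)) * R' := by
  simp only [div_eq_mul_inv]
  ring

/-- Gronwall on (0, T) bounds ‖z‖_{s₁} by (D_B R + D_{B_d} R')/(1 - ε D_{A_β}), and this is inserted
into the error estimate. `supNorm1` serves twice: the values of r and d drive z, their derivatives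
drive the linear part of the error. -/
theorem IsMildSolution.supNorm_error_le (hG : P.G ≠ 0) (hβ : β ∈ Ioo (0 : ℝ) 1)
    (hS : S.GeneratedBy (P.regGraph β)) (hSs : S.ExpStable) (hs₁ : s₁ ∈ Ioo (0 : ℝ) 1)
    (hf0 : f 0 = 0) (hf : ∀ φ₁ ∈ range (P.T.negPow s₁), ∀ φ₂ ∈ range (P.T.negPow s₁),
      ‖f φ₁ - f φ₂‖ₑ ≤ ENNReal.ofReal ε * P.T.fracNorm s₁ (φ₁ - φ₂))
    (hDB : P.DB β S s₁ (Ioi 0) ≠ ⊤) (hDBd : P.DBd S s₁ (Ioi 0) ≠ ⊤)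
    (hDA : ENNReal.ofReal ε * P.DA S s₁ (Ioi 0) < 1) (hr : IsCb1 r) (hd : IsCb1 d)
    (hz : P.IsMildSolution β S s₁ f r d 0 z)
    (h0 : ∀ t, 0 < t → P.K β S t * r 0 + P.Kd S t * d 0 = 0) (T : ℝ) :
    supNorm (fun t => r t - P.C (z t)) (Ioo 0 T) ≤
      (P.D β S + P.calD β S s₁ ε (Ioo 0 T)) * supNorm1 r (Ioo 0 T) +
      (P.Dd S + P.calDd S s₁ ε (Ioo 0 T)) * supNorm1 d (Ioo 0 T) := by
  have hfin : ∀ {g : ℝ → ℝ}, IsCb1 g → supNorm1 g (Ioo 0 T) ≠ ⊤ ∧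
      ∀ t ∈ Ioo 0 T, ‖g t‖ₑ ≤ supNorm1 g (Ioo 0 T) ∧
        ‖derivWithin g (Ici 0) t‖ₑ ≤ supNorm1 g (Ioo 0 T) := fun {g} hg => by
    obtain ⟨M, hM, h⟩ := hg.exists_bound
    refine ⟨ne_top_of_le_ne_top hM (max_le (iSup₂_le fun t ht => (h t ht.1.le).1)
      (iSup₂_le fun t ht => (h t ht.1.le).2)), fun t ht => ⟨?_, ?_⟩⟩
    · exact (le_iSup₂ (f := fun t (_ : t ∈ Ioo 0 T) => ‖g t‖ₑ) t ht).trans (le_max_left _ _)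
    · exact (le_iSup₂ (f := fun t (_ : t ∈ Ioo 0 T) => ‖derivWithin g (Ici 0) t‖ₑ) t ht).trans
        (le_max_right _ _)
  obtain ⟨hRt, hR⟩ := hfin hr
  obtain ⟨hRt', hR'⟩ := hfin hd
  set R := supNorm1 r (Ioo 0 T)
  set R' := supNorm1 d (Ioo 0 T)
  obtain ⟨hzc, hni, -⟩ := hz.fracNorm_le hs₁.1.le
  have hsub : Ioo (0 : ℝ) T ⊆ Ioi 0 := Ioo_subset_Ioi_self
  have hDBT : P.DB β S s₁ (Ioo 0 T) ≠ ⊤ := ne_top_of_le_ne_top hDB (lintegral_mono_set hsub)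
  have hDBdT : P.DBd S s₁ (Ioo 0 T) ≠ ⊤ := ne_top_of_le_ne_top hDBd (lintegral_mono_set hsub)
  have hq : ENNReal.ofReal ε * P.DA S s₁ (Ioo 0 T) < 1 :=
    lt_of_le_of_lt (mul_le_mul_right (lintegral_mono_set hsub) _) hDA
  have hc : P.DB β S s₁ (Ioo 0 T) * R + P.DBd S s₁ (Ioo 0 T) * R' ≠ ⊤ :=
    ENNReal.add_ne_top.2 ⟨ENNReal.mul_ne_top hDBT hRt, ENNReal.mul_ne_top hDBdT hRt'⟩
  have hconv : ∀ {k : ℝ → ℝ≥0∞} {g : ℝ → ℝ≥0∞} {M : ℝ≥0∞} {t : ℝ}, M ≠ ⊤ →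
      (∀ τ ∈ Ioo 0 T, g τ ≤ M) → t ∈ Ioo 0 T → conv k g t ≤ (∫⁻ σ in Ioo 0 T, k σ) * M :=
    fun hM hg ht => (conv_le hM fun τ hτ => hg τ ⟨hτ.1, hτ.2.trans ht.2⟩).trans
      (mul_le_mul_left (lintegral_mono_set (Ioo_subset_Ioo_right ht.2.le)) _)
  have hn : ∀ t ∈ Ioo 0 T, P.T.fracNorm s₁ (z t) ≤
      (P.DB β S s₁ (Ioo 0 T) * R + P.DBd S s₁ (Ioo 0 T) * R') /
        (1 - ENNReal.ofReal ε * P.DA S s₁ (Ioo 0 T)) := by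
    intro t ht
    refine le_of_le_add_conv (a := P.kerA S s₁) (n := fun t => P.T.fracNorm s₁ (z t))
      ENNReal.ofReal_ne_top hc ((aemeasurable_kerA hG hβ hS hSs hs₁).mono_set hsub)
      (P.aemeasurable_fracNorm_comp hs₁ measurableSet_Ioo (hzc.mono hsub))
      (ne_top_of_le_ne_top (hni T) (lintegral_mono_set Ioo_subset_Ioc_self)) hq
      (fun τ hτ => ?_) ht
    refine (hz.fracNorm_le_conv hG hβ hS hSs hs₁ hf0 hf hr hτ.1).trans ?_
    rw [map_zero, P.stable.fracNorm_eq hs₁.1.le 0, imgNorm_zero, zero_add]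
    gcongr
    · exact hconv hRt (fun t ht => (hR t ht).1) hτ
    · exact hconv hRt' (fun t ht => (hR' t ht).1) hτ
  refine iSup₂_le fun t ht => (hz.enorm_error_le hG hβ hS hSs hs₁ hf0 hf hr hd ht.1).trans ?_
  rw [h0 t ht.1, map_zero, map_zero, enorm_zero, zero_add, zero_add, calD, calDd,
    ← error_bound_algebra]
  have hc' : (P.DB β S s₁ (Ioo 0 T) * R + P.DBd S s₁ (Ioo 0 T) * R') /
      (1 - ENNReal.ofReal ε * P.DA S s₁ (Ioo 0 T)) ≠ ⊤ :=
    (ENNReal.div_lt_top hc (tsub_pos_of_lt hq).ne').ne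
  gcongr
  · exact (hconv hRt (fun t ht => (hR t ht).2) ht).trans
      (mul_le_mul_left (lintegral_mono_set hsub) _)
  · exact (hconv hRt' (fun t ht => (hR' t ht).2) ht).trans
      (mul_le_mul_left (lintegral_mono_set hsub) _)
  · exact (hconv hc' hn ht).trans (mul_le_mul_left (lintegral_mono_set hsub) _)

/-- The same two estimates at the level of upper limits. They need kernels that tend to 0, which
integrability alone does not give: in Z^{s₁} this comes from `exists_fracNorm_op_le`, for the output
kernels from their weights. The transients due to z₀, r(0) and d(0) die out. -/
theorem IsMildSolution.limsupNorm_error_le (hG : P.G ≠ 0) (hβ : β ∈ Ioo (0 : ℝ) 1)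
    (hS : S.GeneratedBy (P.regGraph β)) (hSs : S.ExpStable) (hs₁ : s₁ ∈ Ioo (0 : ℝ) 1)
    (hε : 0 < ε)
    (hf0 : f 0 = 0) (hf : ∀ φ₁ ∈ range (P.T.negPow s₁), ∀ φ₂ ∈ range (P.T.negPow s₁),
      ‖f φ₁ - f φ₂‖ₑ ≤ ENNReal.ofReal ε * P.T.fracNorm s₁ (φ₁ - φ₂))
    (hDB : P.DB β S s₁ (Ioi 0) ≠ ⊤) (hDBd : P.DBd S s₁ (Ioi 0) ≠ ⊤)
    (hDA : ENNReal.ofReal ε * P.DA S s₁ (Ioi 0) < 1) (hr : IsCb1 r) (hd : IsCb1 d)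
    (hz : P.IsMildSolution β S s₁ f r d z₀ z) :
    limsupNorm (fun t => r t - P.C (z t)) ≤
      (P.D β S + P.calD β S s₁ ε (Ioi 0)) * limsupNorm1 r +
      (P.Dd S + P.calDd S s₁ ε (Ioi 0)) * limsupNorm1 d := by
  have hDAt : P.DA S s₁ (Ioi 0) ≠ ⊤ := by
    intro h
    rw [h, ENNReal.mul_top (by simpa using hε)] at hDA
    exact absurd hDA (by simp)
  obtain ⟨t', Λ, ht', hΛ, hsm⟩ := exists_fracNorm_op_le hG hβ hS hSs hs₁ hDB hDAt
  have hdecay : ∀ {F : ℝ → Z} {w : ℝ → ℝ}, IsWeight w → (∀ t, 0 < t → ‖F t‖ ≤ w t) →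
      Tendsto F atTop (𝓝 0) := fun hw h =>
    squeeze_zero_norm' (by filter_upwards [eventually_gt_atTop 0] with t ht using h t ht) hw.tendsto
  have hB0 : Tendsto (fun t => P.T.fracNorm s₁ (β⁻¹ • P.SB S t)) atTop (𝓝 0) := by
    obtain ⟨w, hw, h⟩ := exists_weight_SB hG hβ hS hSs
    refine tendsto_fracNorm_of_op ht' hΛ hsm (F := fun t => β⁻¹ • P.SB S t)
      (fun τ t hτ ht => by rw [map_smul, op_SB hG hβ hS hSs hτ ht]) ?_
    simpa using (hdecay hw h).const_smul β⁻¹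
  have hBd0 : Tendsto (fun t => P.T.fracNorm s₁ (P.SI0Bd S t)) atTop (𝓝 0) := by
    obtain ⟨w, hw, h⟩ := exists_weight_SI0Bd hG hβ hS hSs
    exact tendsto_fracNorm_of_op ht' hΛ hsm (F := fun t => P.SI0Bd S t)
      (fun τ t hτ ht => op_SI0Bd hG hβ hS hSs hτ ht) (hdecay hw h)
  have hA0 := tendsto_kerA hG hβ hS hSs ht' hΛ hsm
  have hz0 : Tendsto (fun t => P.T.fracNorm s₁ (S.op t z₀)) atTop (𝓝 0) :=
    tendsto_fracNorm_of_op ht' hΛ hsm (F := fun t => S.op t z₀)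
      (fun τ t hτ ht => (S.op_add_apply hτ ht.le z₀).symm) (hSs.tendsto_op_atTop z₀)
  obtain ⟨-, hni, hnb⟩ := hz.fracNorm_le hs₁.1.le
  obtain ⟨M, hM, hrM⟩ := hr.exists_bound
  obtain ⟨M', hM', hdM⟩ := hd.exists_bound
  have hconv : ∀ {k g : ℝ → ℝ≥0∞} {M : ℝ≥0∞}, Tendsto k atTop (𝓝 0) →
      ∫⁻ σ in Ioi 0, k σ ≠ ⊤ → M ≠ ⊤ → (∀ t, 0 ≤ t → g t ≤ M) →
      limsup (conv k g) atTop ≤ (∫⁻ σ in Ioi 0, k σ) * limsup g atTop := fun hk hki hM hg =>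
    limsup_conv_le hk hki (setLIntegral_Ioc_ne_top_of_le hM hg) (limsup_ne_top_of_le hM hg)
  have hlim1 : ∀ {g : ℝ → ℝ} {M : ℝ≥0∞}, M ≠ ⊤ →
      (∀ t, 0 ≤ t → ‖g t‖ₑ ≤ M ∧ ‖derivWithin g (Ici 0) t‖ₑ ≤ M) → limsupNorm1 g ≠ ⊤ :=
    fun hM h => (max_lt (limsup_ne_top_of_le hM fun t ht => (h t ht).1).lt_top
      (limsup_ne_top_of_le hM fun t ht => (h t ht).2).lt_top).ne
  set R := limsupNorm1 r
  set R' := limsupNorm1 d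
  have hRt : R ≠ ⊤ := hlim1 hM hrM
  have hRt' : R' ≠ ⊤ := hlim1 hM' hdM
  have hc : P.DB β S s₁ (Ioi 0) * R + P.DBd S s₁ (Ioi 0) * R' ≠ ⊤ :=
    ENNReal.add_ne_top.2 ⟨ENNReal.mul_ne_top hDB hRt, ENNReal.mul_ne_top hDBd hRt'⟩
  have hp : limsup ((fun t => P.T.fracNorm s₁ (S.op t z₀)) +
      (conv (fun σ => P.T.fracNorm s₁ (β⁻¹ • P.SB S σ)) (fun τ => ‖r τ‖ₑ) +
        conv (fun σ => P.T.fracNorm s₁ (P.SI0Bd S σ)) (fun τ => ‖d τ‖ₑ))) atTop ≤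
      P.DB β S s₁ (Ioi 0) * R + P.DBd S s₁ (Ioi 0) * R' := by
    refine (limsup_add_le_enn _ _).trans ?_
    rw [hz0.limsup_eq, zero_add]
    refine (limsup_add_le_enn _ _).trans (add_le_add ?_ ?_)
    · exact (hconv hB0 hDB hM fun t ht => (hrM t ht).1).trans
        (mul_le_mul_right (le_max_left _ _) _)
    · exact (hconv hBd0 hDBd hM' fun t ht => (hdM t ht).1).trans
        (mul_le_mul_right (le_max_left _ _) _)
  have hn : limsup (fun t => P.T.fracNorm s₁ (z t)) atTop ≤
      (P.DB β S s₁ (Ioi 0) * R + P.DBd S s₁ (Ioi 0) * R') /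
        (1 - ENNReal.ofReal ε * P.DA S s₁ (Ioi 0)) :=
    (limsup_le_of_le_add_conv ENNReal.ofReal_ne_top hA0 hDAt hDA hni
      (fun T => hnb 1 T one_pos) (ne_top_of_le_ne_top hc hp) fun t ht =>
        hz.fracNorm_le_conv hG hβ hS hSs hs₁ hf0 hf hr ht).trans (ENNReal.div_le_div_right hp _)
  have hnt : limsup (fun t => P.T.fracNorm s₁ (z t)) atTop ≠ ⊤ :=
    ne_top_of_le_ne_top (ENNReal.div_lt_top hc (tsub_pos_of_lt hDA).ne').ne hn
  obtain ⟨wK, hwK, hK⟩ := exists_weight_K hG hβ hS hSs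
  obtain ⟨wKd, hwKd, hKd⟩ := exists_weight_Kd hG hβ hS hSs
  obtain ⟨wH, hwH, hH⟩ := exists_weight_kerH hG hβ hS hSs
  have hK0 := hwK.tendsto_of_le hK
  have hKd0 := hwKd.tendsto_of_le hKd
  have htrans : Tendsto (fun t => ‖P.K β S t * r 0 + P.Kd S t * d 0‖ₑ + ‖P.C (S.op t z₀)‖ₑ)
      atTop (𝓝 0) := by
    have h1 : Tendsto (fun t => ‖P.K β S t‖ₑ * ‖r 0‖ₑ + ‖P.Kd S t‖ₑ * ‖d 0‖ₑ +
        ‖P.C (S.op t z₀)‖ₑ) atTop (𝓝 0) := by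
      simpa using ((ENNReal.Tendsto.mul_const hK0 (Or.inr enorm_ne_top)).add
        (ENNReal.Tendsto.mul_const hKd0 (Or.inr enorm_ne_top))).add
        (tendsto_enorm_C_op hG hβ hS hSs z₀)
    refine tendsto_of_tendsto_of_tendsto_of_le_of_le tendsto_const_nhds h1
      (fun _ => zero_le) fun t => ?_
    refine add_le_add ((enorm_add_le _ _).trans_eq ?_) le_rfl
    rw [enorm_mul, enorm_mul]
  calc limsupNorm (fun t => r t - P.C (z t))
      ≤ limsup ((fun t => ‖P.K β S t * r 0 + P.Kd S t * d 0‖ₑ + ‖P.C (S.op t z₀)‖ₑ) +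
          (conv (fun σ => ‖P.K β S σ‖ₑ) (fun τ => ‖derivWithin r (Ici 0) τ‖ₑ) +
            conv (fun σ => ‖P.Kd S σ‖ₑ) (fun τ => ‖derivWithin d (Ici 0) τ‖ₑ)) +
          (fun t => ENNReal.ofReal ε *
            conv (P.kerH S) (fun τ => P.T.fracNorm s₁ (z τ)) t)) atTop :=
        limsup_le_limsup (by
          filter_upwards [eventually_gt_atTop 0] with t ht
          exact hz.enorm_error_le hG hβ hS hSs hs₁ hf0 hf hr hd ht)
    _ ≤ P.D β S * R + P.Dd S * R' + ENNReal.ofReal ε * (P.DH S *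
          ((P.DB β S s₁ (Ioi 0) * R + P.DBd S s₁ (Ioi 0) * R') /
            (1 - ENNReal.ofReal ε * P.DA S s₁ (Ioi 0)))) := by
        refine (limsup_add_le_enn _ _).trans (add_le_add ?_ ?_)
        · refine (limsup_add_le_enn _ _).trans ?_
          rw [htrans.limsup_eq, zero_add]
          refine (limsup_add_le_enn _ _).trans (add_le_add ?_ ?_)
          · exact (hconv hK0 (hwK.lintegral_ne_top_of_le hK) hM fun t ht => (hrM t ht).2).trans
              (mul_le_mul_right (le_max_right _ _) _)
          · exact (hconv hKd0 (hwKd.lintegral_ne_top_of_le hKd) hM' fun t ht =>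
              (hdM t ht).2).trans (mul_le_mul_right (le_max_right _ _) _)
        · rw [ENNReal.limsup_const_mul_of_ne_top ENNReal.ofReal_ne_top]
          gcongr
          exact (limsup_conv_le (hwH.tendsto_of_le hH) (hwH.lintegral_ne_top_of_le hH) hni
            hnt).trans (mul_le_mul_right hn _)
    _ = _ := by rw [calD, calDd, error_bound_algebra]

end MildSolution

end Plant

end Regulation

end

theorem mainTheorem3 {Z : Type*} [NormedAddCommGroup Z] [InnerProductSpace ℝ Z] [CompleteSpace Z]
    (P : Regulation.Plant Z) (hG : P.G ≠ 0)
    (β : ℝ) (hβ : β ∈ Set.Ioo (0 : ℝ) 1)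
    (S : Regulation.C0Semigroup Z) (hS : S.GeneratedBy (P.regGraph β)) (hSstable : S.ExpStable)
    (s₁ ε : ℝ) (hs₁ : s₁ ∈ Set.Ioo (0 : ℝ) 1) (hε : 0 < ε)
    (f : Z → Z) (hf0 : f 0 = 0)
    (hf : ∀ φ₁ ∈ Set.range (P.T.negPow s₁), ∀ φ₂ ∈ Set.range (P.T.negPow s₁),
      ‖f φ₁ - f φ₂‖ₑ ≤ ENNReal.ofReal ε * P.T.fracNorm s₁ (φ₁ - φ₂))
    (hDB : P.DB β S s₁ (Set.Ioi 0) ≠ ⊤) (hDBd : P.DBd S s₁ (Set.Ioi 0) ≠ ⊤)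
    (hDA : ENNReal.ofReal ε * P.DA S s₁ (Set.Ioi 0) < 1)
    (r d : ℝ → ℝ) (hr : Regulation.IsCb1 r) (hd : Regulation.IsCb1 d)
    (z₀ : Z) (z : ℝ → Z) (hz : P.IsMildSolution β S s₁ f r d z₀ z)
    (e₀ : ℝ → ℝ) (he₀ : ∀ t, e₀ t = r t - P.C (z t)) :
    (P.D β S ≠ ⊤ ∧ P.Dd S ≠ ⊤ ∧ P.DH S ≠ ⊤) ∧
    (z₀ = 0 → (∀ t, 0 < t → P.K β S t * r 0 + P.Kd S t * d 0 = 0) →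
      ∀ t, 0 < t →
        Regulation.supNorm e₀ (Set.Ioo 0 t) ≤
          (P.D β S + P.calD β S s₁ ε (Set.Ioo 0 t)) * Regulation.supNorm1 r (Set.Ioo 0 t) +
          (P.Dd S + P.calDd S s₁ ε (Set.Ioo 0 t)) * Regulation.supNorm1 d (Set.Ioo 0 t)) ∧
    Regulation.limsupNorm e₀ ≤
      (P.D β S + P.calD β S s₁ ε (Set.Ioi 0)) * Regulation.limsupNorm1 r +
      (P.Dd S + P.calDd S s₁ ε (Set.Ioi 0)) * Regulation.limsupNorm1 d := by
  obtain rfl : e₀ = fun t => r t - P.C (z t) := funext he₀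
  obtain ⟨_, hwK, hK⟩ := Regulation.Plant.exists_weight_K hG hβ hS hSstable
  obtain ⟨_, hwKd, hKd⟩ := Regulation.Plant.exists_weight_Kd hG hβ hS hSstable
  obtain ⟨_, hwH, hH⟩ := Regulation.Plant.exists_weight_kerH hG hβ hS hSstable
  refine ⟨⟨hwK.lintegral_ne_top_of_le hK, hwKd.lintegral_ne_top_of_le hKd,
    hwH.lintegral_ne_top_of_le hH⟩, ?_, ?_⟩
  · rintro rfl h0 t -
    exact hz.supNorm_error_le hG hβ hS hSstable hs₁ hf0 hf hDB hDBd hDA hr hd h0 t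
  · exact hz.limsupNorm_error_le hG hβ hS hSstable hs₁ hε hf0 hf hDB hDBd hDA hr hd
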